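/- Let $(X^n,g)$ be a Riemannian manifold (smooth, Hausdorff, second countable, without boundary) of dimension $n\ge 1$. A straight and normal ambient space of $(X,g)$ is a smooth family of Riemannian metrics $g_\rho$, $|\rho|<\varepsilon$, on $X$ with $g_0=g$ such that the metric $\widetilde g=2\rho\,d\tau^2+2\tau\,d\tau\,d\rho+\tau^2g_\rho$ on $(0,\infty)\times X\times(-\varepsilon,\varepsilon)$ satisfies $\mathrm{Ric}(\widetilde g)=O(\rho^\infty)$ if $n$ is odd and $\mathrm{Ric}(\widetilde g)=O^+(\rho^{n/2-1})$ if $n$ is even. (Here $S=O^+(\rho^m)$ means that $\rho^{-m}S$ extends continuously to $\rho=0$ and that its pullback to $\{\rho=0\}$ is, at each point, the pullback of a symmetric form on $T_xX$ that is trace-free with respect to $g$.) Let $\widetilde\Delta$ be the Laplace–Beltrami operator of $\widetilde g$, $w=(\det g_\rho/\det g)^{1/4}$ and $\widetilde\Delta_w=w\circ\widetilde\Delta\circ w^{-1}$. Let $\widetilde{\mathcal M}(\rho)$ be the second-order operator on $X$ determined by $$\widetilde\Delta_w(\tau^\gamma u)=\tau^{\gamma-2}\bigl[-2\rho\,\partial_\rho^2+(2\gamma+n-2)\partial_\rho+\widetilde{\mathcal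 M}(\rho)\bigr]u,\qquad u=u(x,\rho),\ \gamma\in\mathbb R,$$ and put $\mathcal R_j=-2\rho\,\partial_\rho^2+2j\,\partial_\rho+\widetilde{\mathcal M}(\rho)$ for $j\in\mathbb R$. For integers $0\le N\le M$ and $L\in\mathbb R$ define, for smooth $u$ on $X$, $$D_{M,L}\circ\mathcal P_N(u)=\mathcal R_{L+1-2M}\cdots\mathcal R_{L-3}\mathcal R_{L-1}(\rho^N u)\Big|_{\rho=0}.$$ The GJMS operator of order $2k$ is $P_{2k}(u)=\widetilde\Delta^k(\tau^{k-n/2}u)\big|_{\tau=1,\rho=0}$ (with $P_0=\mathrm{id}$). The operator $D_{M,L}\circ\mathcal P_N$ is called formally self-adjoint (in dimension $n$) if, for every $n$-dimensional Riemannian manifold $(X,g)$ and every straight and normal ambient space of it, $\int_X u\,T(v)\,d\mathrm{vol}_g=\int_X v\,T(u)\,d\mathrm{vol}_g$ holds with $T=D_{M,L}\circ\mathcal P_N$ for all compactly supported smooth $u,v$. **Theorem.** Let $0\le N\le M$ be integers. There is a nonzero constant $c$, depending only on $M$ and $N$, such that for every $n\ge1$, with $M-N\le n/2$ if $n$ is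 even, and every $L\in\mathbb R$ the following holds. 1. If $M-N\ge 3$ and $L\notin\{M,M+1,\dots,M+N-1\}$, then $D_{M,L}\circ\mathcal P_N$ is formally self-adjoint if and only if $L=M+N$. 2. If $L=M+N$, then $D_{M,L}\circ\mathcal P_N$ is formally self-adjoint, and $D_{M,L}\circ\mathcal P_N=c\,P_{2(M-N)}$ on every $n$-dimensional Riemannian manifold and every straight and normal ambient space of it. -/

import Mathlib

open scoped Manifold ContDiff Topology
open MeasureTheory Filter

noncomputable section

namespace AmbientGJMS

/-! Pseudo-Riemannian geometry in coordinates. `V` is the coordinate space, `b` the coordinate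
frame, and `G y` the Gram matrix of the metric at the point `y` in this frame. -/

/-- The partial derivative of `f` in the direction of the frame vector `b i`. -/
def pderiv {V ι : Type} [NormedAddCommGroup V] [NormedSpace ℝ V] (b : ι → V) (i : ι)
    (f : V → ℝ) : V → ℝ :=
  fun y => fderiv ℝ f y (b i)

/-- The Laplace-Beltrami operator `|G|^{-1/2} ∂_i (|G|^{1/2} G^{ij} ∂_j f)`. -/
def laplaceBeltrami {V ι : Type} [NormedAddCommGroup V] [NormedSpace ℝ V] [Fintype ι]
    [DecidableEq ι] (b : ι → V) (G : V → Matrix ι ι ℝ) (f : V → ℝ) : V → ℝ :=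
  fun y => (√|(G y).det|)⁻¹ *
    ∑ i, pderiv b i (fun z => √|(G z).det| * ∑ j, (G z)⁻¹ i j * pderiv b j f z) y

/-- The Christoffel symbols `Γ^k_{ij}` of the Levi-Civita connection. -/
def christoffel {V ι : Type} [NormedAddCommGroup V] [NormedSpace ℝ V] [Fintype ι]
    [DecidableEq ι] (b : ι → V) (G : V → Matrix ι ι ℝ) (k i j : ι) : V → ℝ :=
  fun y => (1 / 2 : ℝ) * ∑ l, (G y)⁻¹ k l *
    (pderiv b i (fun z => G z j l) y + pderiv b j (fun z => G z i l) y
      - pderiv b l (fun z => G z i j) y)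

/-- The components
`Ric_{ij} = ∂_k Γ^k_{ij} - ∂_j Γ^k_{ik} + Γ^k_{kl} Γ^l_{ij} - Γ^k_{jl} Γ^l_{ik}`
of the Ricci tensor. -/
def ricci {V ι : Type} [NormedAddCommGroup V] [NormedSpace ℝ V] [Fintype ι]
    [DecidableEq ι] (b : ι → V) (G : V → Matrix ι ι ℝ) (i j : ι) : V → ℝ :=
  fun y =>
    (∑ k, (pderiv b k (christoffel b G k i j) y - pderiv b j (christoffel b G k i k) y))
      + ∑ k, ∑ l, (christoffel b G k k l y * christoffel b G l i j y
        - christoffel b G k j l y * christoffel b G l i k y)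

/-- A one-parameter family `g_ρ` of bilinear forms on the tangent spaces of `X`. -/
abbrev FormFamily (n : ℕ) (X : Type) [TopologicalSpace X]
    [ChartedSpace (EuclideanSpace ℝ (Fin n)) X] : Type :=
  ℝ → (x : X) → TangentSpace (𝓡 n) x →L[ℝ] TangentSpace (𝓡 n) x →L[ℝ] ℝ

/-- The matrix `(g_ρ)_{ij}(y)` of `g_ρ` in the preferred chart of `X` at `p`. -/
def chartGram {n : ℕ} {X : Type} [TopologicalSpace X]
    [ChartedSpace (EuclideanSpace ℝ (Fin n)) X] (g : FormFamily n X) (p : X) (ρ : ℝ)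
    (y : EuclideanSpace ℝ (Fin n)) : Matrix (Fin n) (Fin n) ℝ :=
  Matrix.of fun i j =>
    g ρ ((extChartAt (𝓡 n) p).symm y)
      (mfderiv (𝓡 n) (𝓡 n) (extChartAt (𝓡 n) p).symm y (EuclideanSpace.single i (1 : ℝ)))
      (mfderiv (𝓡 n) (𝓡 n) (extChartAt (𝓡 n) p).symm y (EuclideanSpace.single j (1 : ℝ)))

/-- The coordinate space of the ambient space, with coordinates `(τ, y, ρ)`. -/
abbrev AmbCoord (n : ℕ) : Type := ℝ × EuclideanSpace ℝ (Fin n) × ℝ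

/-- The coordinate directions on the ambient space: `τ`, then those of `X`, then `ρ`. -/
abbrev AmbIdx (n : ℕ) : Type := Unit ⊕ (Fin n ⊕ Unit)

/-- The coordinate frame `∂_τ, ∂_1, …, ∂_n, ∂_ρ`. -/
def ambFrame (n : ℕ) : AmbIdx n → AmbCoord n
  | .inl _ => (1, 0, 0)
  | .inr (.inl i) => (0, EuclideanSpace.single i (1 : ℝ), 0)
  | .inr (.inr _) => (0, 0, 1)

/-- The Gram matrix at `(τ, y, ρ)` of the ambient metric
`2ρ dτ² + 2τ dτ dρ + τ² g_ρ`, in the preferred chart of `X` at `p`. -/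
def ambGram {n : ℕ} {X : Type} [TopologicalSpace X]
    [ChartedSpace (EuclideanSpace ℝ (Fin n)) X] (g : FormFamily n X) (p : X)
    (z : AmbCoord n) : Matrix (AmbIdx n) (AmbIdx n) ℝ :=
  Matrix.of fun
    | .inl _, .inl _ => 2 * z.2.2
    | .inl _, .inr (.inr _) => z.1
    | .inr (.inr _), .inl _ => z.1
    | .inr (.inl i), .inr (.inl j) => z.1 ^ 2 * chartGram g p z.2.2 z.2.1 i j
    | _, _ => 0

/-- The components of the Ricci tensor of the ambient metric in the preferred chart at `p`. -/
def ambRicci {n : ℕ} {X : Type} [TopologicalSpace X]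
    [ChartedSpace (EuclideanSpace ℝ (Fin n)) X] (g : FormFamily n X) (p : X)
    (I J : AmbIdx n) (z : AmbCoord n) : ℝ :=
  ricci (ambFrame n) (ambGram g p) I J z

/-- The filter of approach to the point `(τ, x, 0)` through points with `ρ ≠ 0`. -/
def ambNhds {n : ℕ} {X : Type} [TopologicalSpace X]
    [ChartedSpace (EuclideanSpace ℝ (Fin n)) X] (τ : ℝ) (x : X) : Filter (AmbCoord n) :=
  𝓝[{z | z.2.2 ≠ 0}] (τ, extChartAt (𝓡 n) x x, 0)

/-- `Ric = O(ρ^∞)`. -/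
def RicciFlatToInfiniteOrder {n : ℕ} {X : Type} [TopologicalSpace X]
    [ChartedSpace (EuclideanSpace ℝ (Fin n)) X] (g : FormFamily n X) : Prop :=
  ∀ (m : ℕ) (τ : ℝ) (x : X), 0 < τ → ∀ I J : AmbIdx n,
    Tendsto (fun z => ambRicci g x I J z / z.2.2 ^ m) (ambNhds τ x) (𝓝 0)

/-- `Ric = O⁺(ρ^m)`: the tensor `ρ^{-m} Ric` extends continuously to `ρ = 0`, and its pullback
to the metric bundle `{ρ = 0}` (that is, its components in the `τ` and `X` directions) is, at
every point, the pullback of a symmetric form on `T_x X` which is trace-free for `g_0`. -/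
def RicciFlatOPlus {n : ℕ} {X : Type} [TopologicalSpace X]
    [ChartedSpace (EuclideanSpace ℝ (Fin n)) X] (g : FormFamily n X) (m : ℕ) : Prop :=
  ∀ (τ : ℝ) (x : X), 0 < τ → ∃ s : Matrix (AmbIdx n) (AmbIdx n) ℝ,
    (∀ I J : AmbIdx n,
      Tendsto (fun z => ambRicci g x I J z / z.2.2 ^ m) (ambNhds τ x) (𝓝 (s I J))) ∧
    s (.inl ()) (.inl ()) = 0 ∧
    (∀ i : Fin n, s (.inl ()) (.inr (.inl i)) = 0 ∧ s (.inr (.inl i)) (.inl ()) = 0) ∧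
    ∑ i, ∑ j, (chartGram g x 0 (extChartAt (𝓡 n) x x))⁻¹ i j
      * s (.inr (.inl i)) (.inr (.inl j)) = 0

/-- A straight and normal ambient space of the `n`-dimensional Riemannian manifold `(X, g_0)`:
a smooth family of Riemannian metrics `g_ρ`, `|ρ| < ε`, such that the metric
`2ρ dτ² + 2τ dτ dρ + τ² g_ρ` on `(0, ∞) × X × (-ε, ε)` is formally Ricci flat. -/
structure Ambient (n : ℕ) (X : Type) [TopologicalSpace X]
    [ChartedSpace (EuclideanSpace ℝ (Fin n)) X] where
  ε : ℝ
  ε_pos : 0 < ε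
  g : FormFamily n X
  smooth : ∀ (p : X) (i j : Fin n),
    ContDiffOn ℝ ∞
      (fun q : EuclideanSpace ℝ (Fin n) × ℝ => chartGram g p q.2 q.1 i j)
      ((extChartAt (𝓡 n) p).target ×ˢ Set.Ioo (-ε) ε)
  symm : ∀ ρ ∈ Set.Ioo (-ε) ε, ∀ (x : X) (v w : TangentSpace (𝓡 n) x), g ρ x v w = g ρ x w v
  pos : ∀ ρ ∈ Set.Ioo (-ε) ε, ∀ (x : X) (v : TangentSpace (𝓡 n) x), v ≠ 0 → 0 < g ρ x v v
  ricci_odd : Odd n → RicciFlatToInfiniteOrder g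
  ricci_even : Even n → RicciFlatOPlus g (n / 2 - 1)

section Operators

variable {n : ℕ} {X : Type} [TopologicalSpace X] [ChartedSpace (EuclideanSpace ℝ (Fin n)) X]

/-- The ambient Laplacian on functions of `(τ, x, ρ)`. -/
def Ambient.laplacian (A : Ambient n X) (F : ℝ × X × ℝ → ℝ) : ℝ × X × ℝ → ℝ :=
  fun z => laplaceBeltrami (ambFrame n) (ambGram A.g z.2.1)
    (fun c => F (c.1, (extChartAt (𝓡 n) z.2.1).symm c.2.1, c.2.2))
    (z.1, extChartAt (𝓡 n) z.2.1 z.2.1, z.2.2)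

/-- `w(ρ) = (det g_ρ / det g_0)^{1/4}`. -/
def Ambient.w (A : Ambient n X) (x : X) (ρ : ℝ) : ℝ :=
  ((chartGram A.g x ρ (extChartAt (𝓡 n) x x)).det
    / (chartGram A.g x 0 (extChartAt (𝓡 n) x x)).det) ^ (1 / 4 : ℝ)

/-- The conjugated ambient Laplacian `w ∘ Δ ∘ w⁻¹`. -/
def Ambient.laplacianW (A : Ambient n X) (F : ℝ × X × ℝ → ℝ) : ℝ × X × ℝ → ℝ :=
  fun z => A.w z.2.1 z.2.2 * A.laplacian (fun z' => (A.w z'.2.1 z'.2.2)⁻¹ * F z') z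

/-- The generating function `ℳ(ρ)`, acting on functions on `X`. It is determined by the expansion
`Δ_w (τ^γ u) = τ^(γ-2) (-2ρ ∂_ρ² + (2γ+n-2) ∂_ρ + ℳ(ρ)) u`, valid for all `γ` and `u(x, ρ)`;
here this is read off with `γ = 0`, `τ = 1` and `u` independent of `ρ`. -/
def Ambient.genM (A : Ambient n X) (ρ : ℝ) (u : X → ℝ) : X → ℝ :=
  fun x => A.laplacianW (fun z => u z.2.1) (1, x, ρ)

/-- `ℛ_j = -2ρ ∂_ρ² + 2j ∂_ρ + ℳ(ρ)`, acting on functions `v(x, ρ)`. -/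
def Ambient.R (A : Ambient n X) (j : ℝ) (v : X → ℝ → ℝ) : X → ℝ → ℝ :=
  fun x ρ => -2 * ρ * iteratedDeriv 2 (v x) ρ + 2 * j * deriv (v x) ρ
    + A.genM ρ (fun x' => v x' ρ) x

/-- `ℛ_{L+1-2M} ⋯ ℛ_{L-3} ℛ_{L-1}`; the last operator to act is `ℛ_{L+1-2M}`. -/
def Ambient.Dtilde (A : Ambient n X) : ℕ → ℝ → (X → ℝ → ℝ) → X → ℝ → ℝ
  | 0, _, v => v
  | M + 1, L, v => A.R (L + 1 - 2 * ((M : ℝ) + 1)) (A.Dtilde M L v)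

/-- `D_{M,L}`: the restriction of `ℛ_{L+1-2M} ⋯ ℛ_{L-3} ℛ_{L-1}` to `ρ = 0`. -/
def Ambient.D (A : Ambient n X) (M : ℕ) (L : ℝ) (v : X → ℝ → ℝ) : X → ℝ :=
  fun x => A.Dtilde M L v x 0

/-- `𝒫_N u = ρ^N u`, for a function `u` on `X`. -/
def mulPow (N : ℕ) (u : X → ℝ) : X → ℝ → ℝ := fun x ρ => ρ ^ N * u x

/-- The operator `D_{M,L} ∘ 𝒫_N` on functions on `X`. -/
def Ambient.DP (A : Ambient n X) (M N : ℕ) (L : ℝ) (u : X → ℝ) : X → ℝ :=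
  A.D M L (mulPow N u)

/-- The GJMS operator `P_{2k}` of order `2k`: the restriction to `τ = 1, ρ = 0` of
`Δ^k (τ^(k-n/2) u)`, with `Δ` the ambient Laplacian. -/
def Ambient.gjms (A : Ambient n X) (k : ℕ) (u : X → ℝ) : X → ℝ :=
  fun x => A.laplacian^[k] (fun z => z.1 ^ ((k : ℝ) - (n : ℝ) / 2) * u z.2.1) (1, x, 0)

/-- The Riemannian measure of `(X, g_0)` on the domain of the preferred chart at `p`, extended by
zero: it has density `√(det g_0)` with respect to Lebesgue measure in the chart. -/
def Ambient.chartVolume [MeasurableSpace X] (A : Ambient n X) (p : X) : Measure X :=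
  ((volume.restrict (extChartAt (𝓡 n) p).target).withDensity
    fun y => ENNReal.ofReal (√(chartGram A.g p 0 y).det)).map (extChartAt (𝓡 n) p).symm

/-- The Riemannian measure of `(X, g_0)`. The measures on the chart domains agree on overlaps, so
their supremum is the measure that restricts to each of them. -/
def Ambient.riemVolume [MeasurableSpace X] (A : Ambient n X) : Measure X :=
  ⨆ p : X, A.chartVolume p

/-- Formal self-adjointness on `(X, g_0)`: the Dirichlet form `∫ u T(v) dvol` is symmetric on
compactly supported smooth functions. -/
def Ambient.FormallySelfAdjointOn [MeasurableSpace X] (A : Ambient n X)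
    (T : (X → ℝ) → X → ℝ) : Prop :=
  ∀ u v : X → ℝ, ContMDiff (𝓡 n) 𝓘(ℝ, ℝ) ∞ u → ContMDiff (𝓡 n) 𝓘(ℝ, ℝ) ∞ v →
    HasCompactSupport u → HasCompactSupport v →
      ∫ x, u x * T v x ∂A.riemVolume = ∫ x, v x * T u x ∂A.riemVolume

end Operators

/-- `D_{M,L} ∘ 𝒫_N` is formally self-adjoint in dimension `n`: it is so on every `n`-dimensional
Riemannian manifold, for every straight and normal ambient space of it. -/
def DPFormallySelfAdjoint (n M N : ℕ) (L : ℝ) : Prop :=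
  ∀ (X : Type) [TopologicalSpace X] [T2Space X] [SecondCountableTopology X]
    [ChartedSpace (EuclideanSpace ℝ (Fin n)) X] [IsManifold (𝓡 n) ∞ X]
    [MeasurableSpace X] [BorelSpace X] (A : Ambient n X),
    A.FormallySelfAdjointOn (A.DP M N L)

end AmbientGJMS

end

set_option linter.unusedSectionVars false

noncomputable section

namespace AmbientGJMS

/-! ### Formal power series in `ρ` -/

section Formal

open Finset

variable {V W : Type*} [AddCommGroup V] [Module ℝ V] [AddCommGroup W] [Module ℝ W]

/-! The theorem becomes a statement about noncommutative words. Let `ℳᵢ` be the Taylor coefficients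
of `ℳ(ρ)` at `ρ = 0`. A product of operators `ℛ_j`, restricted to `ρ = 0` and applied to a function
of `x` alone, is a universal noncommutative polynomial in the `ℳᵢ`: this is `wordCoeff`. Since `ℛ_j
ρ = ρ ℛ_{j-2} + 2j`, the factors `ρ` in `ρ^N u` can be moved out one at a time (`formalD_seqShift`),
so that `D_{M,L} ∘ 𝒫_N` is the scalar `∏_{i<N} 2(M-i)(L-M-i)` times the word of length `K = M-N`
with parameter `L' = L-2N`. The scalar vanishes exactly for the excluded values of `L`, and `L =
M+N` means `L' = K`.

Relation to GJMS. The ambient Laplacian lowers the degree in `τ` by two and acts on `τ^a w⁻¹ v`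
through `ℛ_{a+n/2-1}`. Hence `Δ^k` on degree `k-n/2` is the product that defines the word with
parameter `k`, applied to `w u`. As `w u = u + O(ρ)`, and the word of length `k` with parameter `k`
annihilates multiples of `ρ` at `ρ = 0`, the GJMS operator is that word applied to `u` (`gjms_eq`).

Self-adjointness at `L' = K`. Conjugation by `w` replaces the density of `g_ρ` by that of `g_0`, so
each `ℳᵢ` is a divergence-form operator for one fixed measure plus a potential, hence symmetric
(`l2form_coefMc`). The adjoint of a word is therefore the reversed word, and it suffices that the
word with `L' = K` is invariant under reversal (`wordCoeff_op`). This follows from the residue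
pairing on Laurent polynomials: the adjoint of `ℛ_j` is `ℛ_{-2-j}` with its coefficients multiplying
from the right, and the commutation rule with `ρ` identifies the resulting product on `ρ⁻¹` with the
original parameter on `1`.

Necessity. If the scalar is nonzero and the operator is symmetric, the word equals its reverse as an
operator. Orders are measured by iterated commutators with a coordinate function (`HasSymbol`). The
leading term `ℳ₀^K` cancels in the difference, and the next part comes from words with one `ℳ₁` and
`K-2` factors `ℳ₀`. Its principal part is `(L'-K) ∑ (p-q)² q₀^(K-3) κ`, summed over `p+q = K-2`,
where `q₀` and `κ` are the symbols of `ℳ₀` and `[ℳ₀, ℳ₁]` (`wordCoeff_sub_reverse`). The sum is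
positive once `K ≥ 3`.

It remains to find, in each dimension `n ≥ 1`, one ambient space with `κ ≠ 0`. The metric `χ⁻²|dx|²`
on Euclidean space, with `χ = 2 + sin x₀`, has an exactly flat ambient metric with explicit flat
coordinates (`exPsi`, `ricci_eq_zero`), and there `κ = 128` at the origin (`exKappa_zero`). -/

/-- The action of `-2ρ ∂² + 2j ∂ + ∑ xᵢ ρⁱ` on the coefficients of a power series in `ρ`. -/
def formalR (x : ℕ → Module.End ℝ V) (j : ℝ) : (ℕ → V) →ₗ[ℝ] (ℕ → V) where
  toFun f m := (2 * ((m : ℝ) + 1) * (j - m)) • f (m + 1) + ∑ p ∈ antidiagonal m, x p.1 (f p.2)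
  map_add' f g := by
    ext m
    simp only [Pi.add_apply, smul_add, map_add, sum_add_distrib]
    abel
  map_smul' c f := by
    ext m
    simp only [Pi.smul_apply, map_smul, RingHom.id_apply, smul_add, smul_sum, smul_comm c]

lemma formalR_apply (x : ℕ → Module.End ℝ V) (j : ℝ) (f : ℕ → V) (m : ℕ) :
    formalR x j f m = (2 * ((m : ℝ) + 1) * (j - m)) • f (m + 1)
      + ∑ p ∈ antidiagonal m, x p.1 (f p.2) := rfl

/-- The product `ℛ_{L+1-2M} ⋯ ℛ_{L-3} ℛ_{L-1}` acting on coefficients. -/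
def formalD (x : ℕ → Module.End ℝ V) : ℕ → ℝ → (ℕ → V) →ₗ[ℝ] (ℕ → V)
  | 0, _ => LinearMap.id
  | M + 1, L => formalR x (L + 1 - 2 * ((M : ℝ) + 1)) ∘ₗ formalD x M L

lemma formalD_succ (x : ℕ → Module.End ℝ V) (M : ℕ) (L : ℝ) (f : ℕ → V) :
    formalD x (M + 1) L f = formalR x (L + 1 - 2 * ((M : ℝ) + 1)) (formalD x M L f) := rfl

/-- Multiplication of a power series by `ρ`. -/
def seqShift (f : ℕ → V) : ℕ → V
  | 0 => 0
  | m + 1 => f m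

/-- Leibniz rule: commuting `ρ` past `-2ρ ∂²` produces `-4ρ ∂`, which is a shift of `j` by `2`, and
commuting it past `2j ∂` produces the scalar `2j`. -/
lemma formalR_seqShift (x : ℕ → Module.End ℝ V) (j : ℝ) (f : ℕ → V) :
    formalR x j (seqShift f) = seqShift (formalR x (j - 2) f) + (2 * j) • f := by
  ext m
  cases m with
  | zero => simp [formalR_apply, seqShift]
  | succ m =>
    simp only [formalR_apply, seqShift, Pi.add_apply, Pi.smul_apply]
    rw [Nat.sum_antidiagonal_succ']
    simp only [map_zero]
    push_cast
    module

/-- When `ρ` passes one factor, that factor is replaced by a scalar, and the factors to its right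
have already been shifted. Whichever factor is removed, the remaining indices are those of the same
product with parameter `L - 2`. The scalars `2(L-1) + 2(L-3) + ⋯` add up to `2(M+1)(L-(M+1))`. -/
lemma formalD_seqShift (x : ℕ → Module.End ℝ V) (M : ℕ) (L : ℝ) (f : ℕ → V) :
    formalD x (M + 1) L (seqShift f) = seqShift (formalD x (M + 1) (L - 2) f)
      + (2 * ((M : ℝ) + 1) * (L - (M + 1))) • formalD x M (L - 2) f := by
  induction M with
  | zero =>
    change formalR x _ (seqShift f) = seqShift (formalR x _ f) + _ • f
    rw [formalR_seqShift]
    congr 2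
    · congr 2; push_cast; ring
    · push_cast; ring
  | succ M ih =>
    rw [formalD_succ, ih, map_add, map_smul, formalR_seqShift, formalD_succ x (M + 1) (L - 2)]
    have h1 : L + 1 - 2 * (((M + 1 : ℕ) : ℝ) + 1) - 2 = L - 2 + 1 - 2 * (((M + 1 : ℕ) : ℝ) + 1) := by
      ring
    have h2 : L + 1 - 2 * (((M + 1 : ℕ) : ℝ) + 1) = L - 2 + 1 - 2 * ((M : ℝ) + 1) := by
      push_cast; ring
    have h3 : formalR x (L + 1 - 2 * (((M + 1 : ℕ) : ℝ) + 1)) (formalD x M (L - 2) f)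
        = formalD x (M + 1) (L - 2) f := by rw [formalD_succ, h2]
    rw [h3, h1, add_assoc, ← add_smul]
    congr 2
    push_cast
    ring

lemma formalD_seqShift_apply_zero (x : ℕ → Module.End ℝ V) (M : ℕ) (L : ℝ) (f : ℕ → V) :
    formalD x (M + 1) L (seqShift f) 0
      = (2 * ((M : ℝ) + 1) * (L - (M + 1))) • formalD x M (L - 2) f 0 := by
  simp [formalD_seqShift, seqShift]

/-- At `ρ = 0` the term with `ρ` in front disappears, so each power of `ρ` costs one factor of the
product and contributes one scalar. As `i < N ≤ M`, the product of scalars vanishes only if `L` is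
one of `M, …, M+N-1`. -/
lemma formalD_seqShift_iterate_apply_zero (x : ℕ → Module.End ℝ V) (N M : ℕ) (hNM : N ≤ M)
    (L : ℝ) (f : ℕ → V) :
    formalD x M L (seqShift^[N] f) 0
      = (∏ i ∈ range N, 2 * ((M : ℝ) - i) * (L - M - i)) •
        formalD x (M - N) (L - 2 * N) f 0 := by
  induction N generalizing M L with
  | zero => simp
  | succ N ih =>
    obtain ⟨M, rfl⟩ : ∃ M', M = M' + 1 := ⟨M - 1, by omega⟩
    rw [Function.iterate_succ_apply', formalD_seqShift_apply_zero, ih M (by omega), smul_smul,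
      prod_range_succ', Nat.add_sub_add_right]
    have h1 : ∀ i : ℕ, 2 * ((M : ℝ) - i) * (L - 2 - M - i)
        = 2 * (((M + 1 : ℕ) : ℝ) - ((i + 1 : ℕ) : ℝ)) * (L - ((M + 1 : ℕ) : ℝ) - ((i + 1 : ℕ) : ℝ)) := by
      intro i; push_cast; ring
    have h2 : L - 2 - 2 * (N : ℝ) = L - 2 * ((N + 1 : ℕ) : ℝ) := by push_cast; ring
    rw [h2, prod_congr rfl fun i _ => h1 i, mul_comm]
    congr 2
    push_cast; ring

/-- Naturality under intertwining maps. It serves to evaluate a universal word at a vector, to pass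
to the opposite ring, and to restrict operators to compactly supported functions. -/
lemma map_formalD {x : ℕ → Module.End ℝ V} {y : ℕ → Module.End ℝ W} (h : V →ₗ[ℝ] W)
    (hxy : ∀ i v, h (x i v) = y i (h v)) (M : ℕ) (L : ℝ) (f : ℕ → V) (m : ℕ) :
    h (formalD x M L f m) = formalD y M L (fun i => h (f i)) m := by
  induction M generalizing m with
  | zero => rfl
  | succ M ih =>
    simp only [formalD_succ, formalR_apply, map_add, map_smul, map_sum, hxy, ih]

variable {A : Type*} [Ring A] [Algebra ℝ A]

/-- The `m`-th coefficient of `ℛ_{L+1-2k} ⋯ ℛ_{L-1}` applied to `1`. -/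
def wordCoeff (a : ℕ → A) (L : ℝ) (k m : ℕ) : A :=
  formalD (fun i => LinearMap.mulLeft ℝ (a i)) k L (Pi.single 0 1) m

lemma wordCoeff_zero (a : ℕ → A) (L : ℝ) (m : ℕ) :
    wordCoeff a L 0 m = (Pi.single 0 1 : ℕ → A) m := rfl

lemma wordCoeff_succ (a : ℕ → A) (L : ℝ) (k m : ℕ) :
    wordCoeff a L (k + 1) m
      = (2 * ((m : ℝ) + 1) * (L + 1 - 2 * ((k : ℝ) + 1) - m)) • wordCoeff a L k (m + 1)
        + ∑ p ∈ antidiagonal m, a p.1 * wordCoeff a L k p.2 := rfl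

lemma formalD_single (x : ℕ → Module.End ℝ V) (M : ℕ) (L : ℝ) (u : V) (m : ℕ) :
    formalD x M L (Pi.single 0 u) m = wordCoeff x L M m u := by
  unfold wordCoeff
  have := map_formalD (x := fun i => LinearMap.mulLeft ℝ (x i)) (y := x)
    (LinearMap.applyₗ u) (fun i v => rfl) M L (Pi.single 0 1) m
  simp only [LinearMap.applyₗ_apply_apply] at this
  have e : (Pi.single 0 u : ℕ → V) = fun i => (Pi.single 0 1 : ℕ → Module.End ℝ V) i u := by
    funext i
    by_cases hi : i = 0
    · subst hi; simp
    · simp [hi]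
  rw [this, e]

end Formal

/-! ### Reversal symmetry of the word with `L = K` -/

section Palindrome

open Finset MulOpposite

section Abstract

variable {B : Type*} [Ring B] [Algebra ℝ B]

/-- `-2 T ∂² + 2j ∂ + m` for a derivation `∂`, an element `T` and an additive map `m`. -/
def derivR (D : B →ₗ[ℝ] B) (T : B) (m : B →ₗ[ℝ] B) (j : ℝ) : B →ₗ[ℝ] B :=
  (-2 : ℝ) • (LinearMap.mulLeft ℝ T ∘ₗ D ∘ₗ D) + (2 * j) • D + m

/-- The product of the operators `derivR` with indices `L + 1 - 2k, …, L - 3, L - 1`. -/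
def derivD (D : B →ₗ[ℝ] B) (T : B) (m : B →ₗ[ℝ] B) : ℕ → ℝ → B →ₗ[ℝ] B
  | 0, _ => LinearMap.id
  | k + 1, L => derivR D T m (L + 1 - 2 * ((k : ℝ) + 1)) ∘ₗ derivD D T m k L

variable {D : B →ₗ[ℝ] B} {T : B}

lemma derivR_apply (m : B →ₗ[ℝ] B) (j : ℝ) (f : B) :
    derivR D T m j f = (-2 : ℝ) • (T * D (D f)) + (2 * j) • D f + m f := rfl

lemma derivD_succ (m : B →ₗ[ℝ] B) (k : ℕ) (L : ℝ) (f : B) :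
    derivD D T m (k + 1) L f = derivR D T m (L + 1 - 2 * ((k : ℝ) + 1)) (derivD D T m k L f) := rfl

variable (hD : ∀ f g, D (f * g) = D f * g + f * D g) (hT : ∀ f, T * f = f * T) (hDT : D T = 1)

include hD hDT in
lemma derivR_mul_left {m : B →ₗ[ℝ] B} (hm : ∀ f, m (T * f) = T * m f) (j : ℝ) (f : B) :
    derivR D T m j (T * f) = T * derivR D T m (j - 2) f + (2 * j) • f := by
  simp only [derivR_apply, hD, hDT, hm, one_mul, map_add, mul_add, mul_smul_comm]
  module

include hD hDT in
lemma derivD_mul_left {m : B →ₗ[ℝ] B} (hm : ∀ f, m (T * f) = T * m f) (k : ℕ) (L : ℝ) (f : B) :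
    derivD D T m (k + 1) L (T * f) = T * derivD D T m (k + 1) (L - 2) f
      + (2 * ((k : ℝ) + 1) * (L - (k + 1))) • derivD D T m k (L - 2) f := by
  induction k with
  | zero =>
    change derivR D T m _ (T * f) = T * (derivR D T m _ f) + _ • f
    rw [derivR_mul_left hD hDT hm, show L + 1 - 2 * (((0 : ℕ) : ℝ) + 1) - 2
      = L - 2 + 1 - 2 * (((0 : ℕ) : ℝ) + 1) by ring]
    congr 2
    push_cast; ring
  | succ k ih =>
    rw [derivD_succ, ih, map_add, map_smul, derivR_mul_left hD hDT hm,
      derivD_succ _ (k + 1) (L - 2)]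
    have h1 : L + 1 - 2 * (((k + 1 : ℕ) : ℝ) + 1) - 2 = L - 2 + 1 - 2 * (((k + 1 : ℕ) : ℝ) + 1) := by
      ring
    have h2 : L + 1 - 2 * (((k + 1 : ℕ) : ℝ) + 1) = L - 2 + 1 - 2 * ((k : ℝ) + 1) := by
      push_cast; ring
    have h3 : derivR D T m (L + 1 - 2 * (((k + 1 : ℕ) : ℝ) + 1)) (derivD D T m k (L - 2) f)
        = derivD D T m (k + 1) (L - 2) f := by rw [derivD_succ, h2]
    rw [h3, h1, add_assoc, ← add_smul]
    congr 2
    push_cast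
    ring

variable {C : Type*} [AddCommGroup C] [Module ℝ C] (res : B →ₗ[ℝ] C) (hres : ∀ f, res (D f) = 0)

include hD hT hDT hres in
-- Integration by parts: `res` kills derivatives, and `∂²(gT) = T ∂²g + 2 ∂g` accounts for the
-- change of `j` into `-2 - j`. The coefficient `X` stands between `g` and `f`, so it multiplies `g`
-- from the right.
lemma res_mul_derivR (X g f : B) (j : ℝ) :
    res (g * derivR D T (LinearMap.mulLeft ℝ X) j f)
      = res (derivR D T (LinearMap.mulRight ℝ X) (-2 - j) g * f) := by
  -- Up to the factor `-2`, this is an explicit primitive of the difference of the two integrands.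
  have h1 : D (g * T * D f - D (g * T) * f + (-j) • (g * f))
      = g * T * D (D f) - D (D (g * T)) * f + (-j) • (D g * f) + (-j) • (g * D f) := by
    simp only [map_add, map_sub, map_smul, hD, smul_add, hDT]
    abel
  have h2 := hres (g * T * D f - D (g * T) * f + (-j) • (g * f))
  rw [h1] at h2
  have h3 : D (D (g * T)) = T * D (D g) + (2 : ℝ) • D g := by
    rw [hD, hDT, mul_one, map_add, hD, hDT, mul_one, ← hT]
    module
  have h4 : g * derivR D T (LinearMap.mulLeft ℝ X) j f
      = derivR D T (LinearMap.mulRight ℝ X) (-2 - j) g * f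
        + (-2 : ℝ) • (g * T * D (D f) - D (D (g * T)) * f + (-j) • (D g * f)
          + (-j) • (g * D f)) := by
    simp only [derivR_apply, h3, LinearMap.mulLeft_apply, LinearMap.mulRight_apply, mul_add,
      add_mul, mul_smul_comm, smul_mul_assoc, ← mul_assoc]
    module
  rw [h4, map_add, map_smul, h2, smul_zero, add_zero]

lemma derivD_succ' (m : B →ₗ[ℝ] B) (k : ℕ) (L : ℝ) (f : B) :
    derivD D T m (k + 1) L f = derivD D T m k (L - 2) (derivR D T m (L - 1) f) := by
  induction k generalizing f with
  | zero =>
    change derivR D T m _ f = derivR D T m _ f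
    congr 2
    push_cast; ring
  | succ k ih =>
    rw [derivD_succ, ih, derivD_succ _ k, show L + 1 - 2 * (((k + 1 : ℕ) : ℝ) + 1)
      = L - 2 + 1 - 2 * ((k : ℝ) + 1) by push_cast; ring]

include hD hT hDT hres in
-- Taking adjoints reverses the order of the factors, and `j ↦ -2 - j` reverses the progression of
-- indices, so the adjoint has the same shape with top index `2k - 3 - L`.
lemma res_mul_derivD (X g f : B) (k : ℕ) (L : ℝ) :
    res (g * derivD D T (LinearMap.mulLeft ℝ X) k L f)
      = res (derivD D T (LinearMap.mulRight ℝ X) k (2 * k - 2 - L) g * f) := by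
  induction k generalizing g with
  | zero => rfl
  | succ k ih =>
    rw [derivD_succ, res_mul_derivR hD hT hDT res hres, ih, derivD_succ']
    have h1 : (2 * ((k + 1 : ℕ) : ℝ) - 2 - L - 2) = 2 * (k : ℝ) - 2 - L := by push_cast; ring
    have h2 : -2 - (L + 1 - 2 * ((k : ℝ) + 1)) = 2 * ((k + 1 : ℕ) : ℝ) - 2 - L - 1 := by
      push_cast; ring
    rw [h1, h2]

include hD hT hDT hres in
-- For `L = k` the dual parameter is `k - 2`. The extra term in `derivD_mul_left` carries the factor
-- `L - k = 0`, so applying that rule to `T * Ti = 1` turns the product with parameter `k - 2` on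
-- `Ti` into `Ti` times the product with parameter `k` on `1`.
lemma res_derivD_reverse (X Ti : B) (hTi : T * Ti = 1) (k : ℕ) :
    res (Ti * derivD D T (LinearMap.mulLeft ℝ X) k k 1)
      = res (Ti * derivD D T (LinearMap.mulRight ℝ X) k k 1) := by
  cases k with
  | zero => rfl
  | succ k =>
    rw [res_mul_derivD hD hT hDT res hres, mul_one]
    have h1 : (2 * ((k + 1 : ℕ) : ℝ) - 2 - ((k + 1 : ℕ) : ℝ)) = ((k + 1 : ℕ) : ℝ) - 2 := by ring
    have h2 := derivD_mul_left hD hDT (m := LinearMap.mulRight ℝ X)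
      (fun f => by simp [mul_assoc]) k ((k + 1 : ℕ) : ℝ) Ti
    have h3 : (((k + 1 : ℕ) : ℝ) - (k + 1)) = 0 := by push_cast; ring
    rw [h3, mul_zero, zero_smul, add_zero, hTi] at h2
    rw [h1, h2, ← mul_assoc, ← hT, hTi, one_mul]

end Abstract

section Laurent

open LaurentPolynomial

variable {A : Type*} [Ring A] [Algebra ℝ A]

/-- The derivative `∂` of Laurent polynomials. -/
def laurentDeriv : A[T;T⁻¹] →ₗ[ℝ] A[T;T⁻¹] where
  toFun f := .ofCoeff (Finsupp.lsum ℝ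
    (fun m : ℤ => (m : ℝ) • (Finsupp.lsingle (m - 1) : A →ₗ[ℝ] ℤ →₀ A)) f.coeff)
  map_add' f g := by
    rw [AddMonoidAlgebra.coeff_add, map_add, AddMonoidAlgebra.ofCoeff_add]
  map_smul' c f := by
    rw [AddMonoidAlgebra.coeff_smul, map_smul, AddMonoidAlgebra.ofCoeff_smul, RingHom.id_apply]

lemma laurentDeriv_single (m : ℤ) (a : A) :
    laurentDeriv (.single m a) = .single (m - 1) ((m : ℝ) • a) := by
  change AddMonoidAlgebra.ofCoeff (Finsupp.lsum ℝ _ (Finsupp.single m a)) = _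
  rw [Finsupp.lsum_single]
  simp

lemma laurentDeriv_coeff (f : A[T;T⁻¹]) (m : ℤ) :
    (laurentDeriv f).coeff m = ((m : ℝ) + 1) • f.coeff (m + 1) := by
  induction f using AddMonoidAlgebra.induction_linear with
  | zero => simp
  | add f g hf hg => simp [hf, hg]
  | single k a =>
    rw [laurentDeriv_single]
    simp only [AddMonoidAlgebra.coeff_single, Finsupp.single_apply]
    by_cases h : k = m + 1
    · subst h
      simp
    · rw [if_neg h, if_neg (by omega), smul_zero]

lemma laurentDeriv_mul (f g : A[T;T⁻¹]) :
    laurentDeriv (f * g) = laurentDeriv f * g + f * laurentDeriv g := by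
  induction f using AddMonoidAlgebra.induction_linear with
  | zero => simp
  | add f f' hf hf' => simp only [add_mul, map_add, hf, hf']; abel
  | single k a =>
    induction g using AddMonoidAlgebra.induction_linear with
    | zero => simp
    | add g g' hg hg' => simp only [mul_add, map_add, hg, hg']; abel
    | single l b =>
      simp only [laurentDeriv_single, AddMonoidAlgebra.single_mul_single]
      rw [show k - 1 + l = k + l - 1 by ring, show k + (l - 1) = k + l - 1 by ring,
        ← AddMonoidAlgebra.single_add, smul_mul_assoc, mul_smul_comm, ← add_smul]
      push_cast
      rfl

/-- The `m`-th coefficient of a Laurent polynomial as a linear map. -/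
def laurentCoeff (m : ℤ) : A[T;T⁻¹] →ₗ[ℝ] A where
  toFun f := f.coeff m
  map_add' _ _ := rfl
  map_smul' _ _ := rfl

omit [Algebra ℝ A] in
lemma T_mul_coeff (k m : ℤ) (f : A[T;T⁻¹]) :
    ((T k : A[T;T⁻¹]) * f).coeff m = f.coeff (m - k) := by
  induction f using AddMonoidAlgebra.induction_linear with
  | zero => simp
  | add f g hf hg => rw [mul_add, AddMonoidAlgebra.coeff_add, Finsupp.add_apply, hf, hg]; rfl
  | single l a =>
    rw [T, AddMonoidAlgebra.single_mul_single]
    simp only [AddMonoidAlgebra.coeff_single, Finsupp.single_apply, one_mul]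
    congr 1
    rw [eq_iff_iff]
    omega

/-- The truncation at order `K` of the power series `∑ aᵢ Tⁱ`. -/
def truncSeries (a : ℕ → A) (K : ℕ) : A[T;T⁻¹] := ∑ i ∈ range (K + 1), C (a i) * T i

omit [Algebra ℝ A] in
lemma C_mul_coeff (b : A) (g : A[T;T⁻¹]) (k : ℤ) : (C b * g).coeff k = b * g.coeff k := by
  rw [← smul_eq_C_mul]; rfl

omit [Algebra ℝ A] in
lemma mul_C_coeff (b : A) (g : A[T;T⁻¹]) (k : ℤ) : (g * C b).coeff k = g.coeff k * b := by
  rw [← single_eq_C, AddMonoidAlgebra.coeff_mul_single_zero]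

omit [Algebra ℝ A] in
lemma truncSeries_mul_coeff (a : ℕ → A) (K : ℕ) (f : A[T;T⁻¹]) (m : ℤ) :
    (truncSeries a K * f).coeff m = ∑ i ∈ range (K + 1), a i * f.coeff (m - i) := by
  rw [truncSeries, sum_mul, AddMonoidAlgebra.coeff_sum, Finsupp.finsetSum_apply]
  refine sum_congr rfl fun i _ => ?_
  rw [mul_assoc, C_mul_coeff, T_mul_coeff]

omit [Algebra ℝ A] in
lemma mul_truncSeries_coeff (a : ℕ → A) (K : ℕ) (f : A[T;T⁻¹]) (m : ℤ) :
    (f * truncSeries a K).coeff m = ∑ i ∈ range (K + 1), f.coeff (m - i) * a i := by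
  rw [truncSeries, mul_sum, AddMonoidAlgebra.coeff_sum, Finsupp.finsetSum_apply]
  refine sum_congr rfl fun i _ => ?_
  rw [← T_mul, ← mul_assoc, ← T_mul, mul_assoc, T_mul_coeff, mul_C_coeff]

/-- Each factor reads at most one degree higher, so the truncation at `K` is invisible in degree `m`
after `k` factors if `m + k ≤ K`. This lets Laurent polynomials, where residues make sense, compute
the words in power series. -/
lemma derivD_coeff {y : ℕ → Module.End ℝ A} {K : ℕ} {μ : A[T;T⁻¹] →ₗ[ℝ] A[T;T⁻¹]}
    (hμ : ∀ f m, (μ f).coeff m = ∑ i ∈ range (K + 1), y i (f.coeff (m - i)))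
    (L : ℝ) (k : ℕ) (hk : k ≤ K) :
    (∀ m : ℤ, m < 0 → (derivD laurentDeriv (T 1 : A[T;T⁻¹]) μ k L 1).coeff m = 0) ∧
    ∀ m : ℕ, m + k ≤ K → (derivD laurentDeriv (T 1 : A[T;T⁻¹]) μ k L 1).coeff m = formalD y k L (Pi.single 0 1) m := by
  induction k with
  | zero =>
    constructor
    · intro m hm
      change (1 : A[T;T⁻¹]).coeff m = 0
      rw [← T_zero, T_apply, if_neg (by omega)]
    · intro m _
      change (1 : A[T;T⁻¹]).coeff m = _
      rw [← T_zero, T_apply, formalD, LinearMap.id_apply]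
      by_cases hm : m = 0
      · subst hm; simp
      · rw [if_neg (by omega), Pi.single_eq_of_ne hm]
  | succ k ih =>
    obtain ⟨ih1, ih2⟩ := ih (by omega)
    set F := derivD laurentDeriv (T 1 : A[T;T⁻¹]) μ k L 1 with hF
    have key : ∀ m : ℤ, (derivD laurentDeriv (T 1 : A[T;T⁻¹]) μ (k + 1) L 1).coeff m
        = (2 * ((m : ℝ) + 1) * (L + 1 - 2 * ((k : ℝ) + 1) - m)) • F.coeff (m + 1)
          + ∑ i ∈ range (K + 1), y i (F.coeff (m - i)) := by
      intro m
      rw [derivD_succ, ← hF, derivR_apply]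
      simp only [AddMonoidAlgebra.coeff_add, AddMonoidAlgebra.coeff_smul, Finsupp.add_apply,
        Finsupp.smul_apply, hμ, T_mul_coeff, laurentDeriv_coeff]
      congr 1
      rw [sub_add_cancel]
      push_cast
      module
    constructor
    · intro m hm
      rw [key, sum_eq_zero, add_zero]
      -- In degree `-1` the derivative terms carry the factor `m + 1 = 0`, so no pole is ever
      -- created.
      · rcases eq_or_ne m (-1) with rfl | hm'
        · simp
        · rw [ih1 _ (by omega), smul_zero]
      · intro i _
        rw [ih1 _ (by omega), map_zero]
    · intro m hm
      rw [key, formalD_succ, formalR_apply]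
      congr 1
      · rw [← ih2 (m + 1) (by omega)]
        push_cast
        rfl
      · rw [Nat.sum_antidiagonal_eq_sum_range_succ_mk]
        symm
        rw [← sum_subset (range_mono (show m + 1 ≤ K + 1 by omega))]
        · refine sum_congr rfl fun i hi => ?_
          have hi' : i ≤ m := by simpa [Nat.lt_succ_iff] using hi
          rw [← ih2 (m - i) (by omega), Nat.cast_sub hi']
        · intro i _ hi
          have hi' : m < i := by simpa using hi
          rw [ih1 _ (by omega), map_zero]

/-- The word of length `K` at `L = K` is invariant under reversal of products. -/
theorem wordCoeff_op (a : ℕ → A) (K : ℕ) :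
    wordCoeff (fun i => op (a i)) K K 0 = op (wordCoeff a K K 0) := by
  have h1 : wordCoeff (fun i => op (a i)) K K 0
      = op (formalD (fun i => LinearMap.mulRight ℝ (a i)) K K (Pi.single 0 1) 0) := by
    have := map_formalD (x := fun i => LinearMap.mulRight ℝ (a i))
      (y := fun i => LinearMap.mulLeft ℝ (op (a i))) (opLinearEquiv ℝ).toLinearMap
      (fun i v => rfl) K K (Pi.single 0 1) 0
    have e : (fun i => (opLinearEquiv ℝ).toLinearMap ((Pi.single 0 1 : ℕ → A) i))
        = (Pi.single 0 1 : ℕ → Aᵐᵒᵖ) := by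
      funext i
      by_cases hi : i = 0
      · subst hi; simp
      · simp [hi]
    rw [e] at this
    exact this.symm
  have h2 := (derivD_coeff (μ := LinearMap.mulLeft ℝ (truncSeries a K))
    (y := fun i => LinearMap.mulLeft ℝ (a i)) (truncSeries_mul_coeff a K) K K le_rfl).2 0
    (by omega)
  have h3 := (derivD_coeff (μ := LinearMap.mulRight ℝ (truncSeries a K))
    (y := fun i => LinearMap.mulRight ℝ (a i)) (mul_truncSeries_coeff a K) K K le_rfl).2 0
    (by omega)
  -- The residue of `T⁻¹ f` is the constant coefficient of `f`, which is what the word records.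
  have h4 := res_derivD_reverse (D := laurentDeriv) (T := (T 1 : A[T;T⁻¹])) laurentDeriv_mul
    (T_mul 1) (by rw [T, laurentDeriv_single]; rw [sub_self, Int.cast_one, one_smul]; rfl)
    (laurentCoeff (-1)) (fun f => by
      change (laurentDeriv f).coeff (-1) = 0
      rw [laurentDeriv_coeff]; simp) (truncSeries a K) (T (-1)) (by rw [← T_add]; simp) K
  change ((T (-1) : A[T;T⁻¹]) * _).coeff (-1) = ((T (-1) : A[T;T⁻¹]) * _).coeff (-1) at h4
  rw [T_mul_coeff, T_mul_coeff] at h4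
  have h5 : (-1 : ℤ) - -1 = ((0 : ℕ) : ℤ) := by norm_num
  rw [h5, h2, h3] at h4
  rw [h1, ← h4]
  rfl

end Laurent

end Palindrome

/-! ### Principal parts of words with respect to a derivation -/

section Order

open Finset MulOpposite

variable {A : Type*} [Ring A] [Algebra ℝ A] {δ : A →ₗ[ℝ] A}

lemma iterate_leibniz (hδ : ∀ a b, δ (a * b) = δ a * b + a * δ b) (n : ℕ) (a b : A) :
    (δ ^ n) (a * b) = ∑ p ∈ antidiagonal n, n.choose p.1 • ((δ ^ p.1) a * (δ ^ p.2) b) := by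
  induction n with
  | zero => simp
  | succ n ih =>
    rw [sum_antidiagonal_choose_succ_nsmul (fun i j => (δ ^ i) a * (δ ^ j) b) n, pow_succ',
      Module.End.mul_apply, ih, map_sum, ← sum_add_distrib]
    refine sum_congr rfl fun p hp => ?_
    rw [map_nsmul, hδ, nsmul_add, add_comm, pow_succ', pow_succ', ← Nat.choose_symm_of_eq_add
      (by rw [← mem_antidiagonal.1 hp, add_comm] : n = p.2 + p.1)]
    rfl

/-- `T` has order at most `m` with principal part `c`: `δ^m T = m! c` and `δ^(m+1) T = 0`. -/
def HasSymbol (δ : A →ₗ[ℝ] A) (m : ℕ) (T c : A) : Prop :=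
  (δ ^ m) T = (m.factorial : ℝ) • c ∧ δ c = 0

namespace HasSymbol

variable {m m' : ℕ} {T T' c c' : A}

lemma pow_succ_eq_zero (h : HasSymbol δ m T c) : (δ ^ (m + 1)) T = 0 := by
  rw [pow_succ', Module.End.mul_apply, h.1, map_smul, h.2, smul_zero]

lemma pow_eq_zero (h : HasSymbol δ m T c) {k : ℕ} (hk : m < k) : (δ ^ k) T = 0 := by
  obtain ⟨d, rfl⟩ := Nat.exists_eq_add_of_lt hk
  rw [show m + d + 1 = d + (m + 1) by ring, pow_add, Module.End.mul_apply, h.pow_succ_eq_zero,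
    map_zero]

lemma of_lt (h : HasSymbol δ m T c) {k : ℕ} (hk : m < k) : HasSymbol δ k T 0 :=
  ⟨by rw [h.pow_eq_zero hk, smul_zero], map_zero _⟩

lemma add (h : HasSymbol δ m T c) (h' : HasSymbol δ m T' c') :
    HasSymbol δ m (T + T') (c + c') :=
  ⟨by rw [map_add, h.1, h'.1, smul_add], by rw [map_add, h.2, h'.2, add_zero]⟩

lemma smul (r : ℝ) (h : HasSymbol δ m T c) : HasSymbol δ m (r • T) (r • c) :=
  ⟨by rw [map_smul, h.1, smul_comm], by rw [map_smul, h.2, smul_zero]⟩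

lemma sub (h : HasSymbol δ m T c) (h' : HasSymbol δ m T' c') :
    HasSymbol δ m (T - T') (c - c') := by
  simpa [sub_eq_add_neg] using h.add (h'.smul (-1))

lemma zero : HasSymbol δ m 0 0 := ⟨by simp, by simp⟩

lemma sum {ι : Type*} (s : Finset ι) {F f : ι → A} (h : ∀ i ∈ s, HasSymbol δ m (F i) (f i)) :
    HasSymbol δ m (∑ i ∈ s, F i) (∑ i ∈ s, f i) :=
  ⟨by rw [map_sum, smul_sum]; exact sum_congr rfl fun i hi => (h i hi).1,
    by rw [map_sum]; exact sum_eq_zero fun i hi => (h i hi).2⟩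

/-- In the Leibniz expansion of `δ^(m+m')` only the term `(m, m')` survives, and the binomial
coefficient times `m! m'!` is `(m+m')!`. The factorial in the definition makes principal parts
multiplicative. -/
lemma mul (hδ : ∀ a b, δ (a * b) = δ a * b + a * δ b) (h : HasSymbol δ m T c)
    (h' : HasSymbol δ m' T' c') : HasSymbol δ (m + m') (T * T') (c * c') := by
  refine ⟨?_, by rw [hδ, h.2, h'.2, zero_mul, mul_zero, add_zero]⟩
  rw [iterate_leibniz hδ, sum_eq_single (m, m')]
  · simp only [h.1, h'.1, smul_mul_assoc, mul_smul_comm, smul_smul]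
    rw [← Nat.cast_smul_eq_nsmul ℝ, smul_smul]
    congr 1
    have := Nat.add_choose_mul_factorial_mul_factorial m m'
    rw [← Nat.choose_symm_add] at this
    rw [← this]
    push_cast
    ring
  · rintro ⟨i, j⟩ hij hne
    rw [HasAntidiagonal.mem_antidiagonal] at hij
    simp only at hij ⊢
    rcases lt_trichotomy i m with hi | hi | hi
    · rw [h'.pow_eq_zero (by omega), mul_zero, smul_zero]
    · exact absurd (by ext <;> simp only <;> omega) hne
    · rw [h.pow_eq_zero hi, zero_mul, smul_zero]
  · intro hn
    simp at hn

lemma one (hδ : ∀ a b, δ (a * b) = δ a * b + a * δ b) : HasSymbol δ 0 1 1 := by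
  refine ⟨by simp, ?_⟩
  have := hδ 1 1
  simpa using this

lemma pow (hδ : ∀ a b, δ (a * b) = δ a * b + a * δ b) (h : HasSymbol δ m T c) (k : ℕ) :
    HasSymbol δ (m * k) (T ^ k) (c ^ k) := by
  induction k with
  | zero => simpa using HasSymbol.one hδ
  | succ k ih => rw [pow_succ, pow_succ, Nat.mul_succ]; exact ih.mul hδ h

end HasSymbol

section Words

variable (hδ : ∀ a b, δ (a * b) = δ a * b + a * δ b) {a q : ℕ → A}
  (ha : ∀ i, HasSymbol δ 2 (a i) (q i)) (L : ℝ)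

include hδ ha in
-- Each factor contributes at most one coefficient of order two. The bound `2k` is expressed as
-- order `2k + 1` with vanishing principal part, so that no leading term has to be named.
lemma wordCoeff_order (k m : ℕ) : HasSymbol δ (2 * k + 1) (wordCoeff a L k m) 0 := by
  induction k generalizing m with
  | zero =>
    rw [wordCoeff_zero]
    by_cases hm : m = 0
    · subst hm
      exact (HasSymbol.one hδ).of_lt (by omega)
    · rw [Pi.single_eq_of_ne hm]
      exact HasSymbol.zero
  | succ k ih =>
    rw [wordCoeff_succ]
    have h1 := ((ih (m + 1)).smul (2 * ((m : ℝ) + 1) * (L + 1 - 2 * ((k : ℝ) + 1) - m))).of_lt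
      (k := 2 * (k + 1) + 1) (by omega)
    have h2 := HasSymbol.sum (antidiagonal m) (m := 2 + (2 * k + 1)) (δ := δ)
      (F := fun p => a p.1 * wordCoeff a L k p.2) (f := fun p => q p.1 * 0)
      fun p _ => (ha p.1).mul hδ (ih p.2)
    have h3 := h1.add (c' := 0) (m := 2 * (k + 1) + 1) (T' := ∑ p ∈ antidiagonal m, a p.1 * wordCoeff a L k p.2) (by
      have e : 2 + (2 * k + 1) = 2 * (k + 1) + 1 := by ring
      simpa [e] using h2)
    simpa using h3

/-- The part of a word of length `k + 2` with `k` factors `a 0` and one factor `a 1`. -/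
def subleading (a : ℕ → A) (L : ℝ) (k : ℕ) : A :=
  ∑ p ∈ antidiagonal k, (2 * ((p.1 : ℝ) + 1) * (L - p.1 - 2 * p.2 - 3)) •
    (a 0 ^ p.1 * a 1 * a 0 ^ p.2)

lemma subleading_succ (a : ℕ → A) (L : ℝ) (k : ℕ) :
    subleading a L (k + 1) = (2 * (L + 1 - 2 * ((k + 2 : ℕ) + 1 : ℝ))) •
      (∑ p ∈ antidiagonal (k + 1), a 0 ^ p.1 * a 1 * a 0 ^ p.2) + a 0 * subleading a L k := by
  unfold subleading
  rw [Nat.sum_antidiagonal_succ, Nat.sum_antidiagonal_succ, smul_add, add_assoc]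
  congr 1
  · simp only [pow_zero, one_mul]
    congr 1
    push_cast
    ring
  · rw [smul_sum, mul_sum, ← sum_add_distrib]
    refine sum_congr rfl fun p hp => ?_
    have hk : (k : ℝ) = p.1 + p.2 := by exact_mod_cast (mem_antidiagonal.1 hp).symm
    rw [mul_smul_comm, ← mul_assoc, ← mul_assoc, ← pow_succ', ← add_smul]
    congr 1
    push_cast
    rw [hk]
    ring

include hδ ha in
lemma subleading_order (k : ℕ) : HasSymbol δ (2 * k + 3) (subleading a L k) 0 := by
  have := HasSymbol.sum (antidiagonal k) (δ := δ) (m := 2 * k + 3) (f := fun _ => 0)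
    (F := fun p => (2 * ((p.1 : ℝ) + 1) * (L - p.1 - 2 * p.2 - 3)) •
      (a 0 ^ p.1 * a 1 * a 0 ^ p.2)) fun p hp => by
    have hk := HasAntidiagonal.mem_antidiagonal.1 hp
    have h := (((((ha 0).pow hδ p.1).mul hδ (ha 1)).mul hδ ((ha 0).pow hδ p.2)).of_lt
      (k := 2 * k + 3) (by omega)).smul (2 * ((p.1 : ℝ) + 1) * (L - p.1 - 2 * p.2 - 3))
    rwa [smul_zero] at h
  rwa [sum_const_zero] at this

include hδ ha in
-- Choosing a derivative in one factor removes a coefficient and so loses two orders. In degree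
-- zero, no derivative leaves the pure power of `a 0`, one derivative forces exactly one `a 1`, and
-- two or more leave order at most `2k`. The second statement, for the coefficient of `ρ`, feeds the
-- derivative term in the induction.
lemma wordCoeff_subleading (k : ℕ) :
    HasSymbol δ (2 * k + 1) (wordCoeff a L (k + 2) 0 - a 0 ^ (k + 2) - subleading a L k) 0 ∧
    HasSymbol δ (2 * k + 3) (wordCoeff a L (k + 2) 1
      - ∑ p ∈ antidiagonal (k + 1), a 0 ^ p.1 * a 1 * a 0 ^ p.2) 0 := by
  induction k with
  | zero =>
    have h1 : ∀ m, wordCoeff a L 1 m = a m := by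
      intro m
      rw [wordCoeff_succ, Nat.sum_antidiagonal_eq_sum_range_succ_mk, sum_range_succ,
        sum_eq_zero]
      · simp [wordCoeff_zero]
      · intro i hi
        rw [mem_range] at hi
        rw [wordCoeff_zero, Pi.single_eq_of_ne (by simp only; omega), mul_zero]
    constructor
    · rw [wordCoeff_succ]
      simp only [h1, subleading, Nat.antidiagonal_zero, sum_singleton]
      convert HasSymbol.zero (δ := δ) using 1
      rw [pow_two]
      simp only [pow_zero, one_mul, mul_one]
      have : 2 * (((0 : ℕ) : ℝ) + 1) * (L + 1 - 2 * (((0 + 1 : ℕ) : ℝ) + 1) - ((0 : ℕ) : ℝ))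
        = 2 * (((0 : ℕ) : ℝ) + 1) * (L - ((0 : ℕ) : ℝ) - 2 * ((0 : ℕ) : ℝ) - 3) := by
        push_cast; ring
      rw [this]
      abel
    · rw [wordCoeff_succ]
      simp only [h1, Nat.sum_antidiagonal_succ, Nat.antidiagonal_zero, sum_singleton]
      have := ((ha 2).smul (2 * (((1 : ℕ) : ℝ) + 1) * (L + 1 - 2 * (((0 + 1 : ℕ) : ℝ) + 1)
        - ((1 : ℕ) : ℝ)))).of_lt (k := 2 * 0 + 3) (by omega)
      convert this using 1
      simp only [pow_zero, one_mul, mul_one, zero_add, pow_one]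
      abel
  | succ k ih =>
    obtain ⟨ih0, ih1⟩ := ih
    set U := ∑ p ∈ antidiagonal (k + 1), a 0 ^ p.1 * a 1 * a 0 ^ p.2 with hU
    constructor
    · have h := (ih1.smul (2 * (L + 1 - 2 * ((k + 2 : ℕ) + 1 : ℝ)))).add
        (m := 2 * k + 3) (c' := 0) (T' := a 0 * (wordCoeff a L (k + 2) 0 - a 0 ^ (k + 2)
          - subleading a L k)) (by
          have := (ha 0).mul hδ ih0
          rw [mul_zero] at this
          convert this using 1
          ring)
      rw [smul_zero, add_zero] at h
      have e1 : 2 * (k + 1) + 1 = 2 * k + 3 := by ring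
      rw [e1]
      convert h using 1
      rw [wordCoeff_succ, subleading_succ, ← hU]
      simp only [Nat.antidiagonal_zero, sum_singleton]
      have e : 2 * (((0 : ℕ) : ℝ) + 1) * (L + 1 - 2 * (((k + 1 + 1 : ℕ) : ℝ) + 1) - ((0 : ℕ) : ℝ))
        = 2 * (L + 1 - 2 * (((k + 2 : ℕ) : ℝ) + 1)) := by push_cast; ring
      rw [e, pow_succ' (a 0) (k + 2), mul_sub (a 0), mul_sub (a 0), smul_sub]
      abel
    · have h0 := (wordCoeff_order hδ ha L (k + 2) 2).smul (2 * (((1 : ℕ) : ℝ) + 1) *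
        (L + 1 - 2 * (((k + 2 : ℕ) : ℝ) + 1) - ((1 : ℕ) : ℝ)))
      have h1 := (ha 0).mul hδ ih1
      have h2 := (ha 1).mul hδ ((ih0.of_lt (show _ < 2 * k + 3 by omega)).add
        (subleading_order hδ ha L k))
      rw [smul_zero] at h0
      rw [mul_zero] at h1
      rw [zero_add, mul_zero] at h2
      have e1 : 2 + (2 * k + 3) = 2 * (k + 1) + 3 := by ring
      have e2 : 2 * (k + 2) + 1 = 2 * (k + 1) + 3 := by ring
      rw [e1] at h1 h2
      rw [e2] at h0
      have h := (h0.add h1).add h2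
      rw [add_zero, add_zero] at h
      convert h using 1
      have hU' : ∑ p ∈ antidiagonal (k + 1 + 1), a 0 ^ p.1 * a 1 * a 0 ^ p.2
          = a 1 * a 0 ^ (k + 2) + a 0 * U := by
        rw [Nat.sum_antidiagonal_succ, hU, mul_sum]
        simp only [pow_zero, one_mul, pow_succ', mul_assoc]
      rw [wordCoeff_succ, hU', Nat.sum_antidiagonal_succ]
      simp only [Nat.antidiagonal_zero, sum_singleton, zero_add, mul_sub, sub_add_cancel]
      abel

include hδ ha in
-- Moving `a 1` to the left past `i` factors `a 0` creates `i` commutators, each with principal part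
-- `κ`. The remaining `k` factors contribute `q 0 ^ k`.
lemma hasSymbol_commuted {κ : A} (hκ : HasSymbol δ 3 (a 0 * a 1 - a 1 * a 0) κ)
    (hc : Commute (q 0) κ) (k i j : ℕ) (hij : i + j = k + 1) :
    HasSymbol δ (2 * k + 3) (a 0 ^ i * a 1 * a 0 ^ j - a 1 * a 0 ^ (k + 1))
      ((i : ℝ) • (q 0 ^ k * κ)) := by
  induction i generalizing j k with
  | zero =>
    obtain rfl : j = k + 1 := by omega
    simpa using HasSymbol.zero
  | succ i ih =>
    have key : a 0 ^ (i + 1) * a 1 * a 0 ^ j - a 1 * a 0 ^ (k + 1)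
        = a 0 * (a 0 ^ i * a 1 * a 0 ^ j - a 1 * a 0 ^ k)
          + (a 0 * a 1 - a 1 * a 0) * a 0 ^ k := by
      rw [pow_succ' (a 0) i, pow_succ' (a 0) k]
      noncomm_ring
    have h1 := hκ.mul hδ ((ha 0).pow hδ k)
    rw [show 3 + 2 * k = 2 * k + 3 by ring, ← (hc.pow_left k).eq] at h1
    rw [key]
    cases k with
    | zero =>
      obtain ⟨rfl, rfl⟩ : i = 0 ∧ j = 0 := by omega
      simpa using h1
    | succ k =>
      have h2 := ((ha 0).mul hδ (ih k j (by omega)))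
      rw [show 2 + (2 * k + 3) = 2 * (k + 1) + 3 by ring] at h2
      convert h2.add h1 using 1
      rw [mul_smul_comm, ← mul_assoc, ← pow_succ']
      push_cast
      module

/-- Adding the sum to its image under the exchange of `p.1` and `p.2` leaves the antisymmetric part
of the coefficient, which is `2 (L - (k+3)) (p.1 - p.2)` because `p.1 + p.2 = k + 1`. -/
lemma sum_antisymm (k : ℕ) :
    ∑ p ∈ antidiagonal (k + 1), (2 * ((p.1 : ℝ) + 1) * (L - p.1 - 2 * p.2 - 3)) * (p.1 - p.2)
      = (L - (k + 3)) * ∑ p ∈ antidiagonal (k + 1), ((p.1 : ℝ) - p.2) ^ 2 := by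
  have h := Nat.sum_antidiagonal_swap (n := k + 1) (f := fun p : ℕ × ℕ =>
    (2 * ((p.1 : ℝ) + 1) * (L - p.1 - 2 * p.2 - 3)) * ((p.1 : ℝ) - p.2))
  have h2 : ∑ p ∈ antidiagonal (k + 1),
      ((2 * ((p.1 : ℝ) + 1) * (L - p.1 - 2 * p.2 - 3)) * (p.1 - p.2)
      + (2 * ((p.2 : ℝ) + 1) * (L - p.2 - 2 * p.1 - 3)) * (p.2 - p.1))
      = 2 * ((L - (k + 3)) * ∑ p ∈ antidiagonal (k + 1), ((p.1 : ℝ) - p.2) ^ 2) := by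
    rw [mul_sum, mul_sum]
    refine sum_congr rfl fun p hp => ?_
    have hk : (p.1 : ℝ) + p.2 = k + 1 := by
      exact_mod_cast HasAntidiagonal.mem_antidiagonal.1 hp
    have hk' : (k : ℝ) = p.1 + p.2 - 1 := by linarith
    rw [hk']
    ring
  rw [sum_add_distrib] at h2
  simp only [Prod.fst_swap, Prod.snd_swap] at h
  rw [h] at h2
  linarith

include hδ ha in
-- The pure power of `a 0` is its own reverse and cancels, so the difference is governed by the
-- words with a single `a 1`. Reversal exchanges the numbers of factors `a 0` on the two sides of `a
-- 1`, and `sum_antisymm` exposes the factor `L - (k+3)`.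
theorem wordCoeff_sub_reverse {κ : A} (hκ : HasSymbol δ 3 (a 0 * a 1 - a 1 * a 0) κ)
    (hc : Commute (q 0) κ) (k : ℕ) :
    HasSymbol δ (2 * k + 3) (wordCoeff a L (k + 3) 0
      - unop (wordCoeff (fun i => op (a i)) L (k + 3) 0))
      (((L - (k + 3)) * ∑ p ∈ antidiagonal (k + 1), ((p.1 : ℝ) - p.2) ^ 2) • (q 0 ^ k * κ)) := by
  -- The derivation is carried over to the opposite ring, so that the expansion of words applies to
  -- the reversed word as well.
  set δ' : Aᵐᵒᵖ →ₗ[ℝ] Aᵐᵒᵖ := (opLinearEquiv ℝ).toLinearMap ∘ₗ δ ∘ₗ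
    (opLinearEquiv ℝ).symm.toLinearMap with hδ'
  have hop : ∀ (m : ℕ) (x : A), (δ' ^ m) (op x) = op ((δ ^ m) x) := by
    intro m x
    induction m with
    | zero => rfl
    | succ m ih => rw [pow_succ', pow_succ', Module.End.mul_apply, ih]; rfl
  have hsym : ∀ {m : ℕ} {x c : A}, HasSymbol δ m x c → HasSymbol δ' m (op x) (op c) := by
    intro m x c h
    refine ⟨by rw [hop, h.1]; rfl, ?_⟩
    have := hop 1 c
    rw [pow_one, pow_one, h.2] at this
    simpa using this
  have hsym' : ∀ {m : ℕ} {x : Aᵐᵒᵖ}, HasSymbol δ' m x 0 → HasSymbol δ m (unop x) 0 := by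
    intro m x h
    refine ⟨?_, map_zero _⟩
    have := h.1
    rw [← op_unop x, hop, smul_zero] at this
    rw [smul_zero]
    exact op_injective this
  have hder : ∀ x y : Aᵐᵒᵖ, δ' (x * y) = δ' x * y + x * δ' y := by
    intro x y
    change op (δ (unop y * unop x)) = op (δ (unop x)) * y + x * op (δ (unop y))
    rw [hδ, ← op_unop x, ← op_unop y]
    simp only [unop_op, op_add, op_mul]
    rw [add_comm]
  have h1 := (wordCoeff_subleading hδ ha L (k + 1)).1
  have h2 := hsym' (wordCoeff_subleading hder (fun i => hsym (ha i)) L (k + 1)).1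
  have h3 : HasSymbol δ (2 * k + 3) (subleading a L (k + 1)
      - unop (subleading (fun i => op (a i)) L (k + 1)))
      (((L - (k + 3)) * ∑ p ∈ antidiagonal (k + 1), ((p.1 : ℝ) - p.2) ^ 2) • (q 0 ^ k * κ)) := by
    have e : subleading a L (k + 1) - unop (subleading (fun i => op (a i)) L (k + 1))
        = ∑ p ∈ antidiagonal (k + 1), (2 * ((p.1 : ℝ) + 1) * (L - p.1 - 2 * p.2 - 3)) •
          ((a 0 ^ p.1 * a 1 * a 0 ^ p.2 - a 1 * a 0 ^ (k + 1))
            - (a 0 ^ p.2 * a 1 * a 0 ^ p.1 - a 1 * a 0 ^ (k + 1))) := by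
      unfold subleading
      rw [unop_sum, ← sum_sub_distrib]
      refine sum_congr rfl fun p _ => ?_
      rw [sub_sub_sub_cancel_right, smul_sub]
      simp [mul_assoc]
    rw [e, ← sum_antisymm, sum_smul]
    refine HasSymbol.sum _ fun p hp => ?_
    have hp' := HasAntidiagonal.mem_antidiagonal.1 hp
    have := ((hasSymbol_commuted hδ ha hκ hc k p.1 p.2 hp').sub
      (hasSymbol_commuted hδ ha hκ hc k p.2 p.1 (by omega))).smul
      (2 * ((p.1 : ℝ) + 1) * (L - p.1 - 2 * p.2 - 3))
    rwa [← sub_smul, smul_smul] at this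
  have h := (h1.sub h2).add h3
  rw [sub_zero, zero_add] at h
  rw [show 2 * k + 3 = 2 * (k + 1) + 1 by ring]
  convert h using 1
  rw [show k + 1 + 2 = k + 3 from rfl, MulOpposite.unop_sub, MulOpposite.unop_sub, MulOpposite.unop_pow,
    MulOpposite.unop_op]
  abel

end Words

end Order

/-! ### Taylor coefficients in `ρ` -/

section Taylor

open Finset

/-- The `m`-th Taylor coefficient at `0`. -/
def tcoef (m : ℕ) (f : ℝ → ℝ) : ℝ := iteratedDeriv m f 0 / m.factorial

lemma tcoef_zero (f : ℝ → ℝ) : tcoef 0 f = f 0 := by simp [tcoef]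

lemma tcoef_congr {f g : ℝ → ℝ} (h : f =ᶠ[𝓝 0] g) (m : ℕ) : tcoef m f = tcoef m g := by
  rw [tcoef, tcoef, h.iteratedDeriv_eq]

lemma tcoef_add {f g : ℝ → ℝ} (hf : ContDiffAt ℝ ∞ f 0) (hg : ContDiffAt ℝ ∞ g 0) (m : ℕ) :
    tcoef m (fun r => f r + g r) = tcoef m f + tcoef m g := by
  rw [tcoef, iteratedDeriv_fun_add (hf.of_le (by exact_mod_cast le_top))
    (hg.of_le (by exact_mod_cast le_top)), add_div]
  rfl

lemma tcoef_sum {ι : Type*} (s : Finset ι) {f : ι → ℝ → ℝ}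
    (hf : ∀ i ∈ s, ContDiffAt ℝ ∞ (f i) 0) (m : ℕ) :
    tcoef m (fun r => ∑ i ∈ s, f i r) = ∑ i ∈ s, tcoef m (f i) := by
  rw [tcoef, iteratedDeriv_fun_sum fun i hi => (hf i hi).of_le (by exact_mod_cast le_top),
    sum_div]
  rfl

lemma tcoef_const_mul (c : ℝ) (f : ℝ → ℝ) (m : ℕ) :
    tcoef m (fun r => c * f r) = c * tcoef m f := by
  rw [tcoef, iteratedDeriv_const_mul_field, mul_div_assoc]
  rfl

lemma tcoef_mul {f g : ℝ → ℝ} (hf : ContDiffAt ℝ ∞ f 0) (hg : ContDiffAt ℝ ∞ g 0) (m : ℕ) :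
    tcoef m (fun r => f r * g r) = ∑ p ∈ antidiagonal m, tcoef p.1 f * tcoef p.2 g := by
  rw [tcoef, iteratedDeriv_fun_mul (hf.of_le (by exact_mod_cast le_top))
    (hg.of_le (by exact_mod_cast le_top)), sum_div, Nat.sum_antidiagonal_eq_sum_range_succ_mk]
  refine sum_congr rfl fun i hi => ?_
  have hi' : i ≤ m := Nat.lt_succ_iff.1 (mem_range.1 hi)
  rw [tcoef, tcoef, Nat.cast_choose ℝ hi']
  field_simp

lemma tcoef_deriv (f : ℝ → ℝ) (m : ℕ) :
    tcoef m (deriv f) = ((m : ℝ) + 1) * tcoef (m + 1) f := by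
  rw [tcoef, tcoef, iteratedDeriv_succ', Nat.factorial_succ]
  push_cast
  field_simp

lemma tcoef_id (m : ℕ) : tcoef m (fun r => r) = if m = 1 then 1 else 0 := by
  rw [tcoef, iteratedDeriv_fun_id_zero]
  by_cases h : m = 1
  · subst h; simp
  · simp [h]

lemma tcoef_id_mul_zero (f : ℝ → ℝ) : tcoef 0 (fun r => r * f r) = 0 := by
  simp [tcoef_zero]

lemma tcoef_id_mul_succ {f : ℝ → ℝ} (hf : ContDiffAt ℝ ∞ f 0) (m : ℕ) :
    tcoef (m + 1) (fun r => r * f r) = tcoef m f := by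
  rw [tcoef_mul (f := fun r => r) contDiffAt_id hf, Nat.sum_antidiagonal_eq_sum_range_succ_mk,
    sum_eq_single 1]
  · simp [tcoef_id]
  · intro i _ hi
    simp [tcoef_id, hi]
  · intro h
    simp at h

lemma tcoef_const (c : ℝ) (m : ℕ) : tcoef m (fun _ => c) = if m = 0 then c else 0 := by
  rw [tcoef, iteratedDeriv_const]
  by_cases h : m = 0
  · subst h; simp
  · simp [h]

variable {E : Type*} [NormedAddCommGroup E] [NormedSpace ℝ E]

/-- The partial derivative in a direction of `E` of a function on `E × ℝ`. -/
def dx (v : E) (f : E × ℝ → ℝ) : E × ℝ → ℝ := fun q => fderiv ℝ (fun y => f (y, q.2)) q.1 v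

/-- The partial derivative in the direction of `ℝ` of a function on `E × ℝ`. -/
def dr (f : E × ℝ → ℝ) : E × ℝ → ℝ := fun q => deriv (fun r => f (q.1, r)) q.2

omit [NormedAddCommGroup E] [NormedSpace ℝ E] in
lemma dr_iterate (f : E × ℝ → ℝ) (m : ℕ) (y : E) (r : ℝ) :
    dr^[m] f (y, r) = iteratedDeriv m (fun s => f (y, s)) r := by
  induction m generalizing r with
  | zero => rfl
  | succ m ih =>
    rw [Function.iterate_succ_apply', iteratedDeriv_succ]
    exact congrArg (fun g => deriv g r) (funext ih)

variable {W : Set (E × ℝ)} {f g : E × ℝ → ℝ}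

lemma contDiffAt_of_mem (hW : IsOpen W) (hf : ContDiffOn ℝ ∞ f W) {q : E × ℝ} (hq : q ∈ W) :
    ContDiffAt ℝ ∞ f q := hf.contDiffAt (hW.mem_nhds hq)

lemma contDiffAt_slice_right {q : E × ℝ} (hf : ContDiffAt ℝ ∞ f q) :
    ContDiffAt ℝ ∞ (fun r => f (q.1, r)) q.2 :=
  ContDiffAt.comp q.2 (f := fun r => (q.1, r)) hf (contDiffAt_const.prodMk contDiffAt_id)

lemma contDiffAt_slice_left {q : E × ℝ} (hf : ContDiffAt ℝ ∞ f q) :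
    ContDiffAt ℝ ∞ (fun y => f (y, q.2)) q.1 :=
  ContDiffAt.comp q.1 (f := fun y => (y, q.2)) hf (contDiffAt_id.prodMk contDiffAt_const)

lemma dx_eq (v : E) {q : E × ℝ} (hf : DifferentiableAt ℝ f q) :
    dx v f q = fderiv ℝ f q (v, 0) := by
  have h1 : HasFDerivAt (fun y : E => (y, q.2)) (ContinuousLinearMap.inl ℝ E ℝ) q.1 :=
    hasFDerivAt_prodMk_left q.1 q.2
  have h2 := HasFDerivAt.comp q.1 (f := fun y : E => (y, q.2)) hf.hasFDerivAt h1
  unfold dx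
  rw [show (fun y => f (y, q.2)) = f ∘ fun y : E => (y, q.2) from rfl, h2.fderiv]
  rfl

lemma dr_eq {q : E × ℝ} (hf : DifferentiableAt ℝ f q) :
    dr f q = fderiv ℝ f q (0, 1) := by
  have h1 : HasFDerivAt (fun r : ℝ => (q.1, r)) (ContinuousLinearMap.inr ℝ E ℝ) q.2 :=
    hasFDerivAt_prodMk_right q.1 q.2
  have h2 := HasFDerivAt.comp q.2 (f := fun r : ℝ => (q.1, r)) hf.hasFDerivAt h1
  unfold dr
  rw [show (fun r => f (q.1, r)) = f ∘ fun r : ℝ => (q.1, r) from rfl, ← fderiv_apply_one_eq_deriv,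
    h2.fderiv]
  rfl

lemma contDiffOn_fderiv_apply (hW : IsOpen W) (hf : ContDiffOn ℝ ∞ f W) (v : E × ℝ) :
    ContDiffOn ℝ ∞ (fun q => fderiv ℝ f q v) W :=
  (hf.fderiv_of_isOpen hW (by simp)).clm_apply contDiffOn_const

lemma dx_contDiffOn (hW : IsOpen W) (hf : ContDiffOn ℝ ∞ f W) (v : E) :
    ContDiffOn ℝ ∞ (dx v f) W :=
  (contDiffOn_fderiv_apply hW hf (v, 0)).congr fun _ hq =>
    dx_eq v ((contDiffAt_of_mem hW hf hq).differentiableAt (by simp))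

lemma dr_contDiffOn (hW : IsOpen W) (hf : ContDiffOn ℝ ∞ f W) : ContDiffOn ℝ ∞ (dr f) W :=
  (contDiffOn_fderiv_apply hW hf (0, 1)).congr fun _ hq =>
    dr_eq ((contDiffAt_of_mem hW hf hq).differentiableAt (by simp))

omit [NormedSpace ℝ E] in
lemma slice_eventuallyEq_left (hW : IsOpen W) (h : Set.EqOn f g W) {q : E × ℝ} (hq : q ∈ W) :
    (fun y => f (y, q.2)) =ᶠ[𝓝 q.1] fun y => g (y, q.2) := by
  have : Tendsto (fun y : E => (y, q.2)) (𝓝 q.1) (𝓝 q) :=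
    (continuous_id.prodMk continuous_const).continuousAt
  filter_upwards [this (hW.mem_nhds hq)] with y hy using h hy

omit [NormedSpace ℝ E] in
lemma slice_eventuallyEq_right (hW : IsOpen W) (h : Set.EqOn f g W) {q : E × ℝ} (hq : q ∈ W) :
    (fun r => f (q.1, r)) =ᶠ[𝓝 q.2] fun r => g (q.1, r) := by
  have : Tendsto (fun r : ℝ => (q.1, r)) (𝓝 q.2) (𝓝 q) :=
    (continuous_const.prodMk continuous_id).continuousAt
  filter_upwards [this (hW.mem_nhds hq)] with y hy using h hy

lemma dx_congr (hW : IsOpen W) (h : Set.EqOn f g W) (v : E) : Set.EqOn (dx v f) (dx v g) W := by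
  intro q hq
  unfold dx
  rw [(slice_eventuallyEq_left hW h hq).fderiv_eq]

omit [NormedSpace ℝ E] in
lemma dr_congr (hW : IsOpen W) (h : Set.EqOn f g W) : Set.EqOn (dr f) (dr g) W := by
  intro q hq
  exact (slice_eventuallyEq_right hW h hq).deriv_eq

lemma dr_dx (hW : IsOpen W) (hf : ContDiffOn ℝ ∞ f W) (v : E) :
    Set.EqOn (dr (dx v f)) (dx v (dr f)) W := by
  intro q hq
  have hd : ∀ q ∈ W, DifferentiableAt ℝ f q := fun q hq =>
    (contDiffAt_of_mem hW hf hq).differentiableAt (by simp)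
  have h1 : Set.EqOn (dx v f) (fun q => fderiv ℝ f q (v, 0)) W := fun q hq => dx_eq v (hd q hq)
  have h2 : Set.EqOn (dr f) (fun q => fderiv ℝ f q (0, 1)) W := fun q hq => dr_eq (hd q hq)
  have hd' : ∀ w : E × ℝ, DifferentiableAt ℝ (fun q => fderiv ℝ f q w) q := fun w =>
    (contDiffAt_of_mem hW (contDiffOn_fderiv_apply hW hf w) hq).differentiableAt (by simp)
  have hd2 : DifferentiableAt ℝ (fderiv ℝ f) q :=
    ((hf.fderiv_of_isOpen hW (m := ∞) (by simp)).contDiffAt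
      (hW.mem_nhds hq)).differentiableAt (by simp)
  rw [dr_congr hW h1 hq, dx_congr hW h2 v hq, dr_eq (hd' _), dx_eq _ (hd' _)]
  have h3 : ∀ w w' : E × ℝ, fderiv ℝ (fun q => fderiv ℝ f q w) q w'
      = fderiv ℝ (fderiv ℝ f) q w' w := by
    intro w w'
    rw [fderiv_clm_apply hd2 (differentiableAt_const w)]
    simp
  rw [h3, h3]
  exact ((contDiffAt_of_mem hW hf hq).isSymmSndFDerivAt (by
    rw [minSmoothness_of_isRCLikeNormedField]; exact WithTop.coe_le_coe.2 (le_top : (2 : ℕ∞) ≤ ⊤))).eq _ _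

lemma dr_iterate_contDiffOn (hW : IsOpen W) (hf : ContDiffOn ℝ ∞ f W) (m : ℕ) :
    ContDiffOn ℝ ∞ (dr^[m] f) W := by
  induction m with
  | zero => exact hf
  | succ m ih => rw [Function.iterate_succ_apply']; exact dr_contDiffOn hW ih

lemma dr_iterate_dx (hW : IsOpen W) (hf : ContDiffOn ℝ ∞ f W) (v : E) (m : ℕ) :
    Set.EqOn (dr^[m] (dx v f)) (dx v (dr^[m] f)) W := by
  induction m with
  | zero => exact fun _ _ => rfl
  | succ m ih =>
    rw [Function.iterate_succ_apply', Function.iterate_succ_apply']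
    exact (dr_congr hW ih).trans (dr_dx hW (dr_iterate_contDiffOn hW hf m) v)

variable {U : Set E} {I : Set ℝ}

lemma tcoef_contDiffOn (hU : IsOpen U) (hI : IsOpen I) (h0 : (0 : ℝ) ∈ I)
    (hf : ContDiffOn ℝ ∞ f (U ×ˢ I)) (m : ℕ) :
    ContDiffOn ℝ ∞ (fun y => tcoef m (fun r => f (y, r))) U := by
  have h := (dr_iterate_contDiffOn (hU.prod hI) hf m).comp (t := U ×ˢ I)
    (f := fun y : E => (y, (0 : ℝ))) (s := U) (contDiffOn_id.prodMk contDiffOn_const)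
    (fun y hy => ⟨hy, h0⟩)
  refine (h.div_const (m.factorial : ℝ)).congr fun y _ => ?_
  simp [tcoef, dr_iterate]

/-- Mixed partial derivatives commute, so expanding in `ρ` and differentiating in `x` may be
interchanged. -/
lemma tcoef_dx (hU : IsOpen U) (hI : IsOpen I) (h0 : (0 : ℝ) ∈ I)
    (hf : ContDiffOn ℝ ∞ f (U ×ˢ I)) (v : E) (m : ℕ) {y : E} (hy : y ∈ U) :
    tcoef m (fun r => dx v f (y, r)) = fderiv ℝ (fun y => tcoef m (fun r => f (y, r))) y v := by
  have h1 : (fun y => tcoef m (fun r => f (y, r)))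
      = fun y => ((m.factorial : ℝ)⁻¹) * dr^[m] f (y, 0) := by
    funext y
    rw [tcoef, dr_iterate, div_eq_inv_mul]
  have hd : DifferentiableAt ℝ (fun y => dr^[m] f (y, 0)) y :=
    (contDiffAt_slice_left (q := (y, 0)) (contDiffAt_of_mem (hU.prod hI)
      (dr_iterate_contDiffOn (hU.prod hI) hf m) (show (y, (0 : ℝ)) ∈ U ×ˢ I from
        ⟨hy, h0⟩))).differentiableAt (by simp)
  rw [h1, fderiv_const_mul hd, tcoef, ← dr_iterate,
    dr_iterate_dx (hU.prod hI) hf v m (show (y, (0 : ℝ)) ∈ U ×ˢ I from ⟨hy, h0⟩), div_eq_inv_mul]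
  rfl

lemma contDiffAt_slice (hU : IsOpen U) (hI : IsOpen I) (hf : ContDiffOn ℝ ∞ f (U ×ˢ I))
    {y : E} {r : ℝ} (hy : y ∈ U) (hr : r ∈ I) : ContDiffAt ℝ ∞ (fun s => f (y, s)) r :=
  contDiffAt_slice_right (q := (y, r)) (contDiffAt_of_mem (hU.prod hI) hf ⟨hy, hr⟩)

end Taylor

/-! ### Second-order operators in divergence form -/

section DivOp

variable {V ι : Type} [NormedAddCommGroup V] [NormedSpace ℝ V] {b : ι → V}

lemma pderiv_congr {f g : V → ℝ} {y : V} (h : f =ᶠ[𝓝 y] g) (i : ι) :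
    pderiv b i f y = pderiv b i g y := by
  unfold pderiv; rw [h.fderiv_eq]

lemma pderiv_eventuallyEq {f g : V → ℝ} {y : V} (h : f =ᶠ[𝓝 y] g) (i : ι) :
    pderiv b i f =ᶠ[𝓝 y] pderiv b i g := by
  filter_upwards [h.eventuallyEq_nhds] with z hz using pderiv_congr hz i

lemma pderiv_add {f g : V → ℝ} {y : V} (hf : DifferentiableAt ℝ f y)
    (hg : DifferentiableAt ℝ g y) (i : ι) :
    pderiv b i (fun z => f z + g z) y = pderiv b i f y + pderiv b i g y := by
  unfold pderiv; rw [fderiv_fun_add hf hg]; rfl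

lemma pderiv_sub {f g : V → ℝ} {y : V} (hf : DifferentiableAt ℝ f y)
    (hg : DifferentiableAt ℝ g y) (i : ι) :
    pderiv b i (fun z => f z - g z) y = pderiv b i f y - pderiv b i g y := by
  unfold pderiv; rw [fderiv_fun_sub hf hg]; rfl

lemma pderiv_mul {f g : V → ℝ} {y : V} (hf : DifferentiableAt ℝ f y)
    (hg : DifferentiableAt ℝ g y) (i : ι) :
    pderiv b i (fun z => f z * g z) y = pderiv b i f y * g y + f y * pderiv b i g y := by
  unfold pderiv
  rw [fderiv_fun_mul hf hg]
  simp only [_root_.add_apply, _root_.smul_apply, smul_eq_mul]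
  ring

lemma pderiv_const_mul (c : ℝ) {f : V → ℝ} {y : V} (hf : DifferentiableAt ℝ f y) (i : ι) :
    pderiv b i (fun z => c * f z) y = c * pderiv b i f y := by
  unfold pderiv; rw [fderiv_const_mul hf]; rfl

lemma pderiv_sum {κ : Type*} (s : Finset κ) {f : κ → V → ℝ} {y : V}
    (hf : ∀ k ∈ s, DifferentiableAt ℝ (f k) y) (i : ι) :
    pderiv b i (fun z => ∑ k ∈ s, f k z) y = ∑ k ∈ s, pderiv b i (f k) y := by
  unfold pderiv; rw [fderiv_fun_sum hf]; simp

lemma pderiv_const (c : ℝ) (y : V) (i : ι) : pderiv b i (fun _ => c) y = 0 := by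
  unfold pderiv; simp

lemma pderiv_inv {f : V → ℝ} {y : V} (hf : DifferentiableAt ℝ f y) (h0 : f y ≠ 0) (i : ι) :
    pderiv b i (fun z => (f z)⁻¹) y = -((f y)⁻¹ * (f y)⁻¹ * pderiv b i f y) := by
  have := pderiv_mul (b := b) hf (hf.fun_inv h0) i
  have h1 : pderiv b i (fun z => f z * (f z)⁻¹) y = 0 := by
    rw [pderiv_congr (g := fun _ => (1 : ℝ)), pderiv_const]
    filter_upwards [hf.continuousAt.eventually_ne h0] with z hz using mul_inv_cancel₀ hz
  rw [h1] at this
  have h2 : f y * pderiv b i (fun z => (f z)⁻¹) y = -(pderiv b i f y * (f y)⁻¹) := by linarith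
  rw [← mul_right_inj' h0, h2]
  field_simp

lemma eventually_differentiableAt {f : V → ℝ} {y : V} (hf : ContDiffAt ℝ ∞ f y) :
    ∀ᶠ z in 𝓝 y, DifferentiableAt ℝ f z :=
  ((hf.of_le (show (1 : ℕ∞ω) ≤ ∞ by simp)).eventually (by simp)).mono
    fun _ hz => hz.differentiableAt (by simp)

lemma contDiffAt_pderiv {f : V → ℝ} {y : V} (hf : ContDiffAt ℝ ∞ f y) (i : ι) :
    ContDiffAt ℝ ∞ (pderiv b i f) y :=
  (hf.fderiv_right (m := ∞) (by simp)).clm_apply contDiffAt_const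

lemma contDiffOn_pderiv {f : V → ℝ} {U : Set V} (hU : IsOpen U) (hf : ContDiffOn ℝ ∞ f U)
    (i : ι) : ContDiffOn ℝ ∞ (pderiv b i f) U := fun _ hy =>
  (contDiffAt_pderiv (hf.contDiffAt (hU.mem_nhds hy)) i).contDiffWithinAt

variable [Fintype ι]

/-- The operator `μ⁻¹ ∂_i (μ q^{ij} ∂_j h)`. -/
def divOp (b : ι → V) (μ : V → ℝ) (q : V → Matrix ι ι ℝ) (h : V → ℝ) : V → ℝ :=
  fun y => (μ y)⁻¹ * ∑ i, pderiv b i (fun z => μ z * ∑ j, q z i j * pderiv b j h z) y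

lemma divOp_congr {μ μ' : V → ℝ} {q q' : V → Matrix ι ι ℝ} {h h' : V → ℝ} {y : V}
    (hμ : μ =ᶠ[𝓝 y] μ') (hq : q =ᶠ[𝓝 y] q') (hh : h =ᶠ[𝓝 y] h') :
    divOp b μ q h y = divOp b μ' q' h' y := by
  unfold divOp
  rw [hμ.eq_of_nhds]
  congr 1
  refine Finset.sum_congr rfl fun i _ => pderiv_congr ?_ i
  filter_upwards [hμ, hq, eventually_all.2 fun j => pderiv_eventuallyEq (b := b) hh j]
    with z h1 h2 h3
  rw [h1, h2]
  simp only [h3]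

section

variable {μ : V → ℝ} {q : V → Matrix ι ι ℝ} {y : V}

lemma contDiffAt_flux (hμ : ContDiffAt ℝ ∞ μ y)
    (hq : ∀ i j, ContDiffAt ℝ ∞ (fun z => q z i j) y) {h : V → ℝ} (hh : ContDiffAt ℝ ∞ h y)
    (i : ι) : ContDiffAt ℝ ∞ (fun z => μ z * ∑ j, q z i j * pderiv b j h z) y :=
  hμ.mul (ContDiffAt.sum fun j _ => (hq i j).mul (contDiffAt_pderiv hh j))

lemma contDiffAt_divOp (hμ : ContDiffAt ℝ ∞ μ y) (h0 : μ y ≠ 0)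
    (hq : ∀ i j, ContDiffAt ℝ ∞ (fun z => q z i j) y) {h : V → ℝ} (hh : ContDiffAt ℝ ∞ h y) :
    ContDiffAt ℝ ∞ (divOp b μ q h) y :=
  (hμ.inv h0).mul (ContDiffAt.sum fun i _ => contDiffAt_pderiv (contDiffAt_flux hμ hq hh i) i)

/-- Since `w² ∂(w⁻¹ v) = w ∂v - v ∂w`, conjugation by `w` trades the density `w² μ` for `μ` at the
cost of a potential. The first-order cross terms cancel by the symmetry of `q`. -/
lemma divOp_conj (hμ : ContDiffAt ℝ ∞ μ y)
    (hq : ∀ i j, ContDiffAt ℝ ∞ (fun z => q z i j) y) (hs : ∀ i j, q y i j = q y j i)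
    {w v : V → ℝ} (hw : ContDiffAt ℝ ∞ w y) (hv : ContDiffAt ℝ ∞ v y) (h0 : w y ≠ 0) :
    w y * divOp b (fun z => w z ^ 2 * μ z) q (fun z => (w z)⁻¹ * v z) y
      = divOp b μ q v y - (w y)⁻¹ * v y * divOp b μ q w y := by
  have hne : ∀ᶠ z in 𝓝 y, w z ≠ 0 := hw.continuousAt.eventually_ne h0
  have hwe : ∀ᶠ z in 𝓝 y, DifferentiableAt ℝ w z :=
    eventually_differentiableAt hw
  have hve : ∀ᶠ z in 𝓝 y, DifferentiableAt ℝ v z :=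
    eventually_differentiableAt hv
  have hdw : DifferentiableAt ℝ w y := hw.differentiableAt (by simp)
  have hdv : DifferentiableAt ℝ v y := hv.differentiableAt (by simp)
  have hF : ∀ i, DifferentiableAt ℝ (fun z => μ z * ∑ j, q z i j * pderiv b j v z) y :=
    fun i => (contDiffAt_flux hμ hq hv i).differentiableAt (by simp)
  have hG : ∀ i, DifferentiableAt ℝ (fun z => μ z * ∑ j, q z i j * pderiv b j w z) y :=
    fun i => (contDiffAt_flux hμ hq hw i).differentiableAt (by simp)
  have key : ∀ i, pderiv b i (fun z => w z ^ 2 * μ z *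
      ∑ j, q z i j * pderiv b j (fun z => (w z)⁻¹ * v z) z) y
      = pderiv b i w y * (μ y * ∑ j, q y i j * pderiv b j v y)
        + w y * pderiv b i (fun z => μ z * ∑ j, q z i j * pderiv b j v z) y
        - (pderiv b i v y * (μ y * ∑ j, q y i j * pderiv b j w y)
        + v y * pderiv b i (fun z => μ z * ∑ j, q z i j * pderiv b j w z) y) := by
    intro i
    rw [← pderiv_mul hdw (hF i), ← pderiv_mul hdv (hG i), ← pderiv_sub (hdw.fun_mul (hF i))
      (hdv.fun_mul (hG i))]
    refine pderiv_congr ?_ i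
    filter_upwards [hne, hwe, hve] with z h1 h2 h3
    simp only [Finset.mul_sum, ← Finset.sum_sub_distrib]
    refine Finset.sum_congr rfl fun j _ => ?_
    rw [pderiv_mul (h2.fun_inv h1) h3, pderiv_inv h2 h1]
    field_simp
    ring
  have cross : ∑ i, pderiv b i w y * (μ y * ∑ j, q y i j * pderiv b j v y)
      = ∑ i, pderiv b i v y * (μ y * ∑ j, q y i j * pderiv b j w y) := by
    simp only [Finset.mul_sum]
    rw [Finset.sum_comm]
    refine Finset.sum_congr rfl fun j _ => Finset.sum_congr rfl fun i _ => ?_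
    rw [hs i j]
    ring
  unfold divOp
  rw [Finset.sum_congr rfl fun i _ => key i, Finset.sum_sub_distrib, Finset.sum_add_distrib,
    Finset.sum_add_distrib, cross, ← Finset.mul_sum, ← Finset.mul_sum]
  field_simp
  ring

lemma divOp_mul (hμ : ContDiffAt ℝ ∞ μ y) (h0 : μ y ≠ 0)
    (hq : ∀ i j, ContDiffAt ℝ ∞ (fun z => q z i j) y) (hs : ∀ i j, q y i j = q y j i)
    {f h : V → ℝ} (hf : ContDiffAt ℝ ∞ f y) (hh : ContDiffAt ℝ ∞ h y) :
    divOp b μ q (fun z => f z * h z) y = f y * divOp b μ q h y + h y * divOp b μ q f y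
      + 2 * ∑ i, ∑ j, q y i j * pderiv b i f y * pderiv b j h y := by
  have hfe : ∀ᶠ z in 𝓝 y, DifferentiableAt ℝ f z :=
    eventually_differentiableAt hf
  have hhe : ∀ᶠ z in 𝓝 y, DifferentiableAt ℝ h z :=
    eventually_differentiableAt hh
  have hdf : DifferentiableAt ℝ f y := hf.differentiableAt (by simp)
  have hdh : DifferentiableAt ℝ h y := hh.differentiableAt (by simp)
  have hF : ∀ i, DifferentiableAt ℝ (fun z => μ z * ∑ j, q z i j * pderiv b j f z) y :=
    fun i => (contDiffAt_flux hμ hq hf i).differentiableAt (by simp)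
  have hG : ∀ i, DifferentiableAt ℝ (fun z => μ z * ∑ j, q z i j * pderiv b j h z) y :=
    fun i => (contDiffAt_flux hμ hq hh i).differentiableAt (by simp)
  have key : ∀ i, pderiv b i (fun z => μ z *
      ∑ j, q z i j * pderiv b j (fun z => f z * h z) z) y
      = (pderiv b i f y * (μ y * ∑ j, q y i j * pderiv b j h y)
        + f y * pderiv b i (fun z => μ z * ∑ j, q z i j * pderiv b j h z) y)
        + (pderiv b i h y * (μ y * ∑ j, q y i j * pderiv b j f y)
        + h y * pderiv b i (fun z => μ z * ∑ j, q z i j * pderiv b j f z) y) := by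
    intro i
    rw [← pderiv_mul hdf (hG i), ← pderiv_mul hdh (hF i), ← pderiv_add (hdf.fun_mul (hG i))
      (hdh.fun_mul (hF i))]
    refine pderiv_congr ?_ i
    filter_upwards [hfe, hhe] with z h2 h3
    simp only [Finset.mul_sum, ← Finset.sum_add_distrib]
    refine Finset.sum_congr rfl fun j _ => ?_
    rw [pderiv_mul h2 h3]
    ring
  have c1 : ∑ i, pderiv b i f y * (μ y * ∑ j, q y i j * pderiv b j h y)
      = μ y * ∑ i, ∑ j, q y i j * pderiv b i f y * pderiv b j h y := by
    simp only [Finset.mul_sum]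
    refine Finset.sum_congr rfl fun j _ => Finset.sum_congr rfl fun i _ => ?_
    ring
  have c2 : ∑ i, pderiv b i h y * (μ y * ∑ j, q y i j * pderiv b j f y)
      = μ y * ∑ i, ∑ j, q y i j * pderiv b i f y * pderiv b j h y := by
    simp only [Finset.mul_sum]
    rw [Finset.sum_comm]
    refine Finset.sum_congr rfl fun j _ => Finset.sum_congr rfl fun i _ => ?_
    rw [hs i j]
    ring
  unfold divOp
  rw [Finset.sum_congr rfl fun i _ => key i, Finset.sum_add_distrib, Finset.sum_add_distrib,
    Finset.sum_add_distrib, c1, c2, ← Finset.mul_sum, ← Finset.mul_sum]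
  field_simp
  ring

lemma divOp_add (hμ : ContDiffAt ℝ ∞ μ y)
    (hq : ∀ i j, ContDiffAt ℝ ∞ (fun z => q z i j) y)
    {f h : V → ℝ} (hf : ContDiffAt ℝ ∞ f y) (hh : ContDiffAt ℝ ∞ h y) :
    divOp b μ q (fun z => f z + h z) y = divOp b μ q f y + divOp b μ q h y := by
  have hfe : ∀ᶠ z in 𝓝 y, DifferentiableAt ℝ f z :=
    eventually_differentiableAt hf
  have hhe : ∀ᶠ z in 𝓝 y, DifferentiableAt ℝ h z :=
    eventually_differentiableAt hh
  unfold divOp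
  rw [← mul_add, ← Finset.sum_add_distrib]
  congr 1
  refine Finset.sum_congr rfl fun i _ => ?_
  rw [← pderiv_add ((contDiffAt_flux hμ hq hf i).differentiableAt (by simp))
    ((contDiffAt_flux hμ hq hh i).differentiableAt (by simp))]
  refine pderiv_congr ?_ i
  filter_upwards [hfe, hhe] with z h2 h3
  simp only [Finset.mul_sum, ← Finset.sum_add_distrib]
  refine Finset.sum_congr rfl fun j _ => ?_
  rw [pderiv_add h2 h3]
  ring

lemma divOp_const_mul (hμ : ContDiffAt ℝ ∞ μ y)
    (hq : ∀ i j, ContDiffAt ℝ ∞ (fun z => q z i j) y) (c : ℝ)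
    {f : V → ℝ} (hf : ContDiffAt ℝ ∞ f y) :
    divOp b μ q (fun z => c * f z) y = c * divOp b μ q f y := by
  have hfe : ∀ᶠ z in 𝓝 y, DifferentiableAt ℝ f z :=
    eventually_differentiableAt hf
  unfold divOp
  rw [mul_left_comm, Finset.mul_sum _ _ c]
  congr 1
  refine Finset.sum_congr rfl fun i _ => ?_
  rw [← pderiv_const_mul c ((contDiffAt_flux hμ hq hf i).differentiableAt (by simp))]
  refine pderiv_congr ?_ i
  filter_upwards [hfe] with z h2
  simp only [Finset.mul_sum]
  refine Finset.sum_congr rfl fun j _ => ?_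
  rw [pderiv_const_mul c h2]
  ring

end

end DivOp

/-! ### The inverse and the determinant of the ambient Gram matrix. -/

section AmbMatrix

variable {n : ℕ} {X : Type} [TopologicalSpace X] [ChartedSpace (EuclideanSpace ℝ (Fin n)) X]

/-- The inverse of `ambGram`. -/
def ambInv (g : FormFamily n X) (p : X) (z : AmbCoord n) : Matrix (AmbIdx n) (AmbIdx n) ℝ :=
  Matrix.of fun
    | .inl _, .inr (.inr _) => z.1⁻¹
    | .inr (.inr _), .inl _ => z.1⁻¹
    | .inr (.inr _), .inr (.inr _) => -2 * z.2.2 * z.1⁻¹ ^ 2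
    | .inr (.inl i), .inr (.inl j) => z.1⁻¹ ^ 2 * (chartGram g p z.2.2 z.2.1)⁻¹ i j
    | _, _ => 0

lemma ambGram_inv (g : FormFamily n X) (p : X) (z : AmbCoord n) (hτ : z.1 ≠ 0)
    (hdet : (chartGram g p z.2.2 z.2.1).det ≠ 0) : (ambGram g p z)⁻¹ = ambInv g p z := by
  have hinv := Matrix.mul_nonsing_inv (chartGram g p z.2.2 z.2.1) (isUnit_iff_ne_zero.2 hdet)
  refine Matrix.inv_eq_right_inv ?_
  ext I J
  have hij : ∀ i j, ∑ k, chartGram g p z.2.2 z.2.1 i k * (chartGram g p z.2.2 z.2.1)⁻¹ k j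
      = (1 : Matrix (Fin n) (Fin n) ℝ) i j := fun i j => by rw [← hinv]; rfl
  rw [Matrix.mul_apply, Fintype.sum_sum_type, Fintype.sum_sum_type]
  rcases I with _ | i | _ <;> rcases J with _ | j | _ <;>
    simp [ambGram, ambInv, Matrix.one_apply, hτ]
  · field_simp; ring
  · have : ∀ k, z.1 ^ 2 * chartGram g p z.2.2 z.2.1 i k *
        ((z.1 ^ 2)⁻¹ * (chartGram g p z.2.2 z.2.1)⁻¹ k j)
        = chartGram g p z.2.2 z.2.1 i k * (chartGram g p z.2.2 z.2.1)⁻¹ k j := by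
      intro k; field_simp
    simp only [this, hij, Matrix.one_apply]

/-- After reordering the indices the `(τ, ρ)` block, of determinant `-τ²`, splits off from `τ² g_ρ`.
-/
lemma ambGram_det (g : FormFamily n X) (p : X) (z : AmbCoord n) :
    (ambGram g p z).det = -(z.1 ^ (n + 1)) ^ 2 * (chartGram g p z.2.2 z.2.1).det := by
  let e : Fin 2 ⊕ Fin n ≃ AmbIdx n :=
    { toFun := Sum.elim ![.inl (), .inr (.inr ())] fun i => .inr (.inl i)
      invFun := Sum.elim (fun _ => .inl 0) (Sum.elim .inr fun _ => .inl 1)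
      left_inv := by
        rintro (i | i)
        · fin_cases i <;> rfl
        · rfl
      right_inv := by rintro (_ | i | _) <;> rfl }
  have h : (ambGram g p z).submatrix e e
      = Matrix.fromBlocks !![2 * z.2.2, z.1; z.1, 0] 0 0
        (z.1 ^ 2 • chartGram g p z.2.2 z.2.1) := by
    ext i j
    rcases i with i | i <;> rcases j with j | j
    · fin_cases i <;> fin_cases j <;> rfl
    · fin_cases i <;> rfl
    · fin_cases j <;> rfl
    · rfl
  rw [← Matrix.det_submatrix_equiv_self e, h, Matrix.det_fromBlocks_zero₂₁, Matrix.det_fin_two,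
    Matrix.det_smul]
  simp
  ring

lemma sqrt_ambGram_det (g : FormFamily n X) (p : X) (z : AmbCoord n) (hτ : 0 < z.1) :
    √|(ambGram g p z).det| = z.1 ^ (n + 1) * √|(chartGram g p z.2.2 z.2.1).det| := by
  rw [ambGram_det, neg_mul, abs_neg, abs_mul, Real.sqrt_mul (abs_nonneg _),
    abs_of_nonneg (by positivity), Real.sqrt_sq (by positivity)]

end AmbMatrix

/-! ### The Gram matrices in the charts -/

section Charts

/-- The coordinate space of an `n`-dimensional manifold. -/
abbrev Eu (n : ℕ) : Type := EuclideanSpace ℝ (Fin n)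

variable {n : ℕ} {X : Type} [TopologicalSpace X] [ChartedSpace (EuclideanSpace ℝ (Fin n)) X]

/-- The coordinates of the preferred chart at `p`. -/
abbrev crd (n : ℕ) {X : Type} [TopologicalSpace X] [ChartedSpace (EuclideanSpace ℝ (Fin n)) X]
    (p : X) : X → Eu n := extChartAt (𝓡 n) p

/-- The parametrization inverse to the preferred chart at `p`. -/
abbrev par (n : ℕ) {X : Type} [TopologicalSpace X] [ChartedSpace (EuclideanSpace ℝ (Fin n)) X]
    (p : X) : Eu n → X := (extChartAt (𝓡 n) p).symm

/-- The domain of the preferred chart at `p`. -/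
abbrev src (n : ℕ) {X : Type} [TopologicalSpace X] [ChartedSpace (EuclideanSpace ℝ (Fin n)) X]
    (p : X) : Set X := (extChartAt (𝓡 n) p).source

/-- The image of the preferred chart at `p`. -/
abbrev tgt (n : ℕ) {X : Type} [TopologicalSpace X] [ChartedSpace (EuclideanSpace ℝ (Fin n)) X]
    (p : X) : Set (Eu n) := (extChartAt (𝓡 n) p).target

/-- The standard frame of the coordinate space. -/
abbrev fr (n : ℕ) (i : Fin n) : Eu n := EuclideanSpace.single i (1 : ℝ)

/-- The differential of the parametrization at `y`. -/
def dpar (n : ℕ) {X : Type} [TopologicalSpace X] [ChartedSpace (EuclideanSpace ℝ (Fin n)) X]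
    (p : X) (y : Eu n) : Eu n →L[ℝ] Eu n :=
  mfderiv (𝓡 n) (𝓡 n) (extChartAt (𝓡 n) p).symm y

/-- The bilinear form `g_ρ` at `x` on the model space. -/
def bil (g : FormFamily n X) (ρ : ℝ) (x : X) : Eu n →L[ℝ] Eu n →L[ℝ] ℝ := g ρ x

lemma chartGram_apply (g : FormFamily n X) (p : X) (ρ : ℝ) (y : Eu n) (i j : Fin n) :
    chartGram g p ρ y i j = bil g ρ (par n p y) (dpar n p y (fr n i)) (dpar n p y (fr n j)) := rfl

lemma sum_fr (v : Eu n) : v = ∑ i, v i • fr n i := by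
  ext j
  simp [Finset.sum_apply, Pi.single_apply]

lemma isOpen_tgt (p : X) : IsOpen (tgt n p) := isOpen_extChartAt_target p

lemma isOpen_src (p : X) : IsOpen (src n p) := isOpen_extChartAt_source p

lemma continuousOn_par (p : X) : ContinuousOn (par n p) (tgt n p) := continuousOn_extChartAt_symm p

lemma continuousOn_crd (p : X) : ContinuousOn (crd n p) (src n p) := continuousOn_extChartAt p

lemma crd_mem (p : X) {x : X} (hx : x ∈ src n p) : crd n p x ∈ tgt n p :=
  (extChartAt (𝓡 n) p).map_source hx

lemma par_mem (p : X) {y : Eu n} (hy : y ∈ tgt n p) : par n p y ∈ src n p :=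
  (extChartAt (𝓡 n) p).map_target hy

lemma crd_par (p : X) {y : Eu n} (hy : y ∈ tgt n p) : crd n p (par n p y) = y :=
  (extChartAt (𝓡 n) p).right_inv hy

lemma par_crd (p : X) {x : X} (hx : x ∈ src n p) : par n p (crd n p x) = x :=
  (extChartAt (𝓡 n) p).left_inv hx

lemma mem_src_self (x : X) : x ∈ src n x := mem_extChartAt_source x

variable [IsManifold (𝓡 n) ∞ X]

lemma contMDiffAt_par (p : X) {y : Eu n} (hy : y ∈ tgt n p) :
    ContMDiffAt (𝓡 n) (𝓡 n) ∞ (par n p) y :=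
  (contMDiffOn_extChartAt_symm p).contMDiffAt ((isOpen_tgt p).mem_nhds hy)

lemma contMDiffAt_crd (p : X) {x : X} (hx : x ∈ src n p) :
    ContMDiffAt (𝓡 n) (𝓡 n) ∞ (crd n p) x :=
  contMDiffAt_extChartAt' (by simpa [src] using hx)

/-- The transition map between the preferred charts at `p` and `q`. -/
def trans (n : ℕ) {X : Type} [TopologicalSpace X] [ChartedSpace (EuclideanSpace ℝ (Fin n)) X]
    (p q : X) : Eu n → Eu n := fun y => crd n q (par n p y)

lemma contDiffAt_trans {p q : X} {y : Eu n} (hy : y ∈ tgt n p) (hq : par n p y ∈ src n q) :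
    ContDiffAt ℝ ∞ (trans n p q) y := by
  rw [← contMDiffAt_iff_contDiffAt]
  exact (contMDiffAt_crd q hq).comp y (contMDiffAt_par p hy)

omit [IsManifold (𝓡 n) ∞ X] in
lemma par_trans {p q : X} {y : Eu n} (hq : par n p y ∈ src n q) :
    par n q (trans n p q y) = par n p y := par_crd q hq

omit [IsManifold (𝓡 n) ∞ X] in
lemma trans_mem {p q : X} {y : Eu n} (hq : par n p y ∈ src n q) : trans n p q y ∈ tgt n q :=
  crd_mem q hq

lemma dpar_injective (p : X) {y : Eu n} (hy : y ∈ tgt n p) :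
    Function.Injective (dpar n p y) := by
  have h := isInvertible_mfderivWithin_extChartAt_symm (I := 𝓡 n) (x := p) hy
  rw [ModelWithCorners.range_eq_univ, mfderivWithin_univ] at h
  exact h.injective

omit [IsManifold (𝓡 n) ∞ X] in
lemma eventually_par_mem_src {p q : X} {y : Eu n} (hy : y ∈ tgt n p) (hq : par n p y ∈ src n q) :
    ∀ᶠ z in 𝓝 y, z ∈ tgt n p ∧ par n p z ∈ src n q :=
  ((isOpen_tgt p).eventually_mem hy).and
    (((continuousOn_par p).continuousAt ((isOpen_tgt p).mem_nhds hy)).eventually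
      ((isOpen_src q).mem_nhds hq))

lemma dpar_trans {p q : X} {y : Eu n} (hy : y ∈ tgt n p) (hq : par n p y ∈ src n q) (v : Eu n) :
    dpar n p y v = dpar n q (trans n p q y) (fderiv ℝ (trans n p q) y v) := by
  have h1 : par n p =ᶠ[𝓝 y] par n q ∘ trans n p q := by
    filter_upwards [eventually_par_mem_src hy hq] with z hz using (par_trans hz.2).symm
  have h2 : MDifferentiableAt (𝓡 n) (𝓡 n) (par n q) (trans n p q y) :=
    (contMDiffAt_par q (trans_mem hq)).mdifferentiableAt (by simp)
  have h3 : MDifferentiableAt (𝓡 n) (𝓡 n) (trans n p q) y :=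
    ((contDiffAt_trans hy hq).differentiableAt (by simp)).mdifferentiableAt
  have h4 := mfderiv_comp y h2 h3
  rw [← h1.mfderiv_eq, mfderiv_eq_fderiv] at h4
  exact congrArg (fun D : Eu n →L[ℝ] Eu n => D v) h4

/-- The Jacobian matrix of the transition map. -/
def jac (n : ℕ) {X : Type} [TopologicalSpace X] [ChartedSpace (EuclideanSpace ℝ (Fin n)) X]
    (p q : X) (y : Eu n) : Matrix (Fin n) (Fin n) ℝ :=
  Matrix.of fun k i => fderiv ℝ (trans n p q) y (fr n i) k

lemma chartGram_trans (g : FormFamily n X) (ρ : ℝ) {p q : X} {y : Eu n} (hy : y ∈ tgt n p)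
    (hq : par n p y ∈ src n q) :
    chartGram g p ρ y
      = (jac n p q y).transpose * chartGram g q ρ (trans n p q y) * jac n p q y := by
  ext i j
  have h : ∀ i, dpar n p y (fr n i)
      = ∑ k, jac n p q y k i • dpar n q (trans n p q y) (fr n k) := by
    intro i
    rw [dpar_trans hy hq, sum_fr (fderiv ℝ (trans n p q) y (fr n i)), map_sum]
    simp only [map_smul]
    rfl
  rw [chartGram_apply, h, h, Matrix.mul_apply]
  simp only [Matrix.mul_apply, Matrix.transpose_apply, chartGram_apply, par_trans hq, map_sum,
    map_smul, _root_.sum_apply, _root_.smul_apply, smul_eq_mul, Finset.sum_mul, Finset.mul_sum]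
  refine Finset.sum_congr rfl fun k _ => Finset.sum_congr rfl fun l _ => ?_
  ring

omit [IsManifold (𝓡 n) ∞ X] in
lemma fderiv_trans_det (p q : X) (y : Eu n) :
    (fderiv ℝ (trans n p q) y).det = (jac n p q y).det := by
  rw [ContinuousLinearMap.det, ← LinearMap.det_toMatrix (EuclideanSpace.basisFun (Fin n) ℝ).toBasis]
  congr 1

lemma sqrt_chartGram_det_trans (g : FormFamily n X) (ρ : ℝ) {p q : X} {y : Eu n}
    (hy : y ∈ tgt n p) (hq : par n p y ∈ src n q) :
    √|(chartGram g p ρ y).det|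
      = |(jac n p q y).det| * √|(chartGram g q ρ (trans n p q y)).det| := by
  rw [chartGram_trans g ρ hy hq, Matrix.det_mul, Matrix.det_mul, Matrix.det_transpose,
    show ∀ a b : ℝ, a * b * a = a ^ 2 * b by intros; ring, abs_mul, abs_of_nonneg (sq_nonneg _),
    Real.sqrt_mul (sq_nonneg _), Real.sqrt_sq_eq_abs]

namespace Ambient

variable (A : Ambient n X)

/-- The interval of admissible `ρ`. -/
abbrev J : Set ℝ := Set.Ioo (-A.ε) A.ε

omit [IsManifold (𝓡 n) ∞ X] in
lemma isOpen_J : IsOpen A.J := isOpen_Ioo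

omit [IsManifold (𝓡 n) ∞ X] in
lemma zero_mem_J : (0 : ℝ) ∈ A.J := ⟨neg_lt_zero.2 A.ε_pos, A.ε_pos⟩

lemma posDef {p : X} {y : Eu n} (hy : y ∈ tgt n p) {ρ : ℝ} (hρ : ρ ∈ A.J) :
    (chartGram A.g p ρ y).PosDef := by
  refine Matrix.PosDef.of_dotProduct_mulVec_pos ?_ ?_
  · ext i j
    simp only [Matrix.conjTranspose_apply, star_trivial]
    exact A.symm ρ hρ _ _ _
  · intro v hv
    have hv' : (WithLp.toLp 2 v : Eu n) ≠ 0 := by simpa using hv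
    have h1 : dpar n p y (WithLp.toLp 2 v) ≠ 0 := by
      rw [Ne, ← map_zero (dpar n p y)]
      exact (dpar_injective p hy).ne hv'
    have h2 : 0 < bil A.g ρ (par n p y) (dpar n p y (WithLp.toLp 2 v))
        (dpar n p y (WithLp.toLp 2 v)) := A.pos ρ hρ _ _ h1
    refine h2.trans_eq ?_
    rw [sum_fr (WithLp.toLp 2 v)]
    simp only [map_sum, map_smul, _root_.sum_apply, _root_.smul_apply, smul_eq_mul,
      dotProduct, Matrix.mulVec, chartGram_apply, Finset.mul_sum, star_trivial]
    rw [Finset.sum_comm]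
    refine Finset.sum_congr rfl fun i _ => Finset.sum_congr rfl fun j _ => ?_
    ring

lemma det_pos {p : X} {y : Eu n} (hy : y ∈ tgt n p) {ρ : ℝ} (hρ : ρ ∈ A.J) :
    0 < (chartGram A.g p ρ y).det := (A.posDef hy hρ).det_pos

lemma inv_symm {p : X} {y : Eu n} (hy : y ∈ tgt n p) {ρ : ℝ} (hρ : ρ ∈ A.J) (i j : Fin n) :
    (chartGram A.g p ρ y)⁻¹ i j = (chartGram A.g p ρ y)⁻¹ j i := by
  have h : (chartGram A.g p ρ y)⁻¹.transpose = (chartGram A.g p ρ y)⁻¹ := by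
    rw [Matrix.transpose_nonsing_inv]
    congr 1
    have := (A.posDef hy hρ).isHermitian
    rwa [Matrix.IsHermitian, Matrix.conjTranspose_eq_transpose_of_trivial] at this
  exact (congrFun (congrFun h i) j).symm

end Ambient

end Charts

/-! ### Smoothness of determinants and inverses of matrix-valued functions. -/

section SmoothMatrix

variable {V ι : Type} [NormedAddCommGroup V] [NormedSpace ℝ V] [Fintype ι] [DecidableEq ι]
  {s : Set V} {M : V → Matrix ι ι ℝ}

lemma contDiffOn_det (h : ∀ i j, ContDiffOn ℝ ∞ (fun z => M z i j) s) :
    ContDiffOn ℝ ∞ (fun z => (M z).det) s := by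
  simp only [Matrix.det_apply']
  exact ContDiffOn.sum fun σ _ => contDiffOn_const.mul (contDiffOn_prod fun i _ => h _ _)

lemma contDiffOn_inv (h : ∀ i j, ContDiffOn ℝ ∞ (fun z => M z i j) s)
    (h0 : ∀ z ∈ s, (M z).det ≠ 0) (i j : ι) : ContDiffOn ℝ ∞ (fun z => (M z)⁻¹ i j) s := by
  have h1 : ∀ z, (M z)⁻¹ i j = (M z).det⁻¹ * ((M z).updateRow j (Pi.single i 1)).det := by
    intro z
    rw [Matrix.inv_def, Ring.inverse_eq_inv', Matrix.smul_apply, Matrix.adjugate_apply, smul_eq_mul]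
  simp only [h1]
  refine ((contDiffOn_det h).inv h0).mul (contDiffOn_det fun k l => ?_)
  by_cases hk : k = j
  · subst hk
    simp only [Matrix.updateRow_self]
    exact contDiffOn_const
  · simp only [Matrix.updateRow_ne hk]
    exact h k l

end SmoothMatrix

/-! ### The conjugated Laplacian -/

section AmbientCoordinates

variable {n : ℕ}

lemma pderiv_amb {K : Eu n × ℝ → ℝ} {z : AmbCoord n} (hz : 0 < z.1)
    (hK : DifferentiableAt ℝ K z.2) (c : ℝ) :
    pderiv (ambFrame n) (.inl ()) (fun z => z.1 ^ c * K z.2) z = c * z.1 ^ (c - 1) * K z.2 ∧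
    (∀ i, pderiv (ambFrame n) (.inr (.inl i)) (fun z => z.1 ^ c * K z.2) z
      = z.1 ^ c * dx (fr n i) K z.2) ∧
    pderiv (ambFrame n) (.inr (.inr ())) (fun z => z.1 ^ c * K z.2) z
      = z.1 ^ c * dr K z.2 := by
  have h1 : HasFDerivAt (fun z : AmbCoord n => z.1 ^ c)
      ((c * z.1 ^ (c - 1)) • ContinuousLinearMap.fst ℝ ℝ (Eu n × ℝ)) z :=
    (Real.hasDerivAt_rpow_const (Or.inl hz.ne')).comp_hasFDerivAt z hasFDerivAt_fst
  have h2 : HasFDerivAt (fun z : AmbCoord n => K z.2)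
      ((fderiv ℝ K z.2).comp (ContinuousLinearMap.snd ℝ ℝ (Eu n × ℝ))) z :=
    hK.hasFDerivAt.comp z hasFDerivAt_snd
  have h3 := (h1.mul h2).fderiv
  refine ⟨?_, fun i => ?_, ?_⟩
  · unfold pderiv
    rw [show (fun z : AmbCoord n => z.1 ^ c * K z.2)
      = (fun z : AmbCoord n => z.1 ^ c) * fun z => K z.2 from rfl, h3]
    simp only [ambFrame, _root_.add_apply, _root_.smul_apply, ContinuousLinearMap.comp_apply,
      ContinuousLinearMap.coe_snd', ContinuousLinearMap.coe_fst', smul_eq_mul]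
    rw [show ((0 : Eu n), (0 : ℝ)) = 0 from rfl, map_zero]
    ring
  · unfold pderiv
    rw [show (fun z : AmbCoord n => z.1 ^ c * K z.2)
      = (fun z : AmbCoord n => z.1 ^ c) * fun z => K z.2 from rfl, h3, dx_eq _ hK]
    simp [ambFrame]
  · unfold pderiv
    rw [show (fun z : AmbCoord n => z.1 ^ c * K z.2)
      = (fun z : AmbCoord n => z.1 ^ c) * fun z => K z.2 from rfl, h3, dr_eq hK]
    simp [ambFrame]

end AmbientCoordinates

namespace Ambient

variable {n : ℕ} {X : Type} [TopologicalSpace X] [ChartedSpace (EuclideanSpace ℝ (Fin n)) X]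
  [IsManifold (𝓡 n) ∞ X] (A : Ambient n X)

/-- The Riemannian density of `g_ρ` in the chart at `p`. -/
def dens (p : X) (ρ : ℝ) (y : Eu n) : ℝ := √|(chartGram A.g p ρ y).det|

/-- The inverse Gram matrix of `g_ρ` in the chart at `p`. -/
def ginv (p : X) (ρ : ℝ) (y : Eu n) : Matrix (Fin n) (Fin n) ℝ := (chartGram A.g p ρ y)⁻¹

lemma dens_pos {p : X} {y : Eu n} (hy : y ∈ tgt n p) {ρ : ℝ} (hρ : ρ ∈ A.J) :
    0 < A.dens p ρ y := Real.sqrt_pos.2 (abs_pos.2 (A.det_pos hy hρ).ne')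

omit [IsManifold (𝓡 n) ∞ X] in
lemma isOpen_prod (p : X) : IsOpen (tgt n p ×ˢ A.J) := (isOpen_tgt p).prod A.isOpen_J

omit [IsManifold (𝓡 n) ∞ X] in
lemma det_contDiffOn (p : X) :
    ContDiffOn ℝ ∞ (fun q : Eu n × ℝ => (chartGram A.g p q.2 q.1).det) (tgt n p ×ˢ A.J) :=
  contDiffOn_det (A.smooth p)

lemma dens_contDiffOn (p : X) :
    ContDiffOn ℝ ∞ (fun q : Eu n × ℝ => A.dens p q.2 q.1) (tgt n p ×ˢ A.J) := by
  refine ((A.det_contDiffOn p).sqrt fun _ hq => (A.det_pos hq.1 hq.2).ne').congr fun q hq => ?_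
  rw [dens, abs_of_pos (A.det_pos hq.1 hq.2)]

lemma ginv_contDiffOn (p : X) (i j : Fin n) :
    ContDiffOn ℝ ∞ (fun q : Eu n × ℝ => A.ginv p q.2 q.1 i j) (tgt n p ×ˢ A.J) :=
  contDiffOn_inv (A.smooth p) (fun _ hq => (A.det_pos hq.1 hq.2).ne') i j

lemma dens_zero_contDiffOn (p : X) : ContDiffOn ℝ ∞ (A.dens p 0) (tgt n p) :=
  (A.dens_contDiffOn p).comp (f := fun y : Eu n => (y, (0 : ℝ)))
    (contDiffOn_id.prodMk contDiffOn_const) fun _ hy => ⟨hy, A.zero_mem_J⟩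

lemma ginv_slice_contDiffAt {p : X} {y : Eu n} (hy : y ∈ tgt n p) {ρ : ℝ} (hρ : ρ ∈ A.J)
    (i j : Fin n) : ContDiffAt ℝ ∞ (fun z => A.ginv p ρ z i j) y :=
  contDiffAt_slice_left (q := (y, ρ)) (contDiffAt_of_mem (A.isOpen_prod p)
    (A.ginv_contDiffOn p i j) ⟨hy, hρ⟩)

lemma dens_zero_contDiffAt {p : X} {y : Eu n} (hy : y ∈ tgt n p) :
    ContDiffAt ℝ ∞ (A.dens p 0) y :=
  (A.dens_zero_contDiffOn p).contDiffAt ((isOpen_tgt p).mem_nhds hy)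

/-! #### The function `w` -/

/-- The squared Jacobian of the transition map cancels in the quotient of determinants, so `w` can
be computed in any chart. -/
lemma w_par {p : X} {y : Eu n} (hy : y ∈ tgt n p) (ρ : ℝ) :
    A.w (par n p y) ρ
      = ((chartGram A.g p ρ y).det / (chartGram A.g p 0 y).det) ^ (1 / 4 : ℝ) := by
  have hq := mem_src_self (n := n) (par n p y)
  have h0 := A.det_pos hy A.zero_mem_J
  have ht : trans n p (par n p y) y = crd n (par n p y) (par n p y) := rfl
  rw [chartGram_trans A.g 0 hy hq, Matrix.det_mul, Matrix.det_mul, Matrix.det_transpose] at h0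
  rw [w, chartGram_trans A.g ρ hy hq, chartGram_trans A.g 0 hy hq, Matrix.det_mul, Matrix.det_mul,
    Matrix.det_mul, Matrix.det_mul, Matrix.det_transpose, ht]
  congr 1
  have h1 : (jac n p (par n p y) y).det ≠ 0 := fun h => by simp [h] at h0
  rw [mul_right_comm, mul_right_comm _ (chartGram A.g _ 0 _).det,
    mul_div_mul_left _ _ (mul_ne_zero h1 h1)]

lemma w_pos (x : X) {ρ : ℝ} (hρ : ρ ∈ A.J) : 0 < A.w x ρ :=
  Real.rpow_pos_of_pos (div_pos (A.det_pos (crd_mem x (mem_src_self x)) hρ)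
    (A.det_pos (crd_mem x (mem_src_self x)) A.zero_mem_J)) _

lemma w_zero (x : X) : A.w x 0 = 1 := by
  rw [w, div_self (A.det_pos (crd_mem x (mem_src_self x)) A.zero_mem_J).ne', Real.one_rpow]

lemma w_sq_mul_dens {p : X} {y : Eu n} (hy : y ∈ tgt n p) {ρ : ℝ} (hρ : ρ ∈ A.J) :
    A.w (par n p y) ρ ^ 2 * A.dens p 0 y = A.dens p ρ y := by
  have h0 := A.det_pos hy A.zero_mem_J
  have h1 := A.det_pos hy hρ
  rw [A.w_par hy, dens, dens, abs_of_pos h0, abs_of_pos h1, ← Real.rpow_natCast,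
    ← Real.rpow_mul (div_pos h1 h0).le, show (1 / 4 : ℝ) * ((2 : ℕ) : ℝ) = 1 / 2 by norm_num,
    ← Real.sqrt_eq_rpow, ← Real.sqrt_mul (div_pos h1 h0).le, div_mul_cancel₀ _ h0.ne']

/-- Smooth functions on `X × (-ε, ε)`. -/
def SmoothFam (v : X → ℝ → ℝ) : Prop :=
  ∀ p : X, ContDiffOn ℝ ∞ (fun q : Eu n × ℝ => v (par n p q.1) q.2) (tgt n p ×ˢ A.J)

lemma smoothFam_w : A.SmoothFam A.w := by
  intro p
  have h0 : ContDiffOn ℝ ∞ (fun q : Eu n × ℝ => (chartGram A.g p 0 q.1).det)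
      (tgt n p ×ˢ A.J) :=
    (A.det_contDiffOn p).comp (f := fun q : Eu n × ℝ => (q.1, (0 : ℝ)))
      (contDiffOn_fst.prodMk contDiffOn_const) fun q hq => ⟨hq.1, A.zero_mem_J⟩
  refine (((A.det_contDiffOn p).div h0 fun q hq => (A.det_pos hq.1 A.zero_mem_J).ne').rpow_const_of_ne
    (p := 1 / 4) fun q hq => ?_).congr fun q hq => A.w_par hq.1 q.2
  exact (div_pos (A.det_pos hq.1 hq.2) (A.det_pos hq.1 A.zero_mem_J)).ne'

omit [IsManifold (𝓡 n) ∞ X] in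
variable {A} in
lemma SmoothFam.mul {u v : X → ℝ → ℝ} (hu : A.SmoothFam u) (hv : A.SmoothFam v) :
    A.SmoothFam fun x ρ => u x ρ * v x ρ := fun p => (hu p).mul (hv p)

variable {A} in
lemma SmoothFam.w_inv_mul {v : X → ℝ → ℝ} (hv : A.SmoothFam v) :
    A.SmoothFam fun x ρ => (A.w x ρ)⁻¹ * v x ρ := fun p =>
  ((A.smoothFam_w p).inv fun _ hq => (A.w_pos _ hq.2).ne').mul (hv p)

omit [IsManifold (𝓡 n) ∞ X] in
variable {A} in
lemma SmoothFam.contDiffAt_right {v : X → ℝ → ℝ} (hv : A.SmoothFam v) (x : X) {ρ : ℝ}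
    (hρ : ρ ∈ A.J) : ContDiffAt ℝ ∞ (v x) ρ := by
  have := contDiffAt_slice (isOpen_tgt x) A.isOpen_J (hv x) (crd_mem x (mem_src_self x)) hρ
  simpa [par_crd x (mem_src_self x)] using this

omit [IsManifold (𝓡 n) ∞ X] in
variable {A} in
lemma SmoothFam.contDiffAt_left {v : X → ℝ → ℝ} (hv : A.SmoothFam v) {p : X} {y : Eu n}
    (hy : y ∈ tgt n p) {ρ : ℝ} (hρ : ρ ∈ A.J) :
    ContDiffAt ℝ ∞ (fun y => v (par n p y) ρ) y :=
  contDiffAt_slice_left (q := (y, ρ)) (contDiffAt_of_mem (A.isOpen_prod p) (hv p) ⟨hy, hρ⟩)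

/-! #### The ambient Laplacian on homogeneous functions -/

/-- The inverse metric has the entries `1/τ` between `τ` and `ρ`, `-2ρ/τ²` in `ρρ`, and `τ⁻² g_ρ⁻¹`
along `X`, while the volume density is `τ^(n+1)` times that of `g_ρ`. All components of the flux are
thus homogeneous in `τ`, and `∂_τ` acts by scalars. -/
lemma laplacian_homogeneous {h : X → ℝ → ℝ} (hh : A.SmoothFam h) {F : ℝ × X × ℝ → ℝ} (a : ℝ)
    (hF : ∀ τ x ρ, 0 < τ → ρ ∈ A.J → F (τ, x, ρ) = τ ^ a * h x ρ) (τ : ℝ) (x : X) (ρ : ℝ)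
    (hτ : 0 < τ) (hρ : ρ ∈ A.J) :
    A.laplacian F (τ, x, ρ) = τ ^ (a - 2) * ((n + a) * deriv (h x) ρ
      + divOp (fr n) (A.dens x ρ) (A.ginv x ρ) (fun y => h (par n x y) ρ) (crd n x x)
      + (A.dens x ρ (crd n x x))⁻¹ * deriv (fun r => A.dens x r (crd n x x)
        * (a * h x r - 2 * r * deriv (h x) r)) ρ) := by
  set y := crd n x x with hy0
  have hy : y ∈ tgt n x := crd_mem x (mem_src_self x)
  have hpar : par n x y = x := par_crd x (mem_src_self x)
  set W := tgt n x ×ˢ A.J with hW0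
  have hW : IsOpen W := A.isOpen_prod x
  set H : Eu n × ℝ → ℝ := fun q => h (par n x q.1) q.2 with hH0
  set Γ : Eu n × ℝ → ℝ := fun q => A.dens x q.2 q.1 with hΓ0
  have hH : ContDiffOn ℝ ∞ H W := hh x
  have hΓ : ContDiffOn ℝ ∞ Γ W := A.dens_contDiffOn x
  set f : AmbCoord n → ℝ := fun c => F (c.1, (extChartAt (𝓡 n) x).symm c.2.1, c.2.2) with hf0
  set Ω : Set (AmbCoord n) := {z | 0 < z.1 ∧ z.2 ∈ W} with hΩ0
  have hΩ : IsOpen Ω := (isOpen_lt continuous_const continuous_fst).inter (hW.preimage continuous_snd)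
  have hz : ((τ, y, ρ) : AmbCoord n) ∈ Ω := ⟨hτ, hy, hρ⟩
  have hfΩ : ∀ z ∈ Ω, f =ᶠ[𝓝 z] fun z => z.1 ^ a * H z.2 := by
    intro z hz
    filter_upwards [hΩ.mem_nhds hz] with c hc
    exact hF _ _ _ hc.1 hc.2.2
  have hd : ∀ {K : Eu n × ℝ → ℝ}, ContDiffOn ℝ ∞ K W → ∀ q ∈ W, DifferentiableAt ℝ K q :=
    fun hK q hq => (contDiffAt_of_mem hW hK hq).differentiableAt (by simp)
  have hdf : ∀ z ∈ Ω, pderiv (ambFrame n) (.inl ()) f z = a * z.1 ^ (a - 1) * H z.2 ∧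
      (∀ i, pderiv (ambFrame n) (.inr (.inl i)) f z = z.1 ^ a * dx (fr n i) H z.2) ∧
      pderiv (ambFrame n) (.inr (.inr ())) f z = z.1 ^ a * dr H z.2 := by
    intro z hz
    have := pderiv_amb hz.1 (hd hH z.2 hz.2) a
    refine ⟨?_, fun i => ?_, ?_⟩
    · rw [pderiv_congr (hfΩ z hz), this.1]
    · rw [pderiv_congr (hfΩ z hz), this.2.1]
    · rw [pderiv_congr (hfΩ z hz), this.2.2]
  set Kt : Eu n × ℝ → ℝ := fun q => Γ q * dr H q with hKt
  set Kx : Fin n → Eu n × ℝ → ℝ := fun i q =>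
    Γ q * ∑ j, A.ginv x q.2 q.1 i j * dx (fr n j) H q with hKx
  set Kr : Eu n × ℝ → ℝ := fun q => Γ q * (a * H q - 2 * q.2 * dr H q) with hKr
  have hKt' : ContDiffOn ℝ ∞ Kt W := hΓ.mul (dr_contDiffOn hW hH)
  have hKx' : ∀ i, ContDiffOn ℝ ∞ (Kx i) W := fun i => hΓ.mul (ContDiffOn.sum fun j _ =>
    (A.ginv_contDiffOn x i j).mul (dx_contDiffOn hW hH _))
  have hKr' : ContDiffOn ℝ ∞ Kr W := hΓ.mul ((contDiffOn_const.mul hH).sub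
    ((contDiffOn_const.mul contDiffOn_snd).mul (dr_contDiffOn hW hH)))
  have hflux : ∀ z ∈ Ω, ∀ I : AmbIdx n, √|(ambGram A.g x z).det| *
      ∑ J, (ambGram A.g x z)⁻¹ I J * pderiv (ambFrame n) J f z
      = match I with
        | .inl _ => z.1 ^ ((n : ℝ) + a) * Kt z.2
        | .inr (.inl i) => z.1 ^ ((n : ℝ) + a - 1) * Kx i z.2
        | .inr (.inr _) => z.1 ^ ((n : ℝ) + a - 1) * Kr z.2 := by
    intro z hz I
    obtain ⟨d1, d2, d3⟩ := hdf z hz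
    have hz1 : 0 < z.1 := hz.1
    have e1 : z.1 ^ ((n : ℝ) + a) = z.1 ^ (n + 1) * z.1⁻¹ * z.1 ^ a := by
      rw [Real.rpow_add hz1, Real.rpow_natCast, pow_succ]
      field_simp
    have e2 : z.1 ^ ((n : ℝ) + a - 1) = z.1 ^ (n + 1) * z.1⁻¹ ^ 2 * z.1 ^ a := by
      rw [Real.rpow_sub hz1, e1, Real.rpow_one]
      field_simp
    have e3 : z.1 ^ (a - 1) = z.1⁻¹ * z.1 ^ a := by
      rw [Real.rpow_sub hz1, Real.rpow_one]
      field_simp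
    rw [sqrt_ambGram_det _ _ _ hz1, ambGram_inv _ _ _ hz1.ne' (A.det_pos hz.2.1 hz.2.2).ne',
      Fintype.sum_sum_type, Fintype.sum_sum_type]
    rcases I with _ | i | _
    · simp only [ambInv, Matrix.of_apply, Finset.univ_unique, Finset.sum_singleton, zero_mul,
        Finset.sum_const_zero, zero_add, PUnit.default_eq_unit, d3, e1, hKt, hΓ0, dens]
      ring
    · simp only [ambInv, Matrix.of_apply, Finset.univ_unique, Finset.sum_singleton, zero_mul,
        zero_add, add_zero, PUnit.default_eq_unit, d2, e2, hKx, hΓ0, dens, Finset.mul_sum, ginv]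
      refine Finset.sum_congr rfl fun j _ => ?_
      ring
    · simp only [ambInv, Matrix.of_apply, Finset.univ_unique, Finset.sum_singleton, zero_mul,
        Finset.sum_const_zero, zero_add, PUnit.default_eq_unit, d3, d1, e2, e3, hKr, hΓ0, dens]
      ring
  have hq : ((y, ρ) : Eu n × ℝ) ∈ W := ⟨hy, hρ⟩
  have hpd : ∀ I : AmbIdx n, pderiv (ambFrame n) I (fun z => √|(ambGram A.g x z).det| *
      ∑ J, (ambGram A.g x z)⁻¹ I J * pderiv (ambFrame n) J f z) (τ, y, ρ)
      = τ ^ ((n : ℝ) + a - 1) * match I with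
        | .inl _ => ((n : ℝ) + a) * Kt (y, ρ)
        | .inr (.inl i) => dx (fr n i) (Kx i) (y, ρ)
        | .inr (.inr _) => dr Kr (y, ρ) := by
    intro I
    have hev : (fun z => √|(ambGram A.g x z).det| *
        ∑ J, (ambGram A.g x z)⁻¹ I J * pderiv (ambFrame n) J f z) =ᶠ[𝓝 (τ, y, ρ)] fun z =>
        match I with
        | .inl _ => z.1 ^ ((n : ℝ) + a) * Kt z.2
        | .inr (.inl i) => z.1 ^ ((n : ℝ) + a - 1) * Kx i z.2
        | .inr (.inr _) => z.1 ^ ((n : ℝ) + a - 1) * Kr z.2 := by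
      filter_upwards [hΩ.mem_nhds hz] with z hz using hflux z hz I
    rw [pderiv_congr hev]
    rcases I with _ | i | _
    · rw [(pderiv_amb (z := (τ, y, ρ)) hτ (hd hKt' _ hq) _).1]
      ring
    · rw [(pderiv_amb (z := (τ, y, ρ)) hτ (hd (hKx' i) _ hq) _).2.1]
    · rw [(pderiv_amb (z := (τ, y, ρ)) hτ (hd hKr' _ hq) _).2.2]
  have hlap : A.laplacian F (τ, x, ρ) = (√|(ambGram A.g x (τ, y, ρ)).det|)⁻¹ *
      ∑ I, pderiv (ambFrame n) I (fun z => √|(ambGram A.g x z).det| *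
      ∑ J, (ambGram A.g x z)⁻¹ I J * pderiv (ambFrame n) J f z) (τ, y, ρ) := rfl
  have hdr : dr H (y, ρ) = deriv (h x) ρ := by
    simp only [dr, hH0, hpar]
  have hdr2 : dr Kr (y, ρ) = deriv (fun r => A.dens x r y * (a * h x r - 2 * r * deriv (h x) r)) ρ := by
    simp only [dr, hH0, hpar, hKr, hΓ0]
  have hdiv : divOp (fr n) (A.dens x ρ) (A.ginv x ρ) (fun y => h (par n x y) ρ) y
      = (Γ (y, ρ))⁻¹ * ∑ i, dx (fr n i) (Kx i) (y, ρ) := rfl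
  have hΓne : Γ (y, ρ) ≠ 0 := (A.dens_pos hy hρ).ne'
  have hΓ1 : A.dens x ρ y = Γ (y, ρ) := rfl
  have e4 : τ ^ ((n : ℝ) + a - 1) = τ ^ (n + 1) * τ ^ (a - 2) := by
    rw [← Real.rpow_natCast, ← Real.rpow_add hτ]
    congr 1
    push_cast
    ring
  have hsq : √|(ambGram A.g x (τ, y, ρ)).det| = τ ^ (n + 1) * Γ (y, ρ) :=
    sqrt_ambGram_det _ _ _ hτ
  have hτn : τ ^ (n + 1) ≠ 0 := (pow_pos hτ _).ne'
  rw [hlap, Finset.sum_congr rfl fun I _ => hpd I, ← Finset.mul_sum, Fintype.sum_sum_type,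
    Fintype.sum_sum_type, hsq, hdiv, ← hdr2, hΓ1, ← hdr, e4]
  simp only [Finset.univ_unique, Finset.sum_singleton, hKt]
  field_simp
  ring

end Ambient

/-- The radial analogue of `divOp_conj`: in the flux, `w² ∂(w⁻¹ v) = w v' - w' v`, so the products
`w' v'` cancel and only a potential remembers `w`. -/
lemma conj_radial {w v : ℝ → ℝ} {ρ : ℝ} (hw : ContDiffAt ℝ ∞ w ρ) (hv : ContDiffAt ℝ ∞ v ρ)
    (h0 : w ρ ≠ 0) {d : ℝ} (hd : d ≠ 0) (m a : ℝ) :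
    w ρ * ((m + a) * deriv (fun r => (w r)⁻¹ * v r) ρ + (w ρ ^ 2 * d)⁻¹ *
      deriv (fun r => w r ^ 2 * d * (a * ((w r)⁻¹ * v r)
        - 2 * r * deriv (fun r => (w r)⁻¹ * v r) r)) ρ)
      = -2 * ρ * iteratedDeriv 2 v ρ + (m + 2 * a - 2) * deriv v ρ
        + (2 * ρ * iteratedDeriv 2 w ρ / w ρ - (m - 2) * deriv w ρ / w ρ) * v ρ := by
  have hd1 : ∀ {f : ℝ → ℝ}, ContDiffAt ℝ ∞ f ρ → ∀ᶠ r in 𝓝 ρ, DifferentiableAt ℝ f r :=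
    fun hf => eventually_differentiableAt hf
  have hd2 : ∀ {f : ℝ → ℝ}, ContDiffAt ℝ ∞ f ρ → HasDerivAt (deriv f) (iteratedDeriv 2 f ρ) ρ := by
    intro f hf
    have h : ContDiffAt ℝ ∞ (deriv f) ρ := hf.derivWithin (m := ∞) (by simp) |>.congr_of_eventuallyEq
      (by simp)
    rw [iteratedDeriv_succ, iteratedDeriv_one]
    exact (h.differentiableAt (by simp)).hasDerivAt
  have hh : ∀ᶠ r in 𝓝 ρ, w r ≠ 0 ∧ deriv (fun r => (w r)⁻¹ * v r) r
      = (w r)⁻¹ * deriv v r - deriv w r * v r * (w r ^ 2)⁻¹ := by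
    filter_upwards [hd1 hw, hd1 hv, hw.continuousAt.eventually_ne h0] with r h1 h2 h3
    refine ⟨h3, ((h1.hasDerivAt.inv h3).mul h2.hasDerivAt).deriv.trans ?_⟩
    simp only [Pi.inv_apply]
    field_simp
    ring
  have hf : (fun r => w r ^ 2 * d * (a * ((w r)⁻¹ * v r)
        - 2 * r * deriv (fun r => (w r)⁻¹ * v r) r)) =ᶠ[𝓝 ρ]
      fun r => d * (a * (w r * v r) - 2 * r * (w r * deriv v r - deriv w r * v r)) := by
    filter_upwards [hh] with r hr
    rw [hr.2]
    have := hr.1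
    field_simp
  have w1 := (hw.differentiableAt (by simp)).hasDerivAt
  have v1 := (hv.differentiableAt (by simp)).hasDerivAt
  have key : HasDerivAt (fun r => d * (a * (w r * v r) - 2 * r * (w r * deriv v r - deriv w r * v r)))
      _ ρ := ((((w1.mul v1).const_mul a).sub (((hasDerivAt_id ρ).const_mul 2).mul
        ((w1.mul (hd2 hv)).sub ((hd2 hw).mul v1)))).const_mul d)
  rw [hf.deriv_eq, key.deriv, hh.self_of_nhds.2]
  simp only [id, Pi.sub_apply, Pi.mul_apply]
  field_simp
  ring

namespace Ambient

variable {n : ℕ} {X : Type} [TopologicalSpace X] [ChartedSpace (EuclideanSpace ℝ (Fin n)) X]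

/-- Smooth functions on `X`, tested in the preferred charts. -/
def _root_.AmbientGJMS.SmoothFn (n : ℕ) {X : Type} [TopologicalSpace X]
    [ChartedSpace (EuclideanSpace ℝ (Fin n)) X] (u : X → ℝ) : Prop :=
  ∀ p : X, ContDiffOn ℝ ∞ (fun y => u (par n p y)) (tgt n p)

variable (A : Ambient n X)

variable {A} in
lemma SmoothFam.slice {v : X → ℝ → ℝ} (hv : A.SmoothFam v) {ρ : ℝ} (hρ : ρ ∈ A.J) :
    SmoothFn n fun x => v x ρ := fun p => (hv p).comp (f := fun y : Eu n => (y, ρ))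
  (contDiffOn_id.prodMk contDiffOn_const) fun _ hy => ⟨hy, hρ⟩

lemma smoothFam_const {u : X → ℝ} (hu : SmoothFn n u) : A.SmoothFam fun x _ => u x :=
  fun p => (hu p).comp contDiffOn_fst fun _ hq => hq.1

/-- The potential of the operator `ℳ(ρ)`. -/
def pot (x : X) (ρ : ℝ) : ℝ :=
  -((A.w x ρ)⁻¹ * divOp (fr n) (A.dens x 0) (A.ginv x ρ) (fun y => A.w (par n x y) ρ) (crd n x x))
    + 2 * ρ * iteratedDeriv 2 (A.w x) ρ / A.w x ρ - (n - 2) * deriv (A.w x) ρ / A.w x ρ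

variable [IsManifold (𝓡 n) ∞ X]

/-- After conjugation the tangential part is in divergence form for the density of `g_0` at every
`ρ`. This is why all Taylor coefficients of `ℳ(ρ)` are symmetric for one and the same measure. -/
lemma w_mul_laplacian {v : X → ℝ → ℝ} (hv : A.SmoothFam v) {F : ℝ × X × ℝ → ℝ} (a : ℝ)
    (hF : ∀ τ x ρ, 0 < τ → ρ ∈ A.J → F (τ, x, ρ) = τ ^ a * ((A.w x ρ)⁻¹ * v x ρ)) (τ : ℝ) (x : X)
    (ρ : ℝ) (hτ : 0 < τ) (hρ : ρ ∈ A.J) :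
    A.w x ρ * A.laplacian F (τ, x, ρ) = τ ^ (a - 2) * (-2 * ρ * iteratedDeriv 2 (v x) ρ
      + (n + 2 * a - 2) * deriv (v x) ρ
      + (divOp (fr n) (A.dens x 0) (A.ginv x ρ) (fun y => v (par n x y) ρ) (crd n x x)
        + A.pot x ρ * v x ρ)) := by
  have hy : crd n x x ∈ tgt n x := crd_mem x (mem_src_self x)
  have hpar : par n x (crd n x x) = x := par_crd x (mem_src_self x)
  have hw0 := (A.w_pos x hρ).ne'
  have hdens : ∀ r ∈ A.J, A.dens x r (crd n x x) = A.w x r ^ 2 * A.dens x 0 (crd n x x) := by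
    intro r hr
    rw [← A.w_sq_mul_dens hy hr, hpar]
  have h1 : divOp (fr n) (A.dens x ρ) (A.ginv x ρ)
      (fun y => (A.w (par n x y) ρ)⁻¹ * v (par n x y) ρ) (crd n x x)
      = divOp (fr n) (fun y => A.w (par n x y) ρ ^ 2 * A.dens x 0 y) (A.ginv x ρ)
      (fun y => (A.w (par n x y) ρ)⁻¹ * v (par n x y) ρ) (crd n x x) := by
    refine divOp_congr ?_ ?_ ?_
    · filter_upwards [(isOpen_tgt x).mem_nhds hy] with z hz using (A.w_sq_mul_dens hz hρ).symm
    · rfl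
    · rfl
  have h2 := divOp_conj (b := fr n) (w := fun y => A.w (par n x y) ρ)
    (v := fun y => v (par n x y) ρ) (A.dens_zero_contDiffAt hy)
    (A.ginv_slice_contDiffAt hy hρ) (A.inv_symm hy hρ) (A.smoothFam_w.contDiffAt_left hy hρ)
    (hv.contDiffAt_left hy hρ) (by simpa only [hpar] using hw0)
  simp only [hpar] at h2
  have h3 : (fun r => A.dens x r (crd n x x) * (a * ((A.w x r)⁻¹ * v x r)
      - 2 * r * deriv (fun r => (A.w x r)⁻¹ * v x r) r)) =ᶠ[𝓝 ρ]
      fun r => A.w x r ^ 2 * A.dens x 0 (crd n x x) * (a * ((A.w x r)⁻¹ * v x r)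
        - 2 * r * deriv (fun r => (A.w x r)⁻¹ * v x r) r) := by
    filter_upwards [A.isOpen_J.mem_nhds hρ] with r hr
    rw [hdens r hr]
  have h4 := conj_radial (A.smoothFam_w.contDiffAt_right x hρ) (hv.contDiffAt_right x hρ) hw0
    (A.dens_pos hy A.zero_mem_J).ne' n a
  rw [A.laplacian_homogeneous hv.w_inv_mul a hF τ x ρ hτ hρ, h1, h3.deriv_eq, hdens ρ hρ, pot]
  linear_combination τ ^ (a - 2) * h2 + τ ^ (a - 2) * h4

lemma genM_eq {u : X → ℝ} (hu : SmoothFn n u) (x : X) {ρ : ℝ} (hρ : ρ ∈ A.J) :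
    A.genM ρ u x = divOp (fr n) (A.dens x 0) (A.ginv x ρ) (fun y => u (par n x y)) (crd n x x)
      + A.pot x ρ * u x := by
  have := A.w_mul_laplacian (A.smoothFam_const hu)
    (F := fun z' => (A.w z'.2.1 z'.2.2)⁻¹ * u z'.2.1) 0 (by simp) 1 x ρ one_pos hρ
  simpa [genM, laplacianW, iteratedDeriv_const] using this

lemma laplacian_eq_R {v : X → ℝ → ℝ} (hv : A.SmoothFam v) {F : ℝ × X × ℝ → ℝ} (a : ℝ)
    (hF : ∀ τ x ρ, 0 < τ → ρ ∈ A.J → F (τ, x, ρ) = τ ^ a * ((A.w x ρ)⁻¹ * v x ρ)) (τ : ℝ) (x : X)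
    (ρ : ℝ) (hτ : 0 < τ) (hρ : ρ ∈ A.J) :
    A.laplacian F (τ, x, ρ)
      = τ ^ (a - 2) * ((A.w x ρ)⁻¹ * A.R (a + n / 2 - 1) v x ρ) := by
  have h := A.w_mul_laplacian hv a hF τ x ρ hτ hρ
  rw [R, A.genM_eq (hv.slice hρ) x hρ]
  rw [eq_comm, ← mul_assoc, mul_comm _ (A.w x ρ)⁻¹, mul_assoc, inv_mul_eq_iff_eq_mul₀
    (A.w_pos x hρ).ne', h]
  ring

end Ambient

/-! ### Bivector fields and their divergence-form operators -/

section WeakForm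

variable {n : ℕ} {U : Set (Eu n)}

lemma continuous_mul_of_tsupport_subset {Y : Type*} [TopologicalSpace Y] {U : Set Y}
    (hU : IsOpen U) {θ G : Y → ℝ}
    (hθ : Continuous θ) (hs : tsupport θ ⊆ U) (hG : ContinuousOn G U) :
    Continuous fun y => θ y * G y := by
  refine continuous_of_tsupport fun y hy => ?_
  exact hθ.continuousAt.mul (hG.continuousAt (hU.mem_nhds (hs (tsupport_mul_subset_left hy))))

lemma integrable_mul_of_tsupport_subset (hU : IsOpen U) {θ G : Eu n → ℝ} (hθ : Continuous θ)
    (hc : HasCompactSupport θ) (hs : tsupport θ ⊆ U) (hG : ContinuousOn G U) :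
    Integrable fun y => θ y * G y :=
  (continuous_mul_of_tsupport_subset hU hθ hs hG).integrable_of_hasCompactSupport hc.mul_right

lemma tsupport_pderiv_subset {θ : Eu n → ℝ} (i : Fin n) :
    tsupport (pderiv (fr n) i θ) ⊆ tsupport θ :=
  tsupport_fderiv_apply_subset ℝ (fr n i)

lemma continuous_pderiv {θ : Eu n → ℝ} (hθ : ContDiff ℝ ∞ θ) (i : Fin n) :
    Continuous (pderiv (fr n) i θ) :=
  (hθ.continuous_fderiv (by simp)).clm_apply continuous_const

lemma integral_mul_pderiv (hU : IsOpen U) {θ F : Eu n → ℝ} (hθ : ContDiff ℝ ∞ θ)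
    (hc : HasCompactSupport θ) (hs : tsupport θ ⊆ U) (hF : ContDiffOn ℝ ∞ F U) (i : Fin n) :
    ∫ y, θ y * pderiv (fr n) i F y = -∫ y, pderiv (fr n) i θ y * F y := by
  refine integral_bilinear_hasLineDerivAt_right_eq_neg_left_of_integrable
    (B := ContinuousLinearMap.mul ℝ ℝ) (v := fr n i) ?_ ?_ ?_ ?_ ?_
  · exact integrable_mul_of_tsupport_subset hU (continuous_pderiv hθ i)
      (hc.mono' ((subset_tsupport _).trans (tsupport_pderiv_subset i)))
      ((tsupport_pderiv_subset i).trans hs) hF.continuousOn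
  · exact integrable_mul_of_tsupport_subset hU hθ.continuous hc hs
      (contDiffOn_pderiv hU hF i).continuousOn
  · exact integrable_mul_of_tsupport_subset hU hθ.continuous hc hs hF.continuousOn
  · exact fun y _ => ((hθ.differentiable (by simp)) y).hasFDerivAt.hasLineDerivAt _
  · intro y hy
    exact ((hF.contDiffAt (hU.mem_nhds (hs hy))).differentiableAt
      (by simp)).hasFDerivAt.hasLineDerivAt _

/-- Integration by parts for an operator in divergence form. -/
lemma integral_mul_divOp (hU : IsOpen U) {μ h θ : Eu n → ℝ}
    {q : Eu n → Matrix (Fin n) (Fin n) ℝ} (hμ : ContDiffOn ℝ ∞ μ U) (hμ0 : ∀ y ∈ U, μ y ≠ 0)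
    (hq : ∀ i j, ContDiffOn ℝ ∞ (fun y => q y i j) U) (hh : ContDiffOn ℝ ∞ h U)
    (hθ : ContDiff ℝ ∞ θ) (hc : HasCompactSupport θ) (hs : tsupport θ ⊆ U) :
    ∫ y, θ y * (μ y * divOp (fr n) μ q h y)
      = -∫ y, μ y * ∑ i, ∑ j, q y i j * pderiv (fr n) i θ y * pderiv (fr n) j h y := by
  set F : Fin n → Eu n → ℝ := fun i y => μ y * ∑ j, q y i j * pderiv (fr n) j h y with hF0
  have hF : ∀ i, ContDiffOn ℝ ∞ (F i) U := fun i =>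
    hμ.mul (ContDiffOn.sum fun j _ => (hq i j).mul (contDiffOn_pderiv hU hh j))
  have h1 : (fun y => θ y * (μ y * divOp (fr n) μ q h y))
      = fun y => ∑ i, θ y * pderiv (fr n) i (F i) y := by
    funext y
    by_cases hy : y ∈ U
    · rw [divOp, mul_inv_cancel_left₀ (hμ0 y hy), Finset.mul_sum]
    · have : θ y = 0 := image_eq_zero_of_notMem_tsupport fun h => hy (hs h)
      simp [this]
  have h2 : (fun y => μ y * ∑ i, ∑ j, q y i j * pderiv (fr n) i θ y * pderiv (fr n) j h y)
      = fun y => ∑ i, pderiv (fr n) i θ y * F i y := by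
    funext y
    simp only [hF0, Finset.mul_sum]
    refine Finset.sum_congr rfl fun i _ => Finset.sum_congr rfl fun j _ => ?_
    ring
  rw [h1, h2, integral_finsetSum _ fun i _ => ?_, integral_finsetSum _ fun i _ => ?_,
    ← Finset.sum_neg_distrib]
  · exact Finset.sum_congr rfl fun i _ => integral_mul_pderiv hU hθ hc hs (hF i) i
  · exact integrable_mul_of_tsupport_subset hU (continuous_pderiv hθ i)
      (hc.mono' ((subset_tsupport _).trans (tsupport_pderiv_subset i)))
      ((tsupport_pderiv_subset i).trans hs) (hF i).continuousOn
  · exact integrable_mul_of_tsupport_subset hU hθ.continuous hc hs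
      (contDiffOn_pderiv hU (hF i) i).continuousOn

end WeakForm

/-! ### Transition maps and the coordinate invariance of divergence-form operators. -/

section Transition

variable {n : ℕ} {X : Type} [TopologicalSpace X] [ChartedSpace (EuclideanSpace ℝ (Fin n)) X]

/-- The part of the chart image at `p` that lies over the chart domain at `p'`. -/
def overlap (n : ℕ) {X : Type} [TopologicalSpace X] [ChartedSpace (EuclideanSpace ℝ (Fin n)) X]
    (p p' : X) : Set (Eu n) := {y | y ∈ tgt n p ∧ par n p y ∈ src n p'}

lemma isOpen_overlap (p p' : X) : IsOpen (overlap n p p') :=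
  (continuousOn_par p).isOpen_inter_preimage (isOpen_tgt p) (isOpen_src p')

lemma trans_mem_overlap {p p' : X} {y : Eu n} (hy : y ∈ overlap n p p') :
    trans n p p' y ∈ overlap n p' p :=
  ⟨trans_mem hy.2, by rw [par_trans hy.2]; exact par_mem p hy.1⟩

lemma trans_trans {p p' : X} {y : Eu n} (hy : y ∈ overlap n p p') :
    trans n p' p (trans n p p' y) = y := by
  rw [trans, par_trans hy.2, crd_par p hy.1]

lemma injOn_trans (p p' : X) : Set.InjOn (trans n p p') (overlap n p p') := fun y hy z hz h => by
  rw [← trans_trans hy, h, trans_trans hz]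

lemma image_trans (p p' : X) : trans n p p' '' overlap n p p' = overlap n p' p := by
  ext z
  constructor
  · rintro ⟨y, hy, rfl⟩
    exact trans_mem_overlap hy
  · exact fun hz => ⟨trans n p' p z, trans_mem_overlap hz, trans_trans hz⟩

variable [IsManifold (𝓡 n) ∞ X]

lemma contDiffOn_trans (p p' : X) : ContDiffOn ℝ ∞ (trans n p p') (overlap n p p') :=
  fun _ hy => (contDiffAt_trans hy.1 hy.2).contDiffWithinAt

lemma pderiv_comp_trans {p p' : X} {y : Eu n} (hy : y ∈ overlap n p p') {a a' : Eu n → ℝ}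
    (h : a =ᶠ[𝓝 y] fun z => a' (trans n p p' z)) (ha' : DifferentiableAt ℝ a' (trans n p p' y))
    (i : Fin n) :
    pderiv (fr n) i a y = ∑ k, jac n p p' y k i * pderiv (fr n) k a' (trans n p p' y) := by
  rw [pderiv, h.fderiv_eq]
  have := fderiv_comp y ha' ((contDiffAt_trans hy.1 hy.2).differentiableAt (by simp))
  rw [show (fun z => a' (trans n p p' z)) = a' ∘ trans n p p' from rfl, this,
    ContinuousLinearMap.comp_apply, sum_fr (fderiv ℝ (trans n p p') y (fr n i)), map_sum]
  simp only [map_smul, smul_eq_mul]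
  rfl

lemma setIntegral_overlap {p p' : X} (f : Eu n → ℝ) :
    ∫ z in overlap n p' p, f z
      = ∫ y in overlap n p p', |(jac n p p' y).det| * f (trans n p p' y) := by
  rw [← image_trans p p', integral_image_eq_integral_abs_det_fderiv_smul volume
    (isOpen_overlap p p').measurableSet (fun y hy => (((contDiffAt_trans hy.1
      hy.2).differentiableAt (by simp)).hasFDerivAt).hasFDerivWithinAt) (injOn_trans p p')]
  simp only [fderiv_trans_det, smul_eq_mul]

lemma integral_eq_of_overlap {p p' : X} {f f' : Eu n → ℝ} (h : ∀ z ∉ overlap n p p', f z = 0)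
    (h' : ∀ z ∉ overlap n p' p, f' z = 0)
    (ht : ∀ z ∈ overlap n p p', f z = |(jac n p p' z).det| * f' (trans n p p' z)) :
    ∫ z, f z = ∫ z, f' z := by
  have h1 := setIntegral_eq_integral_of_forall_compl_eq_zero (μ := volume) h
  have h2 := setIntegral_eq_integral_of_forall_compl_eq_zero (μ := volume) h'
  rw [← h1, ← h2, setIntegral_overlap (p := p) (p' := p')]
  exact setIntegral_congr_fun (isOpen_overlap p p').measurableSet ht

lemma lintegral_overlap {p p' : X} {s : Set (Eu n)} (hs : MeasurableSet s)
    (hso : s ⊆ overlap n p p') (f : Eu n → ENNReal) :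
    ∫⁻ z in trans n p p' '' s, f z
      = ∫⁻ y in s, ENNReal.ofReal |(jac n p p' y).det| * f (trans n p p' y) := by
  rw [lintegral_image_eq_lintegral_abs_det_fderiv_mul volume
    hs (fun y hy => (((contDiffAt_trans (hso hy).1
      (hso hy).2).differentiableAt (by simp)).hasFDerivAt).hasFDerivWithinAt)
      ((injOn_trans p p').mono hso)]
  simp only [fderiv_trans_det]

/-- A symmetric bivector field, given by its components in the preferred charts. -/
structure Bivector (n : ℕ) (X : Type) [TopologicalSpace X]
    [ChartedSpace (EuclideanSpace ℝ (Fin n)) X] where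
  q : X → Eu n → Matrix (Fin n) (Fin n) ℝ
  smooth : ∀ p i j, ContDiffOn ℝ ∞ (fun y => q p y i j) (tgt n p)
  symm : ∀ p, ∀ y ∈ tgt n p, ∀ i j, q p y i j = q p y j i
  trans : ∀ p p', ∀ y ∈ overlap n p p', q p' (trans n p p' y)
    = jac n p p' y * q p y * (jac n p p' y).transpose

omit [IsManifold (𝓡 n) ∞ X] in
lemma Bivector.sum_trans (B : Bivector n X) {p p' : X} {y : Eu n} (hy : y ∈ overlap n p p')
    (a a' c c' : Fin n → ℝ) (ha : ∀ i, a i = ∑ k, jac n p p' y k i * a' k)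
    (hc : ∀ i, c i = ∑ k, jac n p p' y k i * c' k) :
    ∑ i, ∑ j, B.q p y i j * a i * c j
      = ∑ i, ∑ j, B.q p' (AmbientGJMS.trans n p p' y) i j * a' i * c' j := by
  have h1 : ∀ (Q : Matrix (Fin n) (Fin n) ℝ) (a c : Fin n → ℝ),
      ∑ i, ∑ j, Q i j * a i * c j = dotProduct a (Q.mulVec c) := by
    intro Q a c
    simp only [dotProduct, Matrix.mulVec, Finset.mul_sum]
    refine Finset.sum_congr rfl fun i _ => Finset.sum_congr rfl fun j _ => ?_
    ring
  have h2 : ∀ a a' : Fin n → ℝ, (∀ i, a i = ∑ k, jac n p p' y k i * a' k) →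
      a = (jac n p p' y).transpose.mulVec a' := fun a a' h => by
    funext i
    simp [h, Matrix.mulVec, dotProduct]
  rw [h1, h1, B.trans p p' y hy, h2 a a' ha, h2 c c' hc, ← Matrix.mulVec_mulVec,
    ← Matrix.mulVec_mulVec, Matrix.mulVec_transpose, ← Matrix.dotProduct_mulVec]

/-! #### Invariance of the divergence form -/

/-- A density on `X`, given by its components in the preferred charts. -/
structure Density (n : ℕ) (X : Type) [TopologicalSpace X]
    [ChartedSpace (EuclideanSpace ℝ (Fin n)) X] where
  μ : X → Eu n → ℝ
  smooth : ∀ p, ContDiffOn ℝ ∞ (μ p) (tgt n p)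
  pos : ∀ p, ∀ y ∈ tgt n p, 0 < μ p y
  trans : ∀ p p', ∀ y ∈ overlap n p p', μ p y
    = |(jac n p p' y).det| * μ p' (trans n p p' y)

omit [IsManifold (𝓡 n) ∞ X] in
lemma Density.divOp_contDiffOn (δ : Density n X) (B : Bivector n X) {u : X → ℝ}
    (hu : SmoothFn n u) (p : X) :
    ContDiffOn ℝ ∞ (divOp (fr n) (δ.μ p) (B.q p) fun y => u (par n p y)) (tgt n p) := by
  intro y hy
  have hn := (isOpen_tgt p).mem_nhds hy
  exact (contDiffAt_divOp ((δ.smooth p).contDiffAt hn) (δ.pos p y hy).ne'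
    (fun i j => (B.smooth p i j).contDiffAt hn) ((hu p).contDiffAt hn)).contDiffWithinAt

/-- Invariance is proved weakly: paired with a test function, each side becomes an integral of first
derivatives, which transforms by the chain rule and the change of variables. Second derivatives of
the transition map never appear. -/
lemma Density.divOp_trans (δ : Density n X) (B : Bivector n X) {u : X → ℝ} (hu : SmoothFn n u)
    {p p' : X} {y : Eu n} (hy : y ∈ overlap n p p') :
    divOp (fr n) (δ.μ p) (B.q p) (fun y => u (par n p y)) y
      = divOp (fr n) (δ.μ p') (B.q p') (fun y => u (par n p' y))
        (AmbientGJMS.trans n p p' y) := by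
  set T := AmbientGJMS.trans n p p' with hT
  set S := AmbientGJMS.trans n p' p with hS
  set W := overlap n p p' with hW0
  set W' := overlap n p' p with hW0'
  have hW : IsOpen W := isOpen_overlap p p'
  have hW' : IsOpen W' := isOpen_overlap p' p
  have hWp : W ⊆ tgt n p := fun _ h => h.1
  have hWp' : W' ⊆ tgt n p' := fun _ h => h.1
  set a := divOp (fr n) (δ.μ p) (B.q p) (fun y => u (par n p y)) with ha0
  set a' := divOp (fr n) (δ.μ p') (B.q p') (fun y => u (par n p' y)) with ha0'
  have ha : ContDiffOn ℝ ∞ a W := (δ.divOp_contDiffOn B hu p).mono hWp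
  have ha' : ContDiffOn ℝ ∞ a' W' := (δ.divOp_contDiffOn B hu p').mono hWp'
  have hTW : ContDiffOn ℝ ∞ T W := contDiffOn_trans p p'
  have haT : ContDiffOn ℝ ∞ (fun y => a' (T y)) W := ha'.comp hTW fun _ h => trans_mem_overlap h
  have hμ : ContDiffOn ℝ ∞ (δ.μ p) W := (δ.smooth p).mono hWp
  have hcont : ContinuousOn (fun y => δ.μ p y * (a y - a' (T y))) W :=
    (hμ.mul (ha.sub haT)).continuousOn
  have hmain : ∀ g : Eu n → ℝ, ContDiff ℝ ∞ g → HasCompactSupport g → tsupport g ⊆ W →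
      ∫ z, g z • (δ.μ p z * (a z - a' (T z))) = 0 := by
    intro g hg hc hs
    -- transport of the test function
    set g' : Eu n → ℝ := W'.indicator fun z => g (S z) with hg'
    have hK : IsCompact (T '' tsupport g) := hc.image_of_continuousOn (hTW.continuousOn.mono hs)
    have hsupp : Function.support g' ⊆ T '' tsupport g := by
      intro z hz
      have hz' : z ∈ W' := by
        by_contra h
        exact hz (Set.indicator_of_notMem h _)
      rw [Function.mem_support, hg', Set.indicator_of_mem hz'] at hz
      exact ⟨S z, subset_tsupport g hz, trans_trans hz'⟩
    have hts : tsupport g' ⊆ W' := (closure_minimal hsupp hK.isClosed).trans (by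
      rintro _ ⟨z, hz, rfl⟩
      exact trans_mem_overlap (hs hz))
    have hc' : HasCompactSupport g' := HasCompactSupport.of_support_subset_isCompact hK hsupp
    have hSW : ContDiffOn ℝ ∞ S W' := contDiffOn_trans p' p
    have hgs : ContDiff ℝ ∞ g' := by
      rw [contDiff_iff_contDiffAt]
      intro z
      by_cases hz : z ∈ W'
      · have h1 : g' =ᶠ[𝓝 z] fun z => g (S z) := by
          filter_upwards [hW'.mem_nhds hz] with t ht using Set.indicator_of_mem ht _
        exact (hg.contDiffAt.comp z (hSW.contDiffAt (hW'.mem_nhds hz))).congr_of_eventuallyEq h1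
      · have h1 : g' =ᶠ[𝓝 z] fun _ => 0 := by
          filter_upwards [(isClosed_tsupport g').isOpen_compl.mem_nhds fun h => hz (hts h)]
            with t ht using image_eq_zero_of_notMem_tsupport ht
        exact contDiffAt_const.congr_of_eventuallyEq h1
    have hgT : ∀ z ∈ W, g' (T z) = g z := by
      intro z hz
      rw [hg', Set.indicator_of_mem (trans_mem_overlap hz), hS, trans_trans hz]
    have hz1 : ∀ z, z ∉ W → g z = 0 := fun z hz =>
      image_eq_zero_of_notMem_tsupport fun h => hz (hs h)
    have hz2 : ∀ z, z ∉ W → ∀ i, pderiv (fr n) i g z = 0 := fun z hz i =>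
      image_eq_zero_of_notMem_tsupport fun h => hz (hs (tsupport_pderiv_subset i h))
    have hz1' : ∀ z, z ∉ W' → g' z = 0 := fun z hz =>
      image_eq_zero_of_notMem_tsupport fun h => hz (hts h)
    have hz2' : ∀ z, z ∉ W' → ∀ i, pderiv (fr n) i g' z = 0 := fun z hz i =>
      image_eq_zero_of_notMem_tsupport fun h => hz (hts (tsupport_pderiv_subset i h))
    have e1 : ∫ z, g z * (δ.μ p z * a z) = ∫ z, g z * (δ.μ p z * a' (T z)) := by
      have f2 : ∫ z, g z * (δ.μ p z * a' (T z)) = ∫ z, g' z * (δ.μ p' z * a' z) := by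
        refine integral_eq_of_overlap (p := p) (p' := p') (fun z hz => by rw [hz1 z hz, zero_mul])
          (fun z hz => by rw [hz1' z hz, zero_mul]) fun z hz => ?_
        rw [δ.trans p p' z hz, ← hT, hgT z hz]
        ring
      rw [f2, integral_mul_divOp hW hμ (fun z hz => (δ.pos p z (hWp hz)).ne')
        (fun i j => (B.smooth p i j).mono hWp) ((hu p).mono hWp) hg hc hs,
        integral_mul_divOp hW' ((δ.smooth p').mono hWp') (fun z hz => (δ.pos p' z (hWp' hz)).ne')
        (fun i j => (B.smooth p' i j).mono hWp') ((hu p').mono hWp') hgs hc' hts]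
      congr 1
      refine integral_eq_of_overlap (p := p) (p' := p') (fun z hz => by simp [hz2 z hz])
          (fun z hz => by simp [hz2' z hz]) fun z hz => ?_
      rw [δ.trans p p' z hz, ← hT, mul_assoc, B.sum_trans hz _
        (fun k => pderiv (fr n) k g' (T z)) _ (fun k => pderiv (fr n) k (fun z => u (par n p' z)) (T z))]
      · intro i
        refine pderiv_comp_trans hz ?_ (hgs.differentiable (by simp) _) i
        filter_upwards [hW.mem_nhds hz] with t ht using (hgT t ht).symm
      · intro i
        refine pderiv_comp_trans hz ?_ (((hu p').contDiffAt
          ((isOpen_tgt p').mem_nhds (trans_mem hz.2))).differentiableAt (by simp)) i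
        filter_upwards [hW.mem_nhds hz] with t ht
        rw [par_trans ht.2]
    have i1 := integrable_mul_of_tsupport_subset hW hg.continuous hc hs (hμ.mul ha).continuousOn
    have i2 := integrable_mul_of_tsupport_subset hW hg.continuous hc hs (hμ.mul haT).continuousOn
    rw [← sub_eq_zero, ← integral_sub i1 i2] at e1
    rw [← e1]
    refine integral_congr_ae (ae_of_all _ fun z => ?_)
    simp only [smul_eq_mul]
    ring
  -- The fundamental lemma of the calculus of variations gives equality almost everywhere, and
  -- continuity gives it at `y`.
  have hae := hW.ae_eq_zero_of_integral_contDiff_smul_eq_zero (μ := volume)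
    (hcont.locallyIntegrableOn hW.measurableSet) hmain
  have hzero := Measure.eqOn_open_of_ae_eq (g := fun _ => (0 : ℝ))
    ((ae_restrict_iff' hW.measurableSet).2 hae) hW hcont continuousOn_const hy
  simpa [sub_eq_zero, (δ.pos p y hy.1).ne'] using hzero

end Transition

/-! ### The coefficients of the operators `ℳ(ρ)` -/

section TaylorDivOp

variable {n : ℕ} {U : Set (Eu n)} {I : Set ℝ} {μ : Eu n → ℝ}
  {Q : Eu n × ℝ → Matrix (Fin n) (Fin n) ℝ} {K : Eu n × ℝ → ℝ}

lemma divOp_slice_contDiffOn (hU : IsOpen U) (hI : IsOpen I) (hμ : ContDiffOn ℝ ∞ μ U)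
    (hμ0 : ∀ y ∈ U, μ y ≠ 0) (hQ : ∀ i j, ContDiffOn ℝ ∞ (fun q => Q q i j) (U ×ˢ I))
    (hK : ContDiffOn ℝ ∞ K (U ×ˢ I)) :
    ContDiffOn ℝ ∞ (fun q : Eu n × ℝ => divOp (fr n) μ (fun y => Q (y, q.2))
      (fun y => K (y, q.2)) q.1) (U ×ˢ I) := by
  have hμ' : ContDiffOn ℝ ∞ (fun q : Eu n × ℝ => μ q.1) (U ×ˢ I) :=
    hμ.comp contDiffOn_fst fun _ hq => hq.1
  exact (hμ'.inv fun q hq => hμ0 _ hq.1).mul (ContDiffOn.sum fun i _ =>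
    dx_contDiffOn (hU.prod hI) (f := fun q => μ q.1 * ∑ j, Q q i j * dx (fr n j) K q)
      (hμ'.mul (ContDiffOn.sum fun j _ => (hQ i j).mul (dx_contDiffOn (hU.prod hI) hK _))) _)

/-- The density `μ` is independent of `ρ`, so the expansion is the Cauchy product of those of `Q`
and `K`, with the same `μ` in every term. -/
lemma tcoef_divOp (hU : IsOpen U) (hI : IsOpen I) (h0 : (0 : ℝ) ∈ I) (hμ : ContDiffOn ℝ ∞ μ U)
    (hQ : ∀ i j, ContDiffOn ℝ ∞ (fun q => Q q i j) (U ×ˢ I))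
    (hK : ContDiffOn ℝ ∞ K (U ×ˢ I)) (m : ℕ) {y : Eu n} (hy : y ∈ U) :
    tcoef m (fun r => divOp (fr n) μ (fun y => Q (y, r)) (fun y => K (y, r)) y)
      = ∑ p ∈ Finset.HasAntidiagonal.antidiagonal m, divOp (fr n) μ
        (fun y => Matrix.of fun i j => tcoef p.1 fun r => Q (y, r) i j)
        (fun y => tcoef p.2 fun r => K (y, r)) y := by
  have hUI := hU.prod hI
  have hμ' : ContDiffOn ℝ ∞ (fun q : Eu n × ℝ => μ q.1) (U ×ˢ I) :=
    hμ.comp contDiffOn_fst fun _ hq => hq.1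
  set F : Fin n → Eu n × ℝ → ℝ := fun i q => μ q.1 * ∑ j, Q q i j * dx (fr n j) K q with hF0
  have hF : ∀ i, ContDiffOn ℝ ∞ (F i) (U ×ˢ I) := fun i =>
    hμ'.mul (ContDiffOn.sum fun j _ => (hQ i j).mul (dx_contDiffOn hUI hK _))
  have hFm : ∀ i, ∀ z ∈ U, tcoef m (fun r => F i (z, r)) = ∑ p ∈ Finset.HasAntidiagonal.antidiagonal m,
      μ z * ∑ j, tcoef p.1 (fun r => Q (z, r) i j)
        * pderiv (fr n) j (fun y => tcoef p.2 fun r => K (y, r)) z := by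
    intro i z hz
    have hs : ∀ {f : Eu n × ℝ → ℝ}, ContDiffOn ℝ ∞ f (U ×ˢ I) →
        ContDiffAt ℝ ∞ (fun r => f (z, r)) 0 := fun hf => contDiffAt_slice hU hI hf hz h0
    simp only [hF0]
    rw [tcoef_const_mul, tcoef_sum _ fun j _ => (hs (hQ i j)).mul (hs (dx_contDiffOn hUI hK _)),
      ← Finset.mul_sum, Finset.sum_comm]
    congr 1
    refine Finset.sum_congr rfl fun j _ => ?_
    rw [tcoef_mul (hs (hQ i j)) (hs (dx_contDiffOn hUI hK _))]
    refine Finset.sum_congr rfl fun p _ => ?_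
    rw [tcoef_dx hU hI h0 hK _ _ hz]
    rfl
  have h1 : ∀ r, divOp (fr n) μ (fun y => Q (y, r)) (fun y => K (y, r)) y
      = (μ y)⁻¹ * ∑ i, dx (fr n i) (F i) (y, r) := fun _ => rfl
  simp only [h1]
  rw [tcoef_const_mul, tcoef_sum _ fun i _ => contDiffAt_slice hU hI
    (dx_contDiffOn hUI (hF i) _) hy h0]
  have hcQ : ∀ a i j, ContDiffOn ℝ ∞ (fun z => tcoef a fun r => Q (z, r) i j) U := fun a i j =>
    tcoef_contDiffOn hU hI h0 (hQ i j) a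
  have hcK : ∀ a, ContDiffOn ℝ ∞ (fun z => tcoef a fun r => K (z, r)) U := fun a =>
    tcoef_contDiffOn hU hI h0 hK a
  simp only [divOp]
  rw [← Finset.mul_sum, Finset.sum_comm]
  congr 1
  refine Finset.sum_congr rfl fun i _ => ?_
  rw [tcoef_dx hU hI h0 (hF i) _ _ hy]
  have h2 : (fun z => tcoef m fun r => F i (z, r)) =ᶠ[𝓝 y] fun z => ∑ p ∈ Finset.HasAntidiagonal.antidiagonal m,
      μ z * ∑ j, tcoef p.1 (fun r => Q (z, r) i j)
        * pderiv (fr n) j (fun y => tcoef p.2 fun r => K (y, r)) z := by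
    filter_upwards [hU.mem_nhds hy] with z hz using hFm i z hz
  have h3 := pderiv_congr (b := fr n) h2 i
  rw [pderiv_sum] at h3
  · exact h3
  · intro p _
    exact ((hμ.mul (ContDiffOn.sum fun j _ => (hcQ _ i j).mul
      (contDiffOn_pderiv hU (hcK _) j))).contDiffAt (hU.mem_nhds hy)).differentiableAt (by simp)

end TaylorDivOp

section Lap

variable {n : ℕ} {X : Type} [TopologicalSpace X] [ChartedSpace (EuclideanSpace ℝ (Fin n)) X]

/-- The operator `μ⁻¹ ∂ᵢ (μ qⁱʲ ∂ⱼ u)` on functions on `X`. -/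
def Density.lap (δ : Density n X) (B : Bivector n X) (u : X → ℝ) : X → ℝ :=
  fun x => divOp (fr n) (δ.μ x) (B.q x) (fun y => u (par n x y)) (crd n x x)

variable [IsManifold (𝓡 n) ∞ X] (δ : Density n X) (B : Bivector n X)

/-- The operator is defined with a chart that varies with the point; invariance allows a fixed
chart, which is needed for smoothness and integration. -/
lemma Density.lap_par {u : X → ℝ} (hu : SmoothFn n u) {p : X} {y : Eu n} (hy : y ∈ tgt n p) :
    δ.lap B u (par n p y) = divOp (fr n) (δ.μ p) (B.q p) (fun y => u (par n p y)) y :=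
  (δ.divOp_trans B hu (p := p) (p' := par n p y) ⟨hy, mem_src_self _⟩).symm

lemma Density.smoothFn_lap {u : X → ℝ} (hu : SmoothFn n u) : SmoothFn n (δ.lap B u) := fun p =>
  (δ.divOp_contDiffOn B hu p).congr fun _ hy => δ.lap_par B hu hy

end Lap

namespace Ambient

variable {n : ℕ} {X : Type} [TopologicalSpace X] [ChartedSpace (EuclideanSpace ℝ (Fin n)) X]
  [IsManifold (𝓡 n) ∞ X] (A : Ambient n X)

/-- The Riemannian density of `g_0`. -/
def density : Density n X where
  μ p := A.dens p 0
  smooth := A.dens_zero_contDiffOn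
  pos _ _ hy := A.dens_pos hy A.zero_mem_J
  trans _ _ _ hy := sqrt_chartGram_det_trans A.g 0 hy.1 hy.2

lemma ginv_trans {p p' : X} {y : Eu n} (hy : y ∈ overlap n p p') {ρ : ℝ} (hρ : ρ ∈ A.J) :
    A.ginv p' ρ (trans n p p' y) = jac n p p' y * A.ginv p ρ y * (jac n p p' y).transpose := by
  have h := chartGram_trans A.g ρ hy.1 hy.2
  have h0 := (A.det_pos hy.1 hρ).ne'
  have h1 := h0
  rw [h, Matrix.det_mul, Matrix.det_mul, Matrix.det_transpose] at h1
  have hj : IsUnit (jac n p p' y).det := isUnit_iff_ne_zero.2 fun h => by simp [h] at h1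
  have hjt : IsUnit (jac n p p' y).transpose.det := by rwa [Matrix.det_transpose]
  rw [ginv, ginv, h, Matrix.mul_inv_rev, Matrix.mul_inv_rev]
  simp only [← Matrix.mul_assoc]
  rw [Matrix.mul_nonsing_inv _ hj, Matrix.one_mul, Matrix.mul_assoc, Matrix.nonsing_inv_mul _ hjt,
    Matrix.mul_one]

/-- The inverse metric of `g_ρ`. -/
def bivector {ρ : ℝ} (hρ : ρ ∈ A.J) : Bivector n X where
  q p := A.ginv p ρ
  smooth p i j := (A.ginv_contDiffOn p i j).comp (f := fun y : Eu n => (y, ρ))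
    (contDiffOn_id.prodMk contDiffOn_const) fun _ hy => ⟨hy, hρ⟩
  symm _ _ hy := A.inv_symm hy hρ
  trans _ _ _ hy := A.ginv_trans hy hρ

/-- The coefficients of the inverse metric of `g_ρ` as a power series in `ρ`. -/
def bivCoef (m : ℕ) : Bivector n X where
  q p y := Matrix.of fun i j => tcoef m fun r => A.ginv p r y i j
  smooth p i j := tcoef_contDiffOn (isOpen_tgt p) A.isOpen_J A.zero_mem_J
    (A.ginv_contDiffOn p i j) m
  symm p y hy i j := tcoef_congr (by
    filter_upwards [A.isOpen_J.mem_nhds A.zero_mem_J] with r hr using A.inv_symm hy hr i j) m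
  trans p p' y hy := by
    ext i j
    have h1 : (fun r => A.ginv p' r (AmbientGJMS.trans n p p' y) i j) =ᶠ[𝓝 0] fun r =>
        ∑ k, ∑ l, jac n p p' y i l * jac n p p' y j k * A.ginv p r y l k := by
      filter_upwards [A.isOpen_J.mem_nhds A.zero_mem_J] with r hr
      rw [A.ginv_trans hy hr]
      simp only [Matrix.mul_apply, Matrix.transpose_apply, Finset.sum_mul]
      refine Finset.sum_congr rfl fun k _ => Finset.sum_congr rfl fun l _ => ?_
      ring
    have hs : ∀ k l, ContDiffAt ℝ ∞ (fun r => A.ginv p r y l k) 0 := fun k l =>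
      contDiffAt_slice (isOpen_tgt p) A.isOpen_J (A.ginv_contDiffOn p l k) hy.1 A.zero_mem_J
    simp only [Matrix.mul_apply, Matrix.transpose_apply, Finset.sum_mul, Matrix.of_apply]
    rw [tcoef_congr h1, tcoef_sum _ fun k _ => ContDiffAt.sum fun l _ =>
      contDiffAt_const.mul (hs k l)]
    refine Finset.sum_congr rfl fun k _ => ?_
    rw [tcoef_sum _ fun l _ => contDiffAt_const.mul (hs k l)]
    refine Finset.sum_congr rfl fun l _ => ?_
    rw [tcoef_const_mul]
    ring

variable {A}

lemma SmoothFam.coef {v : X → ℝ → ℝ} (hv : A.SmoothFam v) (m : ℕ) :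
    SmoothFn n fun x => tcoef m (v x) := fun p =>
  tcoef_contDiffOn (isOpen_tgt p) A.isOpen_J A.zero_mem_J (hv p) m

lemma SmoothFam.deriv {v : X → ℝ → ℝ} (hv : A.SmoothFam v) :
    A.SmoothFam fun x ρ => deriv (v x) ρ := fun p =>
  dr_contDiffOn (A.isOpen_prod p) (hv p)

lemma SmoothFam.congr {u v : X → ℝ → ℝ} (hu : A.SmoothFam u)
    (h : ∀ x, ∀ ρ ∈ A.J, v x ρ = u x ρ) : A.SmoothFam v := fun p =>
  (hu p).congr fun _ hq => h _ _ hq.2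

lemma SmoothFam.add {u v : X → ℝ → ℝ} (hu : A.SmoothFam u) (hv : A.SmoothFam v) :
    A.SmoothFam fun x ρ => u x ρ + v x ρ := fun p => (hu p).add (hv p)

variable (A) in
lemma smoothFam_radial {f : ℝ → ℝ} (hf : ContDiff ℝ ∞ f) :
    A.SmoothFam fun (_ : X) ρ => f ρ := fun _ => (hf.comp contDiff_snd).contDiffOn

/-- The part of `ℳ(ρ)` without the potential. -/
lemma SmoothFam.divOp_par {v : X → ℝ → ℝ} (hv : A.SmoothFam v) {p : X} {y : Eu n}
    (hy : y ∈ tgt n p) {ρ : ℝ} (hρ : ρ ∈ A.J) :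
    divOp (fr n) (A.dens (par n p y) 0) (A.ginv (par n p y) ρ) (fun z => v (par n (par n p y) z) ρ)
      (crd n (par n p y) (par n p y))
      = divOp (fr n) (A.dens p 0) (A.ginv p ρ) (fun z => v (par n p z) ρ) y :=
  A.density.lap_par (A.bivector hρ) (hv.slice hρ) hy

lemma SmoothFam.divOp {v : X → ℝ → ℝ} (hv : A.SmoothFam v) :
    A.SmoothFam fun x ρ => divOp (fr n) (A.dens x 0) (A.ginv x ρ) (fun y => v (par n x y) ρ)
      (crd n x x) := fun p =>
  (divOp_slice_contDiffOn (isOpen_tgt p) A.isOpen_J (A.dens_zero_contDiffOn p)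
    (fun _ hy => (A.dens_pos hy A.zero_mem_J).ne') (Q := fun q => A.ginv p q.2 q.1)
    (A.ginv_contDiffOn p) (hv p)).congr fun _ hq => hv.divOp_par hq.1 hq.2

lemma SmoothFam.tcoef_divOp {v : X → ℝ → ℝ} (hv : A.SmoothFam v) (m : ℕ) (x : X) :
    tcoef m (fun ρ => AmbientGJMS.divOp (fr n) (A.dens x 0) (A.ginv x ρ) (fun y => v (par n x y) ρ)
      (crd n x x)) = ∑ p ∈ Finset.HasAntidiagonal.antidiagonal m,
        A.density.lap (A.bivCoef p.1) (fun x => tcoef p.2 (v x)) x :=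
  AmbientGJMS.tcoef_divOp (isOpen_tgt x) A.isOpen_J A.zero_mem_J (A.dens_zero_contDiffOn x)
    (Q := fun q => A.ginv x q.2 q.1) (K := fun q => v (par n x q.1) q.2)
    (A.ginv_contDiffOn x) (hv x) m (crd_mem x (mem_src_self x))

variable (A)

lemma smoothFam_pot : A.SmoothFam A.pot := by
  have hw := A.smoothFam_w
  have hi : A.SmoothFam fun x ρ => (A.w x ρ)⁻¹ := fun p =>
    (hw p).inv fun _ hq => (A.w_pos _ hq.2).ne'
  have h1 := hi.mul hw.divOp
  have h2 := (A.smoothFam_radial (X := X) (f := fun ρ => 2 * ρ) (by fun_prop)).mul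
    (hw.deriv.deriv.mul hi)
  have h3 := (A.smoothFam_radial (X := X) (f := fun _ => (n : ℝ) - 2) (by fun_prop)).mul
    (hw.deriv.mul hi)
  have hm := A.smoothFam_radial (X := X) (f := fun _ => -1) (by fun_prop)
  refine (((hm.mul h1).add h2).add (hm.mul h3)).congr fun x ρ _ => ?_
  rw [pot, iteratedDeriv_succ, iteratedDeriv_one]
  ring

variable (n X) in
/-- The space of smooth functions on `X`. -/
def _root_.AmbientGJMS.smoothSub : Submodule ℝ (X → ℝ) where
  carrier := {u | SmoothFn n u}
  add_mem' hu hv p := (hu p).add (hv p)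
  zero_mem' _ := contDiffOn_const
  smul_mem' _ _ hu p := contDiffOn_const.mul (hu p)

/-- The coefficients of `ℳ(ρ)` as a power series in `ρ`. -/
def coefM (i : ℕ) : Module.End ℝ (smoothSub n X) where
  toFun u := ⟨fun x => A.density.lap (A.bivCoef i) u x + tcoef i (A.pot x) * u.1 x, fun p =>
    (A.density.smoothFn_lap (A.bivCoef i) u.2 p).add ((A.smoothFam_pot.coef i p).mul (u.2 p))⟩
  map_add' u v := by
    ext x
    have hx := (isOpen_tgt (n := n) x).mem_nhds (crd_mem x (mem_src_self x))
    have := divOp_add (b := fr n) ((A.density.smooth x).contDiffAt hx)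
      (fun k l => ((A.bivCoef i).smooth x k l).contDiffAt hx) ((u.2 x).contDiffAt hx)
      ((v.2 x).contDiffAt hx)
    simp only [Submodule.coe_add, Pi.add_apply, Density.lap, this]
    ring
  map_smul' c u := by
    ext x
    have hx := (isOpen_tgt (n := n) x).mem_nhds (crd_mem x (mem_src_self x))
    have := divOp_const_mul (b := fr n) ((A.density.smooth x).contDiffAt hx)
      (fun k l => ((A.bivCoef i).smooth x k l).contDiffAt hx) c ((u.2 x).contDiffAt hx)
    simp only [Submodule.coe_smul, Pi.smul_apply, smul_eq_mul, Density.lap, this,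
      RingHom.id_apply]
    ring

lemma coefM_apply (i : ℕ) (u : smoothSub n X) (x : X) :
    (A.coefM i u).1 x = A.density.lap (A.bivCoef i) u x + tcoef i (A.pot x) * u.1 x := rfl

variable {A}

/-- The coefficients of a smooth family as a power series in `ρ`. -/
def SmoothFam.series {v : X → ℝ → ℝ} (hv : A.SmoothFam v) : ℕ → smoothSub n X :=
  fun m => ⟨fun x => tcoef m (v x), hv.coef m⟩

lemma SmoothFam.R {v : X → ℝ → ℝ} (hv : A.SmoothFam v) (j : ℝ) : A.SmoothFam (A.R j v) := by
  have h1 := (A.smoothFam_radial (X := X) (f := fun ρ => -2 * ρ) (by fun_prop)).mul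
    hv.deriv.deriv
  have h2 := (A.smoothFam_radial (X := X) (f := fun _ => 2 * j) (by fun_prop)).mul hv.deriv
  refine ((h1.add h2).add (hv.divOp.add (A.smoothFam_pot.mul hv))).congr fun x ρ hρ => ?_
  rw [Ambient.R, A.genM_eq (hv.slice hρ) x hρ, iteratedDeriv_succ, iteratedDeriv_one]

/-- The passage from analysis to algebra: on Taylor coefficients at `ρ = 0`, the differential
operator is exactly the formal one. -/
lemma SmoothFam.series_R {v : X → ℝ → ℝ} (hv : A.SmoothFam v) (j : ℝ) :
    (hv.R j).series = formalR A.coefM j hv.series := by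
  funext m
  ext x
  have h0 := A.zero_mem_J
  have hd := hv.deriv
  have hdd := hd.deriv
  have e1 : A.R j v x =ᶠ[𝓝 0] fun ρ => (-2 * (ρ * _root_.deriv (_root_.deriv (v x)) ρ)
      + 2 * j * _root_.deriv (v x) ρ)
      + (AmbientGJMS.divOp (fr n) (A.dens x 0) (A.ginv x ρ) (fun y => v (par n x y) ρ) (crd n x x)
        + A.pot x ρ * v x ρ) := by
    filter_upwards [A.isOpen_J.mem_nhds h0] with ρ hρ
    rw [Ambient.R, A.genM_eq (hv.slice hρ) x hρ, iteratedDeriv_succ, iteratedDeriv_one]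
    ring
  have c0 := hv.contDiffAt_right x h0
  have c1 := hd.contDiffAt_right x h0
  have c2 := hdd.contDiffAt_right x h0
  have c3 := hv.divOp.contDiffAt_right x h0
  have c4 := A.smoothFam_pot.contDiffAt_right x h0
  have e2 : tcoef m (fun ρ => ρ * _root_.deriv (_root_.deriv (v x)) ρ)
      = (m : ℝ) * ((m : ℝ) + 1) * tcoef (m + 1) (v x) := by
    cases m with
    | zero => simp [tcoef_id_mul_zero]
    | succ m =>
      rw [tcoef_id_mul_succ c2, tcoef_deriv, tcoef_deriv]
      push_cast
      ring
  have c5 : ContDiffAt ℝ ∞ (fun ρ => ρ * _root_.deriv (_root_.deriv (v x)) ρ) 0 :=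
    contDiffAt_id.mul c2
  change tcoef m (A.R j v x) = _
  rw [tcoef_congr e1, tcoef_add ((contDiffAt_const.mul c5).add (contDiffAt_const.mul c1))
      (c3.add (c4.mul c0)), tcoef_add (contDiffAt_const.mul c5) (contDiffAt_const.mul c1),
    tcoef_add c3 (c4.mul c0), tcoef_const_mul, tcoef_const_mul, e2, tcoef_deriv, tcoef_mul c4 c0,
    hv.tcoef_divOp, formalR_apply, ← Finset.sum_add_distrib]
  simp only [Submodule.coe_add, Submodule.coe_smul, Pi.add_apply, Pi.smul_apply,
    AddSubmonoidClass.coe_finsetSum, Finset.sum_apply, smul_eq_mul, coefM_apply]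
  congr 1
  simp only [SmoothFam.series]
  ring

lemma SmoothFam.Dtilde {v : X → ℝ → ℝ} (hv : A.SmoothFam v) (M : ℕ) (L : ℝ) :
    ∃ h : A.SmoothFam (A.Dtilde M L v), h.series = formalD A.coefM M L hv.series := by
  induction M with
  | zero => exact ⟨hv, rfl⟩
  | succ M ih =>
    obtain ⟨h, hs⟩ := ih
    exact ⟨h.R _, by rw [formalD_succ, ← hs]; exact h.series_R _⟩

variable (A)

lemma series_mulPow (N : ℕ) (u : smoothSub n X) :
    ∃ h : A.SmoothFam (mulPow N u.1), h.series = seqShift^[N] (Pi.single 0 u) := by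
  induction N with
  | zero =>
    have h : A.SmoothFam (mulPow 0 u.1) :=
      (A.smoothFam_const u.2).congr fun x ρ _ => by simp [mulPow]
    refine ⟨h, ?_⟩
    funext m
    ext x
    change tcoef m (fun ρ => ρ ^ 0 * u.1 x) = _
    simp only [pow_zero, one_mul, tcoef_const, Function.iterate_zero, id]
    by_cases hm : m = 0
    · subst hm; simp
    · simp [hm]
  | succ N ih =>
    obtain ⟨h, hs⟩ := ih
    have h' : A.SmoothFam (mulPow (N + 1) u.1) :=
      ((A.smoothFam_radial (X := X) contDiff_id).mul h).congr fun x ρ _ => by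
        simp only [mulPow, id]; ring
    refine ⟨h', ?_⟩
    rw [Function.iterate_succ_apply', ← hs]
    funext m
    ext x
    have e : mulPow (N + 1) u.1 x = fun ρ => ρ * mulPow N u.1 x ρ := by
      funext ρ; simp only [mulPow]; ring
    change tcoef m (mulPow (N + 1) u.1 x) = _
    rw [e]
    cases m with
    | zero => rw [tcoef_id_mul_zero]; rfl
    | succ m => rw [tcoef_id_mul_succ (h.contDiffAt_right x A.zero_mem_J)]; rfl

lemma DP_eq (M N : ℕ) (L : ℝ) (u : smoothSub n X) :
    A.DP M N L u.1 = (formalD A.coefM M L (seqShift^[N] (Pi.single 0 u)) 0).1 := by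
  obtain ⟨h, hs⟩ := A.series_mulPow N u
  obtain ⟨h', hs'⟩ := h.Dtilde M L
  rw [← hs, ← hs']
  funext x
  exact (tcoef_zero _).symm

lemma DP_eq_wordCoeff {M N : ℕ} (hNM : N ≤ M) (L : ℝ) (u : smoothSub n X) :
    A.DP M N L u.1 = (∏ i ∈ Finset.range N, 2 * ((M : ℝ) - i) * (L - M - i)) •
      (wordCoeff A.coefM (L - 2 * N) (M - N) 0 u).1 := by
  rw [A.DP_eq, formalD_seqShift_iterate_apply_zero _ _ _ hNM, formalD_single]
  rfl

end Ambient

/-! ### The GJMS operators -/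

namespace Ambient

variable {n : ℕ} {X : Type} [TopologicalSpace X] [ChartedSpace (EuclideanSpace ℝ (Fin n)) X]
  [IsManifold (𝓡 n) ∞ X] (A : Ambient n X)

/-- On degree `a = k - n/2 - 2i` the Laplacian acts through `ℛ` with index `a + n/2 - 1 = k - 1 -
2i`, so its iterates run through precisely the indices of the product with parameter `k`. -/
lemma laplacian_iterate {v : X → ℝ → ℝ} (hv : A.SmoothFam v) {F : ℝ × X × ℝ → ℝ} (k : ℝ)
    (hF : ∀ τ x ρ, 0 < τ → ρ ∈ A.J →
      F (τ, x, ρ) = τ ^ (k - (n : ℝ) / 2) * ((A.w x ρ)⁻¹ * v x ρ)) (i : ℕ) (τ : ℝ) (x : X) (ρ : ℝ)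
    (hτ : 0 < τ) (hρ : ρ ∈ A.J) :
    A.laplacian^[i] F (τ, x, ρ)
      = τ ^ (k - (n : ℝ) / 2 - 2 * i) * ((A.w x ρ)⁻¹ * A.Dtilde i k v x ρ) := by
  induction i generalizing τ x ρ with
  | zero => simpa [Dtilde] using hF τ x ρ hτ hρ
  | succ i ih =>
    obtain ⟨h, -⟩ := hv.Dtilde i k
    rw [Function.iterate_succ_apply', A.laplacian_eq_R h _ (fun τ x ρ => ih τ x ρ) τ x ρ hτ hρ,
      Dtilde, show k - (n : ℝ) / 2 - 2 * i - 2 = k - n / 2 - 2 * ((i + 1 : ℕ) : ℝ) by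
        push_cast; ring, show k - (n : ℝ) / 2 - 2 * i + n / 2 - 1 = k + 1 - 2 * ((i : ℝ) + 1) by
        ring]

/-- The product acts on `w u`, not on `u`. The two agree at `ρ = 0`, and their difference, a
multiple of `ρ`, contributes nothing because its scalar contains `L - k = 0`. -/
lemma gjms_eq (k : ℕ) (u : smoothSub n X) :
    A.gjms k u.1 = (wordCoeff A.coefM k k 0 u).1 := by
  have hv : A.SmoothFam fun x ρ => A.w x ρ * u.1 x := A.smoothFam_w.mul (A.smoothFam_const u.2)
  obtain ⟨h, hs⟩ := hv.Dtilde k k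
  have h0 := A.zero_mem_J
  have e1 : hv.series = Pi.single 0 u + seqShift fun m => hv.series (m + 1) := by
    funext m
    cases m with
    | zero =>
      ext x
      change tcoef 0 (fun ρ => A.w x ρ * u.1 x) = _
      simp [tcoef_zero, A.w_zero, seqShift]
    | succ m => simp [seqShift]
  have e2 : formalD A.coefM k k (seqShift fun m => hv.series (m + 1)) 0 = 0 := by
    cases k with
    | zero => rfl
    | succ k => rw [formalD_seqShift_apply_zero]; simp
  have e3 : formalD A.coefM k k hv.series 0 = wordCoeff A.coefM k k 0 u := by
    rw [e1, map_add, Pi.add_apply, e2, formalD_single, add_zero]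
  rw [← e3, ← hs]
  funext x
  rw [gjms, A.laplacian_iterate hv k (fun τ x ρ hτ hρ => ?_) k 1 x 0 one_pos h0, A.w_zero]
  · simp only [Real.one_rpow, inv_one, one_mul]
    exact (tcoef_zero _).symm
  · rw [inv_mul_cancel_left₀ (A.w_pos x hρ).ne']

/-- The constant relating `D_{M,M+N} ∘ 𝒫_N` to the GJMS operator. -/
def _root_.AmbientGJMS.gjmsConst (M N : ℕ) : ℝ :=
  ∏ i ∈ Finset.range N, 2 * ((M : ℝ) - i) * ((N : ℝ) - i)

lemma _root_.AmbientGJMS.gjmsConst_ne_zero {M N : ℕ} (hNM : N ≤ M) : gjmsConst M N ≠ 0 := by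
  refine Finset.prod_ne_zero_iff.2 fun i hi => ?_
  have h1 : i < N := Finset.mem_range.1 hi
  have h2 : (i : ℝ) < N := by exact_mod_cast h1
  have h3 : (N : ℝ) ≤ M := by exact_mod_cast hNM
  exact mul_ne_zero (mul_ne_zero two_ne_zero (by linarith)) (by linarith)

lemma DP_eq_gjms {M N : ℕ} (hNM : N ≤ M) (u : smoothSub n X) :
    A.DP M N (M + N) u.1 = gjmsConst M N • A.gjms (M - N) u.1 := by
  have h1 : ∀ i : ℕ, 2 * ((M : ℝ) - i) * ((M : ℝ) + N - M - i)
      = 2 * ((M : ℝ) - i) * ((N : ℝ) - i) := fun i => by ring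
  rw [A.DP_eq_wordCoeff hNM, A.gjms_eq, Nat.cast_sub hNM, gjmsConst,
    Finset.prod_congr rfl fun i _ => h1 i, show (M : ℝ) + N - 2 * N = M - N by ring]

lemma _root_.AmbientGJMS.smoothFn_of_contMDiff {u : X → ℝ} (hu : ContMDiff (𝓡 n) 𝓘(ℝ, ℝ) ∞ u) :
    SmoothFn n u := by
  intro p y hy
  have h : ContMDiffAt (𝓡 n) 𝓘(ℝ, ℝ) ∞ (fun y => u (par n p y)) y :=
    (hu.contMDiffAt (x := par n p y)).comp y (contMDiffAt_par p hy)
  exact (contMDiffAt_iff_contDiffAt.1 h).contDiffWithinAt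

lemma _root_.AmbientGJMS.contMDiff_of_smoothFn {u : X → ℝ} (hu : SmoothFn n u) :
    ContMDiff (𝓡 n) 𝓘(ℝ, ℝ) ∞ u := by
  intro x
  have h1 : ContMDiffAt (𝓡 n) 𝓘(ℝ, ℝ) ∞ (fun y => u (par n x y)) (crd n x x) :=
    contMDiffAt_iff_contDiffAt.2
      ((hu x).contDiffAt ((isOpen_tgt x).mem_nhds (crd_mem x (mem_src_self x))))
  refine (h1.comp x (contMDiffAt_crd x (mem_src_self x))).congr_of_eventuallyEq ?_
  filter_upwards [(isOpen_src (n := n) x).mem_nhds (mem_src_self x)] with z hz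
  exact congrArg u (par_crd x hz).symm

end Ambient

/-! ### The Riemannian measure -/

namespace Ambient

variable {n : ℕ} {X : Type} [TopologicalSpace X] [ChartedSpace (EuclideanSpace ℝ (Fin n)) X]
  [IsManifold (𝓡 n) ∞ X] [MeasurableSpace X] [BorelSpace X] (A : Ambient n X)

lemma _root_.AmbientGJMS.measurableSet_par_preimage (p : X) {s : Set X} (hs : MeasurableSet s) :
    MeasurableSet (par n p ⁻¹' s ∩ tgt n p) := by
  have h : Measurable ((tgt n p).domRestrict (par n p)) :=
    (continuousOn_iff_continuous_domRestrict.1 (continuousOn_par p)).measurable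
  have := ((isOpen_tgt p).measurableSet).subtype_image (h hs)
  convert this using 1
  ext y
  simp [and_comm]

lemma density_eq {p : X} {y : Eu n} (hy : y ∈ tgt n p) :
    √(chartGram A.g p 0 y).det = A.dens p 0 y := by
  rw [dens, abs_of_pos (A.det_pos hy A.zero_mem_J)]

lemma aemeasurable_par (p : X) : AEMeasurable (par n p)
    ((volume.restrict (tgt n p)).withDensity
      fun y => ENNReal.ofReal (√(chartGram A.g p 0 y).det)) :=
  ((continuousOn_par p).aemeasurable (isOpen_tgt p).measurableSet).mono_ac
    (withDensity_absolutelyContinuous _ _)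

lemma chartVolume_apply (p : X) {s : Set X} (hs : MeasurableSet s) :
    A.chartVolume p s
      = ∫⁻ y in par n p ⁻¹' s ∩ tgt n p, ENNReal.ofReal (A.dens p 0 y) := by
  rw [chartVolume, Measure.map_apply_of_aemeasurable (A.aemeasurable_par p) hs,
    withDensity_apply', Measure.restrict_restrict' (isOpen_tgt p).measurableSet]
  exact setLIntegral_congr_fun (measurableSet_par_preimage p hs) fun y hy => by
    rw [A.density_eq hy.2]

lemma chartVolume_eq_of_subset {p q : X} {s : Set X} (hs : MeasurableSet s) (hp : s ⊆ src n p)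
    (hq : s ⊆ src n q) : A.chartVolume q s = A.chartVolume p s := by
  have hsub : par n p ⁻¹' s ∩ tgt n p ⊆ overlap n p q := fun y hy => ⟨hy.2, hq hy.1⟩
  have himg : trans n p q '' (par n p ⁻¹' s ∩ tgt n p) = par n q ⁻¹' s ∩ tgt n q := by
    ext z
    constructor
    · rintro ⟨y, hy, rfl⟩
      exact ⟨by rw [Set.mem_preimage, par_trans (hsub hy).2]; exact hy.1, trans_mem (hsub hy).2⟩
    · intro hz
      have hz' : z ∈ overlap n q p := ⟨hz.2, hp hz.1⟩
      exact ⟨trans n q p z, ⟨by rw [Set.mem_preimage, par_trans hz'.2]; exact hz.1,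
        trans_mem hz'.2⟩, trans_trans hz'⟩
  rw [A.chartVolume_apply q hs, A.chartVolume_apply p hs, ← himg,
    lintegral_overlap (measurableSet_par_preimage p hs) hsub]
  refine setLIntegral_congr_fun (measurableSet_par_preimage p hs) fun y hy => ?_
  have := A.density.trans p q y (hsub hy)
  change A.dens p 0 y = _ * A.dens q 0 _ at this
  simp only [this, ENNReal.ofReal_mul (abs_nonneg _)]

lemma chartVolume_compl_src (q : X) : A.chartVolume q (src n q)ᶜ = 0 := by
  rw [A.chartVolume_apply q (isOpen_src q).measurableSet.compl]
  have : par n q ⁻¹' (src n q)ᶜ ∩ tgt n q = ∅ := by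
    ext y
    simp only [Set.mem_inter_iff, Set.mem_preimage, Set.mem_compl_iff, Set.mem_empty_iff_false,
      iff_false, not_and]
    intro h hy
    exact h (par_mem q hy)
  rw [this, Measure.restrict_empty, lintegral_zero_measure]

lemma chartVolume_restrict_src (q : X) :
    (A.chartVolume q).restrict (src n q) = A.chartVolume q :=
  Measure.restrict_eq_self_of_ae_mem (mem_ae_iff.2 (A.chartVolume_compl_src q))

/-- The chart measures agree on overlaps, so the one at `q` can exceed the one at `p` only off the
domain at `p`, where the infinite measure dominates. The right side is independent of `q` and so
also bounds the supremum. -/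
lemma chartVolume_le (p q : X) :
    A.chartVolume q ≤ A.chartVolume p + (⊤ : Measure X).restrict (src n p)ᶜ := by
  refine Measure.le_intro fun s hs _ => ?_
  have hp := (isOpen_src (n := n) p).measurableSet
  have hq := (isOpen_src (n := n) q).measurableSet
  have h1 : A.chartVolume q (s ∩ src n p) ≤ A.chartVolume p s := by
    rw [← A.chartVolume_restrict_src q, Measure.restrict_apply (hs.inter hp),
      A.chartVolume_eq_of_subset (p := p) ((hs.inter hp).inter hq)
        (fun x hx => hx.1.2) fun x hx => hx.2]
    exact measure_mono fun x hx => hx.1.1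
  rw [← measure_inter_add_sdiff s hp, Measure.add_apply, Measure.restrict_apply hs]
  exact add_le_add h1 (le_top (a := A.chartVolume q) _)

lemma riemVolume_restrict_src (p : X) :
    A.riemVolume.restrict (src n p) = A.chartVolume p := by
  have hp := (isOpen_src (n := n) p).measurableSet
  refine le_antisymm ?_ ?_
  · have h1 : A.riemVolume ≤ A.chartVolume p + (⊤ : Measure X).restrict (src n p)ᶜ :=
      iSup_le fun q => A.chartVolume_le p q
    refine (Measure.restrict_mono subset_rfl h1).trans ?_
    rw [Measure.restrict_add, Measure.restrict_restrict hp, Set.inter_compl_self,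
      Measure.restrict_empty, add_zero, A.chartVolume_restrict_src]
  · rw [← A.chartVolume_restrict_src p]
    exact Measure.restrict_mono subset_rfl (le_iSup A.chartVolume p)

lemma aemeasurable_density (p : X) :
    AEMeasurable (fun y => ENNReal.ofReal (√(chartGram A.g p 0 y).det))
      (volume.restrict (tgt n p)) := by
  have hT := (isOpen_tgt (n := n) p).measurableSet
  refine (AEMeasurable.ennreal_ofReal ?_)
  refine (((A.dens_zero_contDiffOn p).continuousOn.aemeasurable hT)).congr ?_
  filter_upwards [ae_restrict_mem hT] with y hy using (A.density_eq hy).symm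

lemma integral_chartVolume (p : X) {f : X → ℝ} (hf : AEStronglyMeasurable f (A.chartVolume p)) :
    ∫ x, f x ∂A.chartVolume p = ∫ y in tgt n p, A.dens p 0 y * f (par n p y) := by
  have hT := (isOpen_tgt (n := n) p).measurableSet
  rw [chartVolume, integral_map (A.aemeasurable_par p) hf,
    integral_withDensity_eq_integral_toReal_smul₀ (A.aemeasurable_density p) (by simp)]
  refine setIntegral_congr_fun hT fun y hy => ?_
  simp only [smul_eq_mul]
  rw [ENNReal.toReal_ofReal (Real.sqrt_nonneg _), A.density_eq hy]

lemma integral_riemVolume {p : X} {f : X → ℝ} (hf : Continuous f) (h : ∀ x ∉ src n p, f x = 0) :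
    ∫ x, f x ∂A.riemVolume = ∫ y in tgt n p, A.dens p 0 y * f (par n p y) := by
  have h1 := setIntegral_eq_integral_of_forall_compl_eq_zero (μ := A.riemVolume) h
  rw [← h1, A.riemVolume_restrict_src, A.integral_chartVolume p hf.aestronglyMeasurable]

instance : IsLocallyFiniteMeasure A.riemVolume := by
  refine ⟨fun x => ?_⟩
  have hy := crd_mem x (mem_src_self (n := n) x)
  obtain ⟨r, hr, hb⟩ := Metric.nhds_basis_closedBall.mem_iff.1 ((isOpen_tgt x).mem_nhds hy)
  have hs : IsOpen (src n x ∩ crd n x ⁻¹' Metric.ball (crd n x x) r) :=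
    (continuousOn_crd x).isOpen_inter_preimage (isOpen_src x) Metric.isOpen_ball
  refine ⟨_, hs.mem_nhds ⟨mem_src_self x, Metric.mem_ball_self hr⟩, ?_⟩
  rw [← Set.inter_eq_self_of_subset_left (s := src n x ∩ _) Set.inter_subset_left,
    ← Measure.restrict_apply hs.measurableSet, A.riemVolume_restrict_src,
    A.chartVolume_apply x hs.measurableSet]
  have hi : IntegrableOn (A.dens x 0) (Metric.closedBall (crd n x x) r) :=
    ((A.dens_zero_contDiffOn x).continuousOn.mono hb).integrableOn_compact
      (isCompact_closedBall _ _)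
  refine lt_of_le_of_lt (lintegral_mono_set ?_) hi.lintegral_lt_top
  rintro y ⟨⟨-, h⟩, hy⟩
  rw [Set.mem_preimage, crd_par x hy] at h
  exact Metric.ball_subset_closedBall h

end Ambient

/-! ### Formal self-adjointness of the coefficients of `ℳ(ρ)` -/

section Pairing

variable {n : ℕ} {X : Type} [TopologicalSpace X] [ChartedSpace (EuclideanSpace ℝ (Fin n)) X]
  [IsManifold (𝓡 n) ∞ X]

/-- The pairing of the differentials of two functions by a bivector field. -/
def Bivector.pair (B : Bivector n X) (u v : X → ℝ) (x : X) : ℝ :=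
  ∑ i, ∑ j, B.q x (crd n x x) i j * pderiv (fr n) i (fun y => u (par n x y)) (crd n x x)
    * pderiv (fr n) j (fun y => v (par n x y)) (crd n x x)

lemma SmoothFn.contDiffAt {u : X → ℝ} (hu : SmoothFn n u) {p : X} {y : Eu n} (hy : y ∈ tgt n p) :
    ContDiffAt ℝ ∞ (fun y => u (par n p y)) y := (hu p).contDiffAt ((isOpen_tgt p).mem_nhds hy)

lemma SmoothFn.pderiv_trans {u : X → ℝ} (hu : SmoothFn n u) {p p' : X} {y : Eu n}
    (hy : y ∈ overlap n p p') (i : Fin n) : pderiv (fr n) i (fun y => u (par n p y)) y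
      = ∑ k, jac n p p' y k i
        * pderiv (fr n) k (fun y => u (par n p' y)) (AmbientGJMS.trans n p p' y) := by
  refine pderiv_comp_trans hy ?_
    ((hu.contDiffAt (trans_mem hy.2)).differentiableAt (by simp)) i
  filter_upwards [(isOpen_overlap p p').mem_nhds hy] with t ht
  rw [par_trans ht.2]

lemma SmoothFn.continuous {u : X → ℝ} (hu : SmoothFn n u) : Continuous u :=
  (contMDiff_of_smoothFn hu).continuous

variable (B : Bivector n X)

lemma Bivector.pair_par {u v : X → ℝ} (hu : SmoothFn n u) (hv : SmoothFn n v) {p : X} {y : Eu n}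
    (hy : y ∈ tgt n p) : B.pair u v (par n p y)
      = ∑ i, ∑ j, B.q p y i j * pderiv (fr n) i (fun y => u (par n p y)) y
        * pderiv (fr n) j (fun y => v (par n p y)) y :=
  (B.sum_trans (p := p) (p' := par n p y) ⟨hy, mem_src_self _⟩ _ _ _ _
    (hu.pderiv_trans ⟨hy, mem_src_self _⟩) (hv.pderiv_trans ⟨hy, mem_src_self _⟩)).symm

lemma Bivector.smoothFn_pair {u v : X → ℝ} (hu : SmoothFn n u) (hv : SmoothFn n v) :
    SmoothFn n (B.pair u v) := fun p =>
  (ContDiffOn.sum fun i _ => ContDiffOn.sum fun j _ => ((B.smooth p i j).mul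
    (contDiffOn_pderiv (isOpen_tgt p) (hu p) i)).mul
      (contDiffOn_pderiv (isOpen_tgt p) (hv p) j)).congr fun _ hy => B.pair_par hu hv hy

lemma Bivector.pair_comm (u v : X → ℝ) : B.pair u v = B.pair v u := by
  funext x
  unfold pair
  rw [Finset.sum_comm]
  refine Finset.sum_congr rfl fun i _ => Finset.sum_congr rfl fun j _ => ?_
  rw [B.symm x _ (crd_mem x (mem_src_self x)) j i]
  ring

lemma Bivector.pair_sum {κ : Type*} (s : Finset κ) {f : κ → X → ℝ} (hf : ∀ k ∈ s, SmoothFn n (f k))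
    (v : X → ℝ) (x : X) : B.pair (fun x => ∑ k ∈ s, f k x) v x = ∑ k ∈ s, B.pair (f k) v x := by
  unfold pair
  have h : ∀ i, pderiv (fr n) i (fun y => ∑ k ∈ s, f k (par n x y)) (crd n x x)
      = ∑ k ∈ s, pderiv (fr n) i (fun y => f k (par n x y)) (crd n x x) := fun i =>
    pderiv_sum s (fun k hk => ((hf k hk).contDiffAt
      (crd_mem x (mem_src_self x))).differentiableAt (by simp)) i
  simp only [h, Finset.mul_sum, Finset.sum_mul]
  exact (Finset.sum_congr rfl fun i _ => Finset.sum_comm).trans Finset.sum_comm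

lemma eventually_par_eq {u : X → ℝ} {x : X} {c : ℝ} (h : u =ᶠ[𝓝 x] fun _ => c) :
    (fun y => u (par n x y)) =ᶠ[𝓝 (crd n x x)] fun _ => c := by
  have h1 : ContinuousAt (par n x) (crd n x x) :=
    (continuousOn_par x).continuousAt ((isOpen_tgt x).mem_nhds (crd_mem x (mem_src_self x)))
  have h2 := h1.tendsto
  rw [par_crd x (mem_src_self x)] at h2
  exact h2.eventually h

lemma Bivector.tsupport_pair_subset (u v : X → ℝ) : tsupport (B.pair u v) ⊆ tsupport u := by
  refine closure_minimal (fun x hx => ?_) (isClosed_tsupport u)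
  by_contra h
  refine hx (Finset.sum_eq_zero fun i _ => Finset.sum_eq_zero fun j _ => ?_)
  rw [pderiv_congr (eventually_par_eq (notMem_tsupport_iff_eventuallyEq.1 h)) i, pderiv_const]
  ring

lemma Density.tsupport_lap_subset (δ : Density n X) (u : X → ℝ) :
    tsupport (δ.lap B u) ⊆ tsupport u := by
  refine closure_minimal (fun x hx => ?_) (isClosed_tsupport u)
  by_contra h
  refine hx ?_
  rw [lap, divOp_congr (EventuallyEq.refl _ _) (EventuallyEq.refl _ _)
    (eventually_par_eq (notMem_tsupport_iff_eventuallyEq.1 h))]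
  simp [divOp, pderiv_const]

end Pairing

namespace Ambient

variable {n : ℕ} {X : Type} [TopologicalSpace X] [T2Space X]
  [ChartedSpace (EuclideanSpace ℝ (Fin n)) X]
  [IsManifold (𝓡 n) ∞ X] [MeasurableSpace X] [BorelSpace X] (A : Ambient n X) (B : Bivector n X)

lemma integral_mul_lap_of_tsupport_subset {θ u : X → ℝ} (hθ : SmoothFn n θ)
    (hc : HasCompactSupport θ) {p : X} (hs : tsupport θ ⊆ src n p) (hu : SmoothFn n u) :
    ∫ x, θ x * A.density.lap B u x ∂A.riemVolume = -∫ x, B.pair θ u x ∂A.riemVolume := by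
  have hT := isOpen_tgt (n := n) p
  set θ' : Eu n → ℝ := (tgt n p).indicator fun y => θ (par n p y) with hθ'
  have hK : IsCompact (crd n p '' tsupport θ) :=
    hc.image_of_continuousOn ((continuousOn_crd p).mono hs)
  have hin : ∀ {y}, y ∈ tgt n p → θ' y = θ (par n p y) := fun hy => Set.indicator_of_mem hy _
  have hsupp : Function.support θ' ⊆ crd n p '' tsupport θ := by
    intro y hy
    have hy' : y ∈ tgt n p := by
      by_contra h
      exact hy (Set.indicator_of_notMem h _)
    rw [Function.mem_support, hin hy'] at hy
    exact ⟨par n p y, subset_tsupport θ hy, crd_par p hy'⟩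
  have hts : tsupport θ' ⊆ tgt n p := (closure_minimal hsupp hK.isClosed).trans (by
    rintro _ ⟨z, hz, rfl⟩
    exact crd_mem p (hs hz))
  have hc' : HasCompactSupport θ' := HasCompactSupport.of_support_subset_isCompact hK hsupp
  have hev : ∀ {y}, y ∈ tgt n p → θ' =ᶠ[𝓝 y] fun y => θ (par n p y) := by
    intro y hy
    filter_upwards [hT.mem_nhds hy] with t ht using hin ht
  have hgs : ContDiff ℝ ∞ θ' := by
    rw [contDiff_iff_contDiffAt]
    intro y
    by_cases hy : y ∈ tgt n p
    · exact (hθ.contDiffAt hy).congr_of_eventuallyEq (hev hy)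
    · exact contDiffAt_const.congr_of_eventuallyEq
        (notMem_tsupport_iff_eventuallyEq.1 fun h => hy (hts h))
  have h0 : ∀ x ∉ src n p, θ x = 0 := fun x hx => image_eq_zero_of_notMem_tsupport fun h => hx (hs h)
  rw [A.integral_riemVolume (f := fun x => θ x * A.density.lap B u x)
      (hθ.continuous.mul (A.density.smoothFn_lap B hu).continuous)
      (p := p) (fun x hx => by rw [h0 x hx, zero_mul]),
    A.integral_riemVolume (B.smoothFn_pair hθ hu).continuous (p := p) fun x hx =>
      image_eq_zero_of_notMem_tsupport fun h => hx (hs (B.tsupport_pair_subset θ u h))]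
  have key := integral_mul_divOp hT (A.density.smooth p) (fun y hy => (A.density.pos p y hy).ne')
    (B.smooth p) (hu p) hgs hc' hts
  have k1 := setIntegral_eq_integral_of_forall_compl_eq_zero (μ := volume) (s := tgt n p)
    (f := fun y => θ' y * (A.density.μ p y * divOp (fr n) (A.density.μ p) (B.q p)
      (fun y => u (par n p y)) y)) fun y hy => by
        rw [image_eq_zero_of_notMem_tsupport fun h => hy (hts h), zero_mul]
  have k2 := setIntegral_eq_integral_of_forall_compl_eq_zero (μ := volume) (s := tgt n p)
    (f := fun y => A.density.μ p y * ∑ i, ∑ j, B.q p y i j * pderiv (fr n) i θ' y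
      * pderiv (fr n) j (fun y => u (par n p y)) y) fun y hy => by
        refine mul_eq_zero_of_right _
          (Finset.sum_eq_zero fun i _ => Finset.sum_eq_zero fun j _ => ?_)
        rw [image_eq_zero_of_notMem_tsupport (f := pderiv (fr n) i θ')
          fun h => hy (hts (tsupport_pderiv_subset i h))]
        ring
  rw [← k1, ← k2] at key
  convert key using 1
  · refine setIntegral_congr_fun hT.measurableSet fun y hy => ?_
    rw [A.density.lap_par B hu hy, hin hy]
    change A.dens p 0 y * _ = _ * (A.dens p 0 y * _)
    ring
  · congr 1
    refine setIntegral_congr_fun hT.measurableSet fun y hy => ?_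
    rw [B.pair_par hθ hu hy]
    refine congrArg _ (Finset.sum_congr rfl fun i _ => Finset.sum_congr rfl fun j _ => ?_)
    rw [pderiv_congr (hev hy)]

variable [SecondCountableTopology X]

/-- Both sides are linear in `θ`, so only `θ` is cut up by a partition of unity; finitely many
pieces meet its compact support, and each lies in one chart. -/
lemma integral_mul_lap {θ u : X → ℝ} (hθ : SmoothFn n θ)
    (hc : HasCompactSupport θ) (hu : SmoothFn n u) :
    ∫ x, θ x * A.density.lap B u x ∂A.riemVolume = -∫ x, B.pair θ u x ∂A.riemVolume := by
  have : LocallyCompactSpace X := ChartedSpace.locallyCompactSpace (EuclideanSpace ℝ (Fin n)) X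
  obtain ⟨f, hf⟩ := SmoothPartitionOfUnity.exists_isSubordinate_chartAt_source (𝓡 n) X
  have hfin := f.locallyFinite.finite_nonempty_inter_compact hc
  set s := hfin.toFinset with hs
  have hsum : θ = fun x => ∑ i ∈ s, f i x * θ x := by
    funext x
    by_cases hx : x ∈ tsupport θ
    · have h1 := f.sum_eq_one (Set.mem_univ x)
      rw [finsum_eq_sum_of_support_subset (s := s)] at h1
      · rw [← Finset.sum_mul, h1, one_mul]
      · intro i hi
        rw [hs, Set.Finite.coe_toFinset]
        exact ⟨x, hi, hx⟩
    · simp [image_eq_zero_of_notMem_tsupport hx]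
  have hsm : ∀ i, SmoothFn n fun x => f i x * θ x := fun i p =>
    (smoothFn_of_contMDiff (f i).contMDiff p).mul (hθ p)
  have hci : ∀ i, HasCompactSupport fun x => f i x * θ x := fun i => hc.mul_left
  have hloc : ∀ i, ∫ x, f i x * θ x * A.density.lap B u x ∂A.riemVolume
      = -∫ x, B.pair (fun x => f i x * θ x) u x ∂A.riemVolume := fun i =>
    A.integral_mul_lap_of_tsupport_subset B (hsm i) (hci i) (p := i)
      ((tsupport_mul_subset_left (f := f i) (g := θ)).trans
        ((hf i).trans_eq (by simp [src]))) hu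
  have e1 : ∫ x, θ x * A.density.lap B u x ∂A.riemVolume
      = ∑ i ∈ s, ∫ x, f i x * θ x * A.density.lap B u x ∂A.riemVolume := by
    rw [← integral_finsetSum _ fun i _ => ?_]
    · refine integral_congr_ae (ae_of_all _ fun x => ?_)
      simp only
      rw [← Finset.sum_mul, ← congrFun hsum x]
    · exact ((hsm i).continuous.mul
        (A.density.smoothFn_lap B hu).continuous).integrable_of_hasCompactSupport
        (hci i).mul_right
  have e2 : ∫ x, B.pair θ u x ∂A.riemVolume
      = ∑ i ∈ s, ∫ x, B.pair (fun x => f i x * θ x) u x ∂A.riemVolume := by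
    rw [← integral_finsetSum _ fun i _ => ?_]
    · refine integral_congr_ae (ae_of_all _ fun x => ?_)
      simp only
      rw [← B.pair_sum s (fun i _ => hsm i), ← hsum]
    · exact (B.smoothFn_pair (hsm i) hu).continuous.integrable_of_hasCompactSupport
        ((hci i).mono' ((subset_tsupport _).trans (B.tsupport_pair_subset _ u)))
  rw [e1, e2, Finset.sum_congr rfl fun i _ => hloc i, Finset.sum_neg_distrib]

lemma integral_mul_lap_comm {u v : X → ℝ} (hu : SmoothFn n u) (hv : SmoothFn n v)
    (hcu : HasCompactSupport u) (hcv : HasCompactSupport v) :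
    ∫ x, u x * A.density.lap B v x ∂A.riemVolume
      = ∫ x, v x * A.density.lap B u x ∂A.riemVolume := by
  rw [A.integral_mul_lap B hu hcu hv, A.integral_mul_lap B hv hcv hu, B.pair_comm]

end Ambient

/-! ### Adjoints of words in symmetric operators. -/

section Adjoint

open MulOpposite

variable {V : Type*} [AddCommGroup V] [Module ℝ V]

/-- Moving symmetric operators across the form one by one reverses their order; the reversed word is
the same word formed in the opposite ring. -/
lemma bilin_wordCoeff (b : V →ₗ[ℝ] V →ₗ[ℝ] ℝ) {x : ℕ → Module.End ℝ V}
    (hx : ∀ i u v, b u (x i v) = b (x i u) v) (L : ℝ) (k m : ℕ) (u v : V) :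
    b u (wordCoeff x L k m v) = b (unop (wordCoeff (fun i => op (x i)) L k m) u) v := by
  induction k generalizing m u with
  | zero =>
    rw [wordCoeff_zero, wordCoeff_zero]
    by_cases hm : m = 0
    · subst hm; simp
    · simp [hm]
  | succ k ih =>
    simp only [wordCoeff_succ, unop_add, unop_smul, Finset.unop_sum, unop_mul, unop_op,
      LinearMap.add_apply, LinearMap.smul_apply, LinearMap.sum_apply, map_add, map_smul, map_sum,
      Module.End.mul_apply, ih, hx]

lemma bilin_wordCoeff_self (b : V →ₗ[ℝ] V →ₗ[ℝ] ℝ) {x : ℕ → Module.End ℝ V}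
    (hx : ∀ i u v, b u (x i v) = b (x i u) v) (k : ℕ) (u v : V) :
    b u (wordCoeff x k k 0 v) = b (wordCoeff x k k 0 u) v := by
  rw [bilin_wordCoeff b hx, wordCoeff_op, unop_op]

/-- Definiteness of the form turns symmetry of the word into an identity of operators, to which the
algebra of principal parts applies. -/
lemma wordCoeff_eq_reverse (b : V →ₗ[ℝ] V →ₗ[ℝ] ℝ) (hb : ∀ u, b u u = 0 → u = 0)
    {x : ℕ → Module.End ℝ V} (hx : ∀ i u v, b u (x i v) = b (x i u) v) (L : ℝ) (k m : ℕ)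
    (h : ∀ u v, b u (wordCoeff x L k m v) = b (wordCoeff x L k m u) v) :
    wordCoeff x L k m - unop (wordCoeff (fun i => op (x i)) L k m) = 0 := by
  ext u
  refine hb _ ?_
  rw [LinearMap.sub_apply, LinearMap.map_sub₂, ← h, ← bilin_wordCoeff b hx, sub_self]

end Adjoint

/-! ### The `L²` pairing on compactly supported functions and formal self-adjointness. -/

namespace Ambient

section CompactSupport

variable {n : ℕ} {X : Type} [TopologicalSpace X] [ChartedSpace (EuclideanSpace ℝ (Fin n)) X]
  [IsManifold (𝓡 n) ∞ X] (A : Ambient n X)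

variable (n X) in
/-- The space of compactly supported smooth functions on `X`. -/
def _root_.AmbientGJMS.compSub : Submodule ℝ (X → ℝ) where
  carrier := {u | SmoothFn n u ∧ HasCompactSupport u}
  add_mem' hu hv := ⟨(smoothSub n X).add_mem hu.1 hv.1, hu.2.add hv.2⟩
  zero_mem' := ⟨(smoothSub n X).zero_mem, HasCompactSupport.zero⟩
  smul_mem' c _ hu := ⟨(smoothSub n X).smul_mem c hu.1, hu.2.mono (Function.support_const_smul_subset c _)⟩

variable (n X) in
/-- The inclusion of the compactly supported smooth functions. -/
def _root_.AmbientGJMS.compIncl : compSub n X →ₗ[ℝ] smoothSub n X :=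
  Submodule.inclusion fun _ hu => hu.1

/-- The coefficients of `ℳ(ρ)`, acting on compactly supported functions. -/
def coefMc (i : ℕ) : Module.End ℝ (compSub n X) :=
  LinearMap.codRestrict (compSub n X)
    ((smoothSub n X).subtype ∘ₗ A.coefM i ∘ₗ compIncl n X) fun u =>
      ⟨(A.coefM i (compIncl n X u)).2, HasCompactSupport.add
        (u.2.2.mono' ((subset_tsupport _).trans (A.density.tsupport_lap_subset (A.bivCoef i) u.1)))
        u.2.2.mul_left⟩

lemma coefMc_apply (i : ℕ) (u : compSub n X) (x : X) : (A.coefMc i u).1 x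
    = A.density.lap (A.bivCoef i) u.1 x + tcoef i (A.pot x) * u.1 x := rfl

lemma compIncl_wordCoeff (L : ℝ) (k m : ℕ) (u : compSub n X) :
    compIncl n X (wordCoeff A.coefMc L k m u) = wordCoeff A.coefM L k m (compIncl n X u) := by
  rw [← formalD_single, ← formalD_single,
    map_formalD (y := A.coefM) (compIncl n X) (fun i v => rfl)]
  refine congrFun (congrArg _ (funext fun i => ?_)) m
  by_cases hi : i = 0
  · subst hi; simp
  · simp [hi]

lemma DP_comp {M N : ℕ} (hNM : N ≤ M) (L : ℝ) (u : compSub n X) :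
    A.DP M N L u.1 = (∏ i ∈ Finset.range N, 2 * ((M : ℝ) - i) * (L - M - i)) •
      (wordCoeff A.coefMc (L - 2 * N) (M - N) 0 u).1 := by
  have h := A.DP_eq_wordCoeff hNM L (compIncl n X u)
  rw [← compIncl_wordCoeff] at h
  exact h

end CompactSupport

section SelfAdjoint

variable {n : ℕ} {X : Type} [TopologicalSpace X] [T2Space X] [SecondCountableTopology X]
  [ChartedSpace (EuclideanSpace ℝ (Fin n)) X]
  [IsManifold (𝓡 n) ∞ X] [MeasurableSpace X] [BorelSpace X] (A : Ambient n X)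

lemma _root_.AmbientGJMS.compSub_integrable (u v : compSub n X) :
    Integrable (fun x => u.1 x * v.1 x) A.riemVolume :=
  (u.2.1.continuous.mul v.2.1.continuous).integrable_of_hasCompactSupport u.2.2.mul_right

/-- The `L²` inner product on compactly supported smooth functions. -/
def l2form : compSub n X →ₗ[ℝ] compSub n X →ₗ[ℝ] ℝ :=
  LinearMap.mk₂ ℝ (fun u v => ∫ x, u.1 x * v.1 x ∂A.riemVolume)
    (fun u u' v => by
      rw [← integral_add (compSub_integrable A u v) (compSub_integrable A u' v)]
      simp [add_mul])
    (fun c u v => by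
      rw [smul_eq_mul, ← integral_const_mul]
      simp [mul_assoc])
    (fun u v v' => by
      rw [← integral_add (compSub_integrable A u v) (compSub_integrable A u v')]
      simp [mul_add])
    (fun c u v => by
      rw [smul_eq_mul, ← integral_const_mul]
      simp [mul_left_comm])

lemma l2form_apply (u v : compSub n X) :
    A.l2form u v = ∫ x, u.1 x * v.1 x ∂A.riemVolume := rfl

lemma l2form_comm (u v : compSub n X) : A.l2form u v = A.l2form v u := by
  simp only [l2form_apply, mul_comm]

lemma l2form_definite (u : compSub n X) (h : A.l2form u u = 0) : u = 0 := by
  ext x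
  have hT := isOpen_tgt (n := n) x
  have hx : crd n x x ∈ tgt n x := crd_mem x (mem_src_self x)
  have hu := u.2.1.continuous
  rw [l2form_apply] at h
  have h1 : ∀ᵐ z ∂A.riemVolume, u.1 z = 0 := by
    have h2 := (integral_eq_zero_iff_of_nonneg (fun x => mul_self_nonneg (u.1 x))
      (compSub_integrable A u u)).1 h
    filter_upwards [h2] with z hz using mul_self_eq_zero.1 hz
  have h2 := ae_restrict_of_ae (s := src n x) h1
  rw [A.riemVolume_restrict_src] at h2
  have h3 := (ae_withDensity_iff' (A.aemeasurable_density x)).1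
    (ae_of_ae_map (A.aemeasurable_par x) h2)
  have h4 : (fun y => u.1 (par n x y)) =ᵐ[volume.restrict (tgt n x)] fun _ => 0 := by
    filter_upwards [h3, ae_restrict_mem hT.measurableSet] with y hy hyT
    refine hy (ENNReal.ofReal_pos.2 ?_).ne'
    rw [A.density_eq hyT]
    exact A.dens_pos hyT A.zero_mem_J
  have h5 := Measure.eqOn_open_of_ae_eq h4 hT (hu.comp_continuousOn (continuousOn_par x))
    continuousOn_const hx
  simpa [par_crd x (mem_src_self x)] using h5

/-- Integration by parts handles the divergence part through a symmetric pairing of differentials,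
and the potential is a multiplication operator. -/
lemma l2form_coefMc (i : ℕ) (u v : compSub n X) :
    A.l2form u (A.coefMc i v) = A.l2form (A.coefMc i u) v := by
  have key : ∀ u v : compSub n X, A.l2form u (A.coefMc i v)
      = (∫ x, u.1 x * A.density.lap (A.bivCoef i) v.1 x ∂A.riemVolume)
        + ∫ x, u.1 x * (tcoef i (A.pot x) * v.1 x) ∂A.riemVolume := by
    intro u v
    rw [l2form_apply, ← integral_add]
    · simp only [coefMc_apply, mul_add]
    · exact (u.2.1.continuous.mul (A.density.smoothFn_lap _
        v.2.1).continuous).integrable_of_hasCompactSupport u.2.2.mul_right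
    · exact (u.2.1.continuous.mul ((A.smoothFam_pot.coef i).continuous.mul
        v.2.1.continuous)).integrable_of_hasCompactSupport u.2.2.mul_right
  rw [A.l2form_comm _ v, key, key, A.integral_mul_lap_comm _ u.2.1 v.2.1 u.2.2 v.2.2]
  congr 2
  funext x
  ring

lemma formallySelfAdjointOn_iff (T : (X → ℝ) → X → ℝ) (c : ℝ) (S : Module.End ℝ (compSub n X))
    (hT : ∀ u : compSub n X, T u.1 = c • (S u).1) :
    A.FormallySelfAdjointOn T ↔ ∀ u v, c * A.l2form u (S v) = c * A.l2form (S u) v := by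
  have key : ∀ u v : compSub n X,
      ∫ x, u.1 x * T v.1 x ∂A.riemVolume = c * A.l2form u (S v) := by
    intro u v
    rw [l2form_apply, ← integral_const_mul, hT]
    refine integral_congr_ae (ae_of_all _ fun x => ?_)
    simp only [Pi.smul_apply, smul_eq_mul]
    ring
  constructor
  · intro h u v
    rw [← key, A.l2form_comm (S u), ← key]
    exact h u.1 v.1 (contMDiff_of_smoothFn u.2.1) (contMDiff_of_smoothFn v.2.1) u.2.2 v.2.2
  · intro h u v hu hv hcu hcv
    have := h ⟨u, smoothFn_of_contMDiff hu, hcu⟩ ⟨v, smoothFn_of_contMDiff hv, hcv⟩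
    rw [← key, A.l2form_comm (S _), ← key] at this
    exact this

lemma DP_formallySelfAdjointOn {M N : ℕ} (hNM : N ≤ M) :
    A.FormallySelfAdjointOn (A.DP M N (M + N)) := by
  refine (A.formallySelfAdjointOn_iff _ _ _ (A.DP_comp hNM _)).2 fun u v => ?_
  rw [show (M : ℝ) + N - 2 * N = ((M - N : ℕ) : ℝ) by rw [Nat.cast_sub hNM]; ring,
    bilin_wordCoeff_self A.l2form A.l2form_coefMc]

lemma wordCoeff_eq_reverse_of_formallySelfAdjointOn {M N : ℕ} (hNM : N ≤ M) {L : ℝ}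
    (hL : ∀ j < N, L ≠ (M : ℝ) + j) (h : A.FormallySelfAdjointOn (A.DP M N L)) :
    wordCoeff A.coefMc (L - 2 * N) (M - N) 0 - MulOpposite.unop
      (wordCoeff (fun i => MulOpposite.op (A.coefMc i)) (L - 2 * N) (M - N) 0) = 0 := by
  have hc : ∏ i ∈ Finset.range N, 2 * ((M : ℝ) - i) * (L - M - i) ≠ 0 := by
    refine Finset.prod_ne_zero_iff.2 fun i hi => ?_
    have h1 : i < N := Finset.mem_range.1 hi
    have h2 : (i : ℝ) < M := by exact_mod_cast h1.trans_le hNM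
    refine mul_ne_zero (mul_ne_zero two_ne_zero (by linarith)) fun h => hL i h1 (by linarith)
  exact wordCoeff_eq_reverse A.l2form A.l2form_definite A.l2form_coefMc _ _ _ fun u v =>
    mul_left_cancel₀ hc ((A.formallySelfAdjointOn_iff _ _ _ (A.DP_comp hNM _)).1 h u v)

end SelfAdjoint

end Ambient

/-! ### Flat metrics -/

section Flat

variable {V ι : Type} [NormedAddCommGroup V] [NormedSpace ℝ V] {b : ι → V}

lemma pderiv_comm {f : V → ℝ} {y : V} (hf : ContDiffAt ℝ ∞ f y) (i j : ι) :
    pderiv b i (pderiv b j f) y = pderiv b j (pderiv b i f) y := by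
  have h1 : DifferentiableAt ℝ (fderiv ℝ f) y :=
    (hf.fderiv_right (m := ∞) (by simp)).differentiableAt (by simp)
  have h2 : ∀ i j, pderiv b i (pderiv b j f) y = fderiv ℝ (fderiv ℝ f) y (b i) (b j) := by
    intro i j
    rw [pderiv]
    have : pderiv b j f = fun y => fderiv ℝ f y (b j) := rfl
    rw [this, fderiv_clm_apply h1 (differentiableAt_const _)]
    simp
  rw [h2, h2]
  have h3 : ∀ m : ℕ, (m : WithTop ℕ∞) ≤ ∞ := fun m => by exact_mod_cast le_top
  exact (hf.isSymmSndFDerivAt (by simpa using h3 2)).eq _ _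

variable [Fintype ι] [DecidableEq ι] {Ψ : ι → V → ℝ} {E : Matrix ι ι ℝ} {G : V → Matrix ι ι ℝ}

lemma gram_eq {y : V} (hG : ∀ i j,
      G y i j = ∑ a, ∑ c, E a c * pderiv b i (Ψ a) y * pderiv b j (Ψ c) y) :
    G y = (Matrix.of fun a k => pderiv b k (Ψ a) y : Matrix ι ι ℝ).transpose * E
      * (Matrix.of fun a k => pderiv b k (Ψ a) y : Matrix ι ι ℝ) := by
  ext i j
  rw [hG i j]
  simp only [Matrix.mul_apply, Matrix.transpose_apply, Matrix.of_apply, Finset.sum_mul]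
  rw [Finset.sum_comm]
  refine Finset.sum_congr rfl fun c _ => Finset.sum_congr rfl fun a _ => ?_
  ring

/-- For a metric induced by `Ψ` from a constant one, the second derivatives of `Ψ` are expressed by
the Christoffel symbols. -/
lemma sum_pderiv_mul_christoffel {y : V} (hE : ∀ a c, E a c = E c a)
    (hΨ : ∀ a, ContDiffAt ℝ ∞ (Ψ a) y)
    (hG : ∀ᶠ z in 𝓝 y, ∀ i j,
      G z i j = ∑ a, ∑ c, E a c * pderiv b i (Ψ a) z * pderiv b j (Ψ c) z)
    (hdet : (G y).det ≠ 0) (a i j : ι) :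
    ∑ k, pderiv b k (Ψ a) y * christoffel b G k i j y = pderiv b i (pderiv b j (Ψ a)) y := by
  set P : ι → ι → ℝ := fun i a => pderiv b i (Ψ a) y with hP
  set D : ι → ι → ι → ℝ := fun i j a => pderiv b i (pderiv b j (Ψ a)) y with hD
  have hDs : ∀ i j, D i j = D j i := fun i j => funext fun a => pderiv_comm (hΨ a) i j
  set e : (ι → ℝ) → (ι → ℝ) → ℝ := fun x x' => ∑ a, ∑ c, E a c * x a * x' c with he
  have hes : ∀ x x', e x x' = e x' x := by
    intro x x'
    simp only [he]
    rw [Finset.sum_comm]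
    refine Finset.sum_congr rfl fun c _ => Finset.sum_congr rfl fun a _ => ?_
    rw [hE a c]
    ring
  have hd : ∀ i a, DifferentiableAt ℝ (pderiv b i (Ψ a)) y := fun i a =>
    (contDiffAt_pderiv (hΨ a) i).differentiableAt (by simp)
  have hdG : ∀ m i j, pderiv b m (fun z => G z i j) y = e (D m i) (P j) + e (P i) (D m j) := by
    intro m i j
    have h1 : (fun z => G z i j) =ᶠ[𝓝 y] fun z => ∑ a, ∑ c, E a c * pderiv b i (Ψ a) z
        * pderiv b j (Ψ c) z := by
      filter_upwards [hG] with z hz using hz i j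
    rw [pderiv_congr h1, pderiv_sum (f := fun a z => ∑ c, E a c * pderiv b i (Ψ a) z
      * pderiv b j (Ψ c) z) _ fun a _ => DifferentiableAt.fun_sum fun c _ =>
        ((hd i a).const_mul _).mul (hd j c)]
    simp only [he]
    rw [← Finset.sum_add_distrib]
    refine Finset.sum_congr rfl fun a _ => ?_
    rw [pderiv_sum (f := fun c z => E a c * pderiv b i (Ψ a) z * pderiv b j (Ψ c) z) _
      fun c _ => ((hd i a).const_mul _).mul (hd j c), ← Finset.sum_add_distrib]
    refine Finset.sum_congr rfl fun c _ => ?_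
    rw [pderiv_mul ((hd i a).const_mul _) (hd j c), pderiv_const_mul _ (hd i a)]
  -- In the combination of derivatives of `G`, all terms cancel except twice the product of `∂_i ∂_j
  -- Ψ` with `∂_l Ψ`.
  have hΓ : ∀ k, christoffel b G k i j y = ∑ l, (G y)⁻¹ k l * e (D i j) (P l) := by
    intro k
    rw [christoffel, Finset.mul_sum]
    refine Finset.sum_congr rfl fun l _ => ?_
    rw [hdG, hdG, hdG, hDs j i, hes (P j), hes (P i) (D j l), hDs l i, hDs l j,
      hes (P i) (D j l)]
    ring
  set B : Matrix ι ι ℝ := Matrix.of fun a k => P k a with hB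
  have hGB : G y = B.transpose * E * B := gram_eq hG.self_of_nhds
  -- As `G = Bᵀ E B` is invertible, `G⁻¹ Bᵀ E` is a left inverse of the square matrix `B`, hence
  -- also a right inverse.
  have hinv : B * ((G y)⁻¹ * B.transpose * E) = 1 := by
    rw [mul_eq_one_comm, Matrix.mul_assoc, Matrix.mul_assoc, ← Matrix.mul_assoc B.transpose,
      ← hGB]
    exact Matrix.nonsing_inv_mul _ (isUnit_iff_ne_zero.2 hdet)
  have hv : (fun k => christoffel b G k i j y)
      = ((G y)⁻¹ * B.transpose * E).mulVec (D i j) := by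
    funext k
    rw [hΓ, Matrix.mul_assoc, ← Matrix.mulVec_mulVec, ← Matrix.mulVec_mulVec]
    simp only [Matrix.mulVec, dotProduct, he]
    refine Finset.sum_congr rfl fun l _ => ?_
    congr 1
    rw [Finset.sum_comm]
    refine Finset.sum_congr rfl fun c _ => ?_
    rw [Finset.mul_sum]
    refine Finset.sum_congr rfl fun a _ => ?_
    rw [hE a c]
    simp only [Matrix.transpose_apply, hB, Matrix.of_apply]
    ring
  have := congrFun (congrArg B.mulVec hv) a
  rw [Matrix.mulVec_mulVec, hinv, Matrix.one_mulVec] at this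
  exact this

lemma contDiffAt_christoffel {y : V} (hG : ∀ i j, ContDiffAt ℝ ∞ (fun z => G z i j) y)
    (hdet : (G y).det ≠ 0) (k i j : ι) : ContDiffAt ℝ ∞ (christoffel b G k i j) y := by
  have hinv : ∀ k l, ContDiffAt ℝ ∞ (fun z => (G z)⁻¹ k l) y := by
    intro k l
    have h1 : ∀ z, (G z)⁻¹ k l = (G z).det⁻¹ * ((G z).updateRow l (Pi.single k 1)).det := by
      intro z
      rw [Matrix.inv_def, Ring.inverse_eq_inv', Matrix.smul_apply, Matrix.adjugate_apply,
        smul_eq_mul]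
    have hd : ∀ {M : V → Matrix ι ι ℝ}, (∀ i j, ContDiffAt ℝ ∞ (fun z => M z i j) y) →
        ContDiffAt ℝ ∞ (fun z => (M z).det) y := by
      intro M hM
      simp only [Matrix.det_apply']
      exact ContDiffAt.sum fun σ _ => contDiffAt_const.mul (contDiffAt_prod fun i _ => hM _ _)
    simp only [h1]
    refine ((hd hG).inv hdet).mul (hd fun i j => ?_)
    by_cases h : i = l
    · subst h
      simp only [Matrix.updateRow_self]
      exact contDiffAt_const
    · simp only [Matrix.updateRow_ne h]
      exact hG i j
  exact contDiffAt_const.mul (ContDiffAt.sum fun l _ => (hinv k l).mul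
    (((contDiffAt_pderiv (hG j l) i).add (contDiffAt_pderiv (hG i l) j)).sub
      (contDiffAt_pderiv (hG i j) l)))

/-- A metric induced from a constant one by an immersion between spaces of equal dimension is
Ricci flat. -/
lemma ricci_eq_zero {y : V} (hE : ∀ a c, E a c = E c a) (hΨe : ∀ᶠ z in 𝓝 y, ∀ a, ContDiffAt ℝ ∞ (Ψ a) z)
    (hG : ∀ᶠ z in 𝓝 y, ∀ i j,
      G z i j = ∑ a, ∑ c, E a c * pderiv b i (Ψ a) z * pderiv b j (Ψ c) z)
    (hdet : (G y).det ≠ 0) (i j : ι) : ricci b G i j y = 0 := by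
  have hΨ := hΨe.self_of_nhds
  have hGs : ∀ i j, ContDiffAt ℝ ∞ (fun z => G z i j) y := by
    intro i j
    have h1 : (fun z => G z i j) =ᶠ[𝓝 y] fun z => ∑ a, ∑ c, E a c * pderiv b i (Ψ a) z
        * pderiv b j (Ψ c) z := by
      filter_upwards [hG] with z hz using hz i j
    exact (ContDiffAt.sum fun a _ => ContDiffAt.sum fun c _ => (contDiffAt_const.mul
      (contDiffAt_pderiv (hΨ a) i)).mul (contDiffAt_pderiv (hΨ c) j)).congr_of_eventuallyEq h1
  have hdetc : ContDiffAt ℝ ∞ (fun z => (G z).det) y := by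
    simp only [Matrix.det_apply']
    exact ContDiffAt.sum fun σ _ => contDiffAt_const.mul (contDiffAt_prod fun i _ => hGs _ _)
  have hΓe : ∀ a i j, (fun z => ∑ k, pderiv b k (Ψ a) z * christoffel b G k i j z) =ᶠ[𝓝 y]
      pderiv b i (pderiv b j (Ψ a)) := by
    intro a i j
    filter_upwards [hΨe, hG.eventually_nhds, hdetc.continuousAt.eventually_ne hdet]
      with z h1 h2 h3 using sum_pderiv_mul_christoffel hE h1 h2 h3 a i j
  have hdΓ : ∀ k i j, DifferentiableAt ℝ (christoffel b G k i j) y := fun k i j =>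
    (contDiffAt_christoffel hGs hdet k i j).differentiableAt (by simp)
  have hd : ∀ i a, DifferentiableAt ℝ (pderiv b i (Ψ a)) y := fun i a =>
    (contDiffAt_pderiv (hΨ a) i).differentiableAt (by simp)
  have hdd : ∀ a m i j, ∑ k, (pderiv b k (Ψ a) y * pderiv b m (christoffel b G k i j) y
      + christoffel b G k i j y * ∑ l, pderiv b l (Ψ a) y * christoffel b G l m k y)
      = pderiv b m (pderiv b i (pderiv b j (Ψ a))) y := by
    intro a m i j
    rw [← pderiv_congr (hΓe a i j) m, pderiv_sum (f := fun k z => pderiv b k (Ψ a) z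
      * christoffel b G k i j z) _ fun k _ => (hd k a).mul (hdΓ k i j)]
    refine Finset.sum_congr rfl fun k _ => ?_
    rw [pderiv_mul (hd k a) (hdΓ k i j), sum_pderiv_mul_christoffel hE hΨ hG hdet]
    ring
  have hsymm : ∀ a m i j, pderiv b m (pderiv b i (pderiv b j (Ψ a))) y
      = pderiv b j (pderiv b i (pderiv b m (Ψ a))) y := by
    intro a m i j
    have h1 : ∀ i j, pderiv b i (pderiv b j (Ψ a)) =ᶠ[𝓝 y] pderiv b j (pderiv b i (Ψ a)) := by
      intro i j
      filter_upwards [hΨe] with z hz using pderiv_comm (hz a) i j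
    rw [pderiv_congr (h1 i j), pderiv_congr (h1 i m), pderiv_comm (contDiffAt_pderiv (hΨ a) i)]
  -- the curvature tensor
  set K : ι → ι → ι → ι → ℝ := fun l m i j => pderiv b m (christoffel b G l i j) y
    - pderiv b j (christoffel b G l i m) y + ∑ k, (christoffel b G l m k y * christoffel b G k i j y
      - christoffel b G l j k y * christoffel b G k i m y) with hK
  -- Differentiating `∂_i ∂_j Ψ = Γ^k_{ij} ∂_k Ψ` and exchanging `m` with `j` in the third
  -- derivatives shows that the differential of `Ψ` annihilates the curvature.
  have hzero : ∀ m i j a, ∑ l, pderiv b l (Ψ a) y * K l m i j = 0 := by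
    intro m i j a
    have h1 := hdd a m i j
    rw [hsymm, ← hdd a j i m] at h1
    have h2 : ∀ m i j, ∑ k, (pderiv b k (Ψ a) y * pderiv b m (christoffel b G k i j) y
      + christoffel b G k i j y * ∑ l, pderiv b l (Ψ a) y * christoffel b G l m k y)
      = ∑ l, pderiv b l (Ψ a) y * (pderiv b m (christoffel b G l i j) y
        + ∑ k, christoffel b G l m k y * christoffel b G k i j y) := by
      intro m i j
      simp only [mul_add, Finset.sum_add_distrib, Finset.mul_sum]
      congr 1
      rw [Finset.sum_comm]
      refine Finset.sum_congr rfl fun l _ => Finset.sum_congr rfl fun k _ => ?_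
      ring
    rw [h2, h2, ← sub_eq_zero, ← Finset.sum_sub_distrib] at h1
    rw [← h1]
    refine Finset.sum_congr rfl fun l _ => ?_
    simp only [hK, Finset.sum_sub_distrib]
    ring
  have hB : IsUnit (Matrix.of fun a k => pderiv b k (Ψ a) y : Matrix ι ι ℝ) := by
    rw [Matrix.isUnit_iff_isUnit_det, isUnit_iff_ne_zero]
    intro h
    refine hdet ?_
    rw [gram_eq hG.self_of_nhds, Matrix.det_mul, h, mul_zero]
  have hK0 : ∀ l m i j, K l m i j = 0 := by
    intro l m i j
    have h1 : (Matrix.of fun a k => pderiv b k (Ψ a) y : Matrix ι ι ℝ).mulVec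
        (fun l => K l m i j) = 0 := funext fun a => hzero m i j a
    have h2 := Matrix.mulVec_injective_of_isUnit hB (h1.trans (Matrix.mulVec_zero _).symm)
    exact congrFun h2 l
  have h : ricci b G i j y = ∑ k, K k k i j := by
    simp only [ricci, hK, Finset.sum_add_distrib]
  rw [h, Finset.sum_eq_zero fun k _ => hK0 k k i j]

end Flat

/-! ### A conformally flat example -/

section Euclidean

variable {n : ℕ}

lemma extChartAt_eu (p : Eu n) : extChartAt (𝓡 n) p = PartialEquiv.refl (Eu n) :=
  extChartAt_model_space_eq_id ℝ p

lemma par_eu (p : Eu n) : par n p = id := by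
  simp only [par, extChartAt_eu, PartialEquiv.refl_symm, PartialEquiv.refl_coe]

lemma crd_eu (p : Eu n) : crd n p = id := by
  simp only [crd, extChartAt_eu, PartialEquiv.refl_coe]

lemma tgt_eu (p : Eu n) : tgt n p = Set.univ := by
  simp only [tgt, extChartAt_eu, PartialEquiv.refl_target]

lemma dpar_eu (p y v : Eu n) : dpar n p y v = v := by
  have h : dpar n p y = fderiv ℝ (par n p) y := mfderiv_eq_fderiv
  rw [h, par_eu, fderiv_id]
  rfl

/-- The form `∑ dₖ dxₖ²` on the model space. -/
def diagForm (d : Fin n → ℝ) : Eu n →L[ℝ] Eu n →L[ℝ] ℝ :=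
  ∑ k, d k • (EuclideanSpace.proj k : Eu n →L[ℝ] ℝ).smulRight (EuclideanSpace.proj k : Eu n →L[ℝ] ℝ)

lemma diagForm_apply (d : Fin n → ℝ) (v w : Eu n) : diagForm d v w = ∑ k, d k * (v k * w k) := by
  simp [diagForm, _root_.sum_apply]

/-- The family of diagonal metrics with coefficients `d`. -/
def diagFamily (d : ℝ → Eu n → Fin n → ℝ) : FormFamily n (Eu n) := fun ρ x => diagForm (d ρ x)

lemma chartGram_diagFamily (d : ℝ → Eu n → Fin n → ℝ) (p : Eu n) (ρ : ℝ) (y : Eu n) :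
    chartGram (diagFamily d) p ρ y = Matrix.diagonal (d ρ y) := by
  ext i j
  have h1 : bil (diagFamily d) ρ (par n p y) = diagForm (d ρ y) := by rw [par_eu]; rfl
  rw [chartGram_apply, h1, dpar_eu, dpar_eu, diagForm_apply]
  by_cases h : i = j
  · subst h
    simp
  · rw [Matrix.diagonal_apply_ne _ h]
    refine Finset.sum_eq_zero fun k _ => ?_
    simp only [PiLp.single_apply]
    by_cases hk : k = i
    · subst hk; simp [h]
    · simp [hk]

end Euclidean

section Example

variable {n : ℕ} (o : Fin n)

/-- The conformal factor. -/
def chi (s : ℝ) : ℝ := 2 + Real.sin s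

lemma chi_pos (s : ℝ) : 0 < chi s := by
  have := Real.neg_one_le_sin s
  unfold chi; linarith

lemma contDiff_chi : ContDiff ℝ ∞ chi := contDiff_const.add Real.contDiff_sin

/-- The coefficient of the metric in the directions transversal to `x₀`. -/
def sig (s ρ : ℝ) : ℝ := (1 - ρ * (Real.cos s ^ 2 / 2)) / chi s

/-- The coefficient of the metric in the direction of `x₀`. -/
def lam (s ρ : ℝ) : ℝ := sig s ρ - ρ * Real.sin s

lemma sig_pos (s : ℝ) {ρ : ℝ} (hρ : ρ ∈ Set.Ioo (-(1 / 4 : ℝ)) (1 / 4)) : 0 < sig s ρ := by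
  refine div_pos ?_ (chi_pos s)
  have h1 := Real.cos_sq_le_one s
  have h2 := sq_nonneg (Real.cos s)
  nlinarith [hρ.1, hρ.2]

/-- In this form the coefficient is `χ⁻¹ (1 + ρ P)`, where `P` is the eigenvalue along `x₀` of `χ
Hess χ - |∇χ|²/2`, the Schouten endomorphism of `χ⁻²|dx|²` for `n ≥ 3`; `sig` is the same with the
transversal eigenvalue. The family is the conformally flat normal form `g (1 + ρ P)²`. -/
lemma lam_eq (s ρ : ℝ) :
    lam s ρ = (1 - ρ * (Real.cos s ^ 2 / 2 + chi s * Real.sin s)) / chi s := by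
  have := (chi_pos s).ne'
  rw [lam, sig]
  field_simp
  ring

lemma lam_pos (s : ℝ) {ρ : ℝ} (hρ : ρ ∈ Set.Ioo (-(1 / 4 : ℝ)) (1 / 4)) : 0 < lam s ρ := by
  rw [lam_eq]
  refine div_pos ?_ (chi_pos s)
  have h1 := Real.sin_sq_add_cos_sq s
  have h2 := Real.neg_one_le_sin s
  have h3 := Real.sin_le_one s
  -- The bound `4` on the coefficient of `ρ` is what makes the radius `1/4` sufficient.
  have h4 : Real.cos s ^ 2 / 2 + chi s * Real.sin s < 4 := by unfold chi; nlinarith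
  have h5 : -4 < Real.cos s ^ 2 / 2 + chi s * Real.sin s := by unfold chi; nlinarith
  obtain ⟨h6, h7⟩ := hρ
  nlinarith

lemma contDiff_sig : ContDiff ℝ ∞ fun q : ℝ × ℝ => sig q.1 q.2 :=
  (contDiff_const.sub (contDiff_snd.mul (((Real.contDiff_cos.comp contDiff_fst).pow 2).div_const 2))).div
    (contDiff_chi.comp contDiff_fst) fun q => (chi_pos q.1).ne'

lemma contDiff_lam : ContDiff ℝ ∞ fun q : ℝ × ℝ => lam q.1 q.2 :=
  contDiff_sig.sub (contDiff_snd.mul (Real.contDiff_sin.comp contDiff_fst))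

/-- The coefficients of the metrics `g_ρ`. -/
def exCoef (ρ : ℝ) (y : Eu n) (k : Fin n) : ℝ := if k = o then lam (y o) ρ ^ 2 else sig (y o) ρ ^ 2

lemma exCoef_pos {ρ : ℝ} (hρ : ρ ∈ Set.Ioo (-(1 / 4 : ℝ)) (1 / 4)) (y : Eu n) (k : Fin n) :
    0 < exCoef o ρ y k := by
  unfold exCoef
  split_ifs
  · exact pow_pos (lam_pos _ hρ) 2
  · exact pow_pos (sig_pos _ hρ) 2

lemma contDiff_exCoef (k : Fin n) : ContDiff ℝ ∞ fun q : Eu n × ℝ => exCoef o q.2 q.1 k := by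
  have hc : ContDiff ℝ ∞ fun q : Eu n × ℝ => (q.1 o, q.2) :=
    ((EuclideanSpace.proj o : Eu n →L[ℝ] ℝ).contDiff.comp contDiff_fst).prodMk contDiff_snd
  unfold exCoef
  split_ifs
  · exact (contDiff_lam.comp hc).pow 2
  · exact (contDiff_sig.comp hc).pow 2

/-! #### The flat coordinates -/

/-- The flat coordinates on the ambient space. -/
def exPsi : AmbIdx n → AmbCoord n → ℝ
  | .inl _, z => z.1 * sig (z.2.1 o) z.2.2
  | .inr (.inl k), z => z.1 * (sig (z.2.1 o) z.2.2 * z.2.1 k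
      + if k = o then z.2.2 * Real.cos (z.2.1 o) else 0)
  | .inr (.inr _), z => z.1 * (-(sig (z.2.1 o) z.2.2 * (∑ k, z.2.1 k ^ 2) / 2)
      - z.2.2 * Real.cos (z.2.1 o) * z.2.1 o + z.2.2 * chi (z.2.1 o))

/-- The flat metric in the flat coordinates. -/
def exEta : Matrix (AmbIdx n) (AmbIdx n) ℝ :=
  Matrix.of fun
    | .inl _, .inr (.inr _) => 1
    | .inr (.inr _), .inl _ => 1
    | .inr (.inl i), .inr (.inl j) => if i = j then 1 else 0
    | _, _ => 0

lemma exEta_symm (a c : AmbIdx n) : exEta a c = exEta c a := by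
  rcases a with _ | i | _ <;> rcases c with _ | j | _ <;> simp [exEta, eq_comm]

lemma contDiff_exPsi (a : AmbIdx n) : ContDiff ℝ ∞ (exPsi o a) := by
  have hy : ∀ k, ContDiff ℝ ∞ fun z : AmbCoord n => z.2.1 k := fun k =>
    (EuclideanSpace.proj k : Eu n →L[ℝ] ℝ).contDiff.comp (contDiff_fst.comp contDiff_snd)
  have hρ : ContDiff ℝ ∞ fun z : AmbCoord n => z.2.2 := contDiff_snd.comp contDiff_snd
  have hs : ContDiff ℝ ∞ fun z : AmbCoord n => sig (z.2.1 o) z.2.2 :=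
    contDiff_sig.comp ((hy o).prodMk hρ)
  have hcos : ContDiff ℝ ∞ fun z : AmbCoord n => Real.cos (z.2.1 o) :=
    Real.contDiff_cos.comp (hy o)
  rcases a with _ | k | _
  · exact contDiff_fst.mul hs
  · change ContDiff ℝ ∞ fun z : AmbCoord n => z.1 * (sig (z.2.1 o) z.2.2 * z.2.1 k
      + if k = o then z.2.2 * Real.cos (z.2.1 o) else 0)
    by_cases h : k = o
    · simp only [h, if_true]
      exact contDiff_fst.mul ((hs.mul (hy o)).add (hρ.mul hcos))
    · simp only [h, if_false]
      exact contDiff_fst.mul ((hs.mul (hy k)).add contDiff_const)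
  · exact contDiff_fst.mul (((((hs.mul (ContDiff.sum fun k _ => (hy k).pow 2)).div_const 2).neg).sub
      ((hρ.mul hcos).mul (hy o))).add (hρ.mul (contDiff_chi.comp (hy o))))

/-- The derivative of `sig` in the direction `(w, r)`. -/
def dsig (s ρ w r : ℝ) : ℝ :=
  -(Real.cos s / chi s) * lam s ρ * w - Real.cos s ^ 2 / 2 / chi s * r

/-- The `s`-derivative of `sig` is `-(χ'/χ) lam`. It is this factor `lam` that makes the mixed
`x₀`–`ρ` component of the induced metric vanish. -/
lemma hasDerivAt_sig {S R : ℝ → ℝ} {w r t : ℝ} (hS : HasDerivAt S w t) (hR : HasDerivAt R r t) :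
    HasDerivAt (fun t => sig (S t) (R t)) (dsig (S t) (R t) w r) t := by
  have h1 : HasDerivAt (fun t => sig (S t) (R t)) _ t :=
    (((hR.mul ((((hS.cos).pow 2).div_const 2))).const_sub 1).div
      ((hS.sin).const_add 2) (chi_pos (S t)).ne')
  refine h1.congr_deriv ?_
  have h2 := (chi_pos (S t)).ne'
  rw [dsig, lam_eq]
  simp only [Pi.mul_apply, Pi.pow_apply]
  field_simp
  ring

/-- A vector with components `α, β, γ` in the null frame at `y`. -/
def nullFrame (y : Eu n) (α : ℝ) (β : Fin n → ℝ) (γ : ℝ) : AmbIdx n → ℝ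
  | .inl _ => α
  | .inr (.inl k) => α * y k + β k
  | .inr (.inr _) => -(α * (∑ k, y k ^ 2) / 2) - (∑ k, β k * y k) + γ

/-- The frame consists of `ξ = (1, y, -|y|²/2)`, its derivatives `∂_k ξ`, and `e = (0, 0, 1)`. Here
`ξ` and `e` are null and pair to `1`, and the `∂_k ξ` are orthonormal and orthogonal to both. -/
lemma exEta_nullFrame (y : Eu n) (α α' γ γ' : ℝ) (β β' : Fin n → ℝ) :
    ∑ a, ∑ c, exEta a c * nullFrame y α β γ a * nullFrame y α' β' γ' c
      = α * γ' + γ * α' + ∑ k, β k * β' k := by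
  simp only [Fintype.sum_sum_type, Finset.univ_unique, Finset.sum_singleton, exEta, nullFrame,
    Matrix.of_apply, zero_mul, Finset.sum_const_zero, zero_add, add_zero, one_mul, ite_mul,
    Finset.sum_ite_eq, Finset.mem_univ, if_true]
  have h : ∑ k, (α * y k + β k) * (α' * y k + β' k) = α * α' * (∑ k, y k ^ 2)
      + α * (∑ k, β' k * y k) + α' * (∑ k, β k * y k) + ∑ k, β k * β' k := by
    simp only [Finset.mul_sum, ← Finset.sum_add_distrib]
    exact Finset.sum_congr rfl fun k _ => by ring
  rw [h]
  ring

/-- The first component of the derivative of `exPsi` in the null frame. -/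
def exA (z v : AmbCoord n) : ℝ :=
  v.1 * sig (z.2.1 o) z.2.2 + z.1 * dsig (z.2.1 o) z.2.2 (v.2.1 o) v.2.2

/-- The middle components of the derivative of `exPsi` in the null frame. -/
def exB (z v : AmbCoord n) (k : Fin n) : ℝ :=
  z.1 * sig (z.2.1 o) z.2.2 * v.2.1 k + if k = o then v.1 * (z.2.2 * Real.cos (z.2.1 o))
    + z.1 * (v.2.2 * Real.cos (z.2.1 o) - z.2.2 * Real.sin (z.2.1 o) * v.2.1 o) else 0

/-- The last component of the derivative of `exPsi` in the null frame. -/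
def exC (z v : AmbCoord n) : ℝ :=
  v.1 * (z.2.2 * chi (z.2.1 o)) + z.1 * (v.2.2 * chi (z.2.1 o))

/-- In the null frame the flat coordinates are `τ (sig ξ + ρ cos(x₀) ∂₀ξ + ρ χ e)`. Since `∂₀∂₀ξ =
-e` and `χ' = cos`, the derivatives along `x₀` cancel in the last component. -/
lemma fderiv_exPsi (z v : AmbCoord n) (a : AmbIdx n) :
    fderiv ℝ (exPsi o a) z v = nullFrame z.2.1 (exA o z v) (exB o z v) (exC o z v) a := by
  have hline : HasDerivAt (fun t : ℝ => exPsi o a (z + t • v)) (fderiv ℝ (exPsi o a) z v) 0 := by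
    have h := ((contDiff_exPsi o a).differentiable (by simp) z).hasFDerivAt.hasLineDerivAt v
    exact h
  have hτ : HasDerivAt (fun t : ℝ => (z + t • v).1) v.1 0 := by
    simpa using ((hasDerivAt_id (0 : ℝ)).mul_const v.1).const_add z.1
  have hy : ∀ k, HasDerivAt (fun t : ℝ => (z + t • v).2.1 k) (v.2.1 k) 0 := fun k => by
    simpa using ((hasDerivAt_id (0 : ℝ)).mul_const (v.2.1 k)).const_add (z.2.1 k)
  have hρ : HasDerivAt (fun t : ℝ => (z + t • v).2.2) v.2.2 0 := by
    simpa using ((hasDerivAt_id (0 : ℝ)).mul_const v.2.2).const_add z.2.2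
  have hs := hasDerivAt_sig (hy o) hρ
  refine hline.unique ?_
  rcases a with _ | k | _
  · refine (hτ.mul hs).congr_deriv ?_
    simp [nullFrame, exA]
  · by_cases hk : k = o
    · refine ((hτ.mul ((hs.mul (hy o)).add (hρ.mul (hy o).cos))).congr_of_eventuallyEq
        (Eventually.of_forall fun t => ?_)).congr_deriv ?_
      · simp only [exPsi, hk, if_true]; rfl
      · simp [nullFrame, exA, exB, hk]
        ring
    · refine ((hτ.mul ((hs.mul (hy k)).add_const 0)).congr_of_eventuallyEq
        (Eventually.of_forall fun t => ?_)).congr_deriv ?_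
      · simp only [exPsi, hk, if_false]; rfl
      · simp [nullFrame, exA, exB, hk]
        ring
  · have h2 : HasDerivAt (fun t : ℝ => ∑ k, (z + t • v).2.1 k ^ 2) _ 0 :=
      HasDerivAt.fun_sum fun k _ => (hy k).pow 2
    have h3 : HasDerivAt (fun t : ℝ => chi ((z + t • v).2.1 o)) _ 0 := (hy o).sin.const_add 2
    refine (hτ.mul ((((hs.mul h2).div_const 2).neg.sub ((hρ.mul (hy o).cos).mul (hy o))).add
      (hρ.mul h3))).congr_deriv ?_
    have h4 : ∑ k, exB o z v k * z.2.1 k = z.1 * sig (z.2.1 o) z.2.2 * (∑ k, v.2.1 k * z.2.1 k)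
        + (v.1 * (z.2.2 * Real.cos (z.2.1 o)) + z.1 * (v.2.2 * Real.cos (z.2.1 o)
          - z.2.2 * Real.sin (z.2.1 o) * v.2.1 o)) * z.2.1 o := by
      simp only [exB, add_mul, Finset.sum_add_distrib, ite_mul, zero_mul, Finset.sum_ite_eq',
        Finset.mem_univ, if_true, Finset.mul_sum]
      congr 1
      exact Finset.sum_congr rfl fun k _ => by ring
    have h5 : ∑ k, 2 * z.2.1 k * v.2.1 k = 2 * ∑ k, v.2.1 k * z.2.1 k := by
      rw [Finset.mul_sum]
      exact Finset.sum_congr rfl fun k _ => by ring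
    simp only [nullFrame, h4]
    simp [exA, exC, h5]
    ring

/-- The ambient metric of the example is induced from the flat one. -/
lemma ambGram_ex (p : Eu n) (z : AmbCoord n) (I J : AmbIdx n) :
    ambGram (diagFamily (exCoef o)) p z I J
      = ∑ a, ∑ c, exEta a c * pderiv (ambFrame n) I (exPsi o a) z
        * pderiv (ambFrame n) J (exPsi o c) z := by
  simp only [pderiv, fderiv_exPsi]
  rw [exEta_nullFrame]
  have hχ := (chi_pos (z.2.1 o)).ne'
  rcases I with _ | i | _ <;> rcases J with _ | j | _
  · simp [ambGram, ambFrame, exA, exB, exC, dsig, sig]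
    field_simp
    ring
  · simp [ambGram, ambFrame, exA, exB, exC, dsig, sig, lam]
    by_cases h : o = j
    · simp [h]
      rw [h] at hχ
      field_simp
      ring
    · simp [h]
  · simp [ambGram, ambFrame, exA, exB, exC, dsig, sig]
    field_simp
    ring
  · simp [ambGram, ambFrame, exA, exB, exC, dsig, sig, lam]
    by_cases h : o = i
    · simp [h]
      rw [h] at hχ
      field_simp
      ring
    · simp [h]
  · have hB : ∀ i k, exB o z (ambFrame n (.inr (.inl i))) k = if k = i then
        z.1 * (if i = o then lam (z.2.1 o) z.2.2 else sig (z.2.1 o) z.2.2) else 0 := by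
      intro i k
      by_cases hk : k = i
      · subst hk
        by_cases ho : k = o
        · subst ho
          simp [exB, ambFrame, lam]
          ring
        · simp [exB, ambFrame, ho]
      · by_cases ho : k = o
        · subst ho
          simp [exB, ambFrame, hk]
        · simp [exB, ambFrame, hk, ho]
    have hC : ∀ i, exC o z (ambFrame n (.inr (.inl i))) = 0 := fun i => by simp [exC, ambFrame]
    simp only [hB, hC, ambGram, Matrix.of_apply, chartGram_diagFamily]
    by_cases h : i = j
    · subst h
      simp only [Matrix.diagonal_apply_eq, exCoef, ite_mul, zero_mul, Finset.sum_ite_eq',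
        Finset.mem_univ, if_true]
      split_ifs <;> ring
    · simp [h, Ne.symm h]
  · simp [ambGram, ambFrame, exA, exB, exC, dsig, sig, lam]
    by_cases h : o = i
    · simp [h]
      rw [h] at hχ
      field_simp
      ring
    · simp [h]
  · simp [ambGram, ambFrame, exA, exB, exC, dsig, sig]
    field_simp
    ring
  · simp [ambGram, ambFrame, exA, exB, exC, dsig, sig, lam]
    by_cases h : o = j
    · simp [h]
      rw [h] at hχ
      field_simp
      ring
    · simp [h]
  · simp [ambGram, ambFrame, exA, exB, exC, dsig, sig]
    field_simp
    ring

end Example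

/-! ### The example as a straight and normal ambient space. -/

section Example

variable {n : ℕ} (o : Fin n)

lemma ambRicci_ex (p : Eu n) (I J : AmbIdx n) {z : AmbCoord n} (hτ : 0 < z.1)
    (hρ : z.2.2 ∈ Set.Ioo (-(1 / 4 : ℝ)) (1 / 4)) :
    ambRicci (diagFamily (exCoef o)) p I J z = 0 := by
  refine ricci_eq_zero (E := exEta) (Ψ := exPsi o) exEta_symm
    (Eventually.of_forall fun _ a => (contDiff_exPsi o a).contDiffAt)
    (Eventually.of_forall fun z I J => ambGram_ex o p z I J) ?_ I J
  rw [ambGram_det, chartGram_diagFamily, Matrix.det_diagonal]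
  exact mul_ne_zero (neg_ne_zero.2 (pow_ne_zero _ (pow_ne_zero _ hτ.ne')))
    (Finset.prod_ne_zero_iff.2 fun k _ => (exCoef_pos o hρ _ k).ne')

lemma tendsto_ambRicci_ex (m : ℕ) {τ : ℝ} (x : Eu n) (hτ : 0 < τ) (I J : AmbIdx n) :
    Tendsto (fun z => ambRicci (diagFamily (exCoef o)) x I J z / z.2.2 ^ m) (ambNhds τ x)
      (𝓝 0) := by
  refine tendsto_const_nhds.congr' ?_
  have h1 : ∀ᶠ z : AmbCoord n in 𝓝 (τ, extChartAt (𝓡 n) x x, 0), 0 < z.1 :=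
    (isOpen_lt continuous_const continuous_fst).mem_nhds hτ
  have h2 : ∀ᶠ z : AmbCoord n in 𝓝 (τ, extChartAt (𝓡 n) x x, 0),
      z.2.2 ∈ Set.Ioo (-(1 / 4 : ℝ)) (1 / 4) :=
    (isOpen_Ioo.preimage (continuous_snd.comp continuous_snd)).mem_nhds
      (by constructor <;> norm_num)
  filter_upwards [h1.filter_mono nhdsWithin_le_nhds, h2.filter_mono nhdsWithin_le_nhds]
    with z hz1 hz2
  rw [ambRicci_ex o x I J hz1 hz2, zero_div]

lemma diagForm_symm (d : Fin n → ℝ) (v w : Eu n) : diagForm d v w = diagForm d w v := by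
  rw [diagForm_apply, diagForm_apply]
  exact Finset.sum_congr rfl fun k _ => by ring

lemma diagForm_pos {d : Fin n → ℝ} (hd : ∀ k, 0 < d k) {v : Eu n} (hv : v ≠ 0) :
    0 < diagForm d v v := by
  rw [diagForm_apply]
  obtain ⟨k, hk⟩ : ∃ k, v k ≠ 0 := by
    by_contra! h
    exact hv (PiLp.ext h)
  exact Finset.sum_pos' (fun k _ => mul_nonneg (hd k).le (mul_self_nonneg _))
    ⟨k, Finset.mem_univ k, mul_pos (hd k) (mul_self_pos.2 hk)⟩

/-- The straight and normal ambient space of the metric `χ⁻² |dx|²`, with `χ = 2 + sin x₀`. -/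
def exAmbient : Ambient n (Eu n) where
  ε := 1 / 4
  ε_pos := by norm_num
  g := diagFamily (exCoef o)
  smooth p i j := by
    simp only [chartGram_diagFamily, Matrix.diagonal_apply]
    split_ifs
    · exact (contDiff_exCoef o i).contDiffOn
    · exact contDiffOn_const
  symm _ _ _ v w := diagForm_symm _ v w
  pos _ hρ x _ hv := diagForm_pos (exCoef_pos o hρ x) hv
  ricci_odd _ m τ x hτ I J := tendsto_ambRicci_ex o m x hτ I J
  ricci_even _ τ x hτ := ⟨0, fun I J => tendsto_ambRicci_ex o _ x hτ I J, rfl, fun _ => ⟨rfl, rfl⟩,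
    by simp⟩

end Example

/-! ### Multiplication operators and commutators with them. -/

section Multiplication

variable {n : ℕ} {X : Type} [TopologicalSpace X] [ChartedSpace (EuclideanSpace ℝ (Fin n)) X]

/-- Multiplication by a smooth function. -/
def mulOp {f : X → ℝ} (hf : SmoothFn n f) : Module.End ℝ (compSub n X) where
  toFun u := ⟨fun x => f x * u.1 x, fun p => (hf p).mul (u.2.1 p), u.2.2.mul_left⟩
  map_add' u v := by
    ext x
    exact mul_add _ _ _
  map_smul' c u := by
    ext x
    exact mul_left_comm _ _ _

lemma mulOp_apply {f : X → ℝ} (hf : SmoothFn n f) (u : compSub n X) (x : X) :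
    (mulOp hf u).1 x = f x * u.1 x := rfl

lemma mulOp_mul {f h : X → ℝ} (hf : SmoothFn n f) (hh : SmoothFn n h) :
    mulOp hf * mulOp hh = mulOp (n := n) (f := fun x => f x * h x) fun p => (hf p).mul (hh p) := by
  ext u x
  exact (mul_assoc _ _ _).symm

lemma mulOp_comm {f h : X → ℝ} (hf : SmoothFn n f) (hh : SmoothFn n h) :
    mulOp hf * mulOp hh = mulOp hh * mulOp hf := by
  ext u x
  exact mul_left_comm _ _ _

lemma mulOp_pow_apply {f : X → ℝ} (hf : SmoothFn n f) (k : ℕ) (u : compSub n X) (x : X) :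
    ((mulOp hf ^ k) u).1 x = f x ^ k * u.1 x := by
  induction k with
  | zero => simp
  | succ k ih => rw [pow_succ', Module.End.mul_apply, mulOp_apply, ih, pow_succ', mul_assoc]

/-- The commutator `T ↦ T l - l T` with `l`. -/
def commOp {A : Type*} [Ring A] [Algebra ℝ A] (l : A) : A →ₗ[ℝ] A :=
  LinearMap.mulRight ℝ l - LinearMap.mulLeft ℝ l

lemma commOp_apply {A : Type*} [Ring A] [Algebra ℝ A] (l T : A) : commOp l T = T * l - l * T := rfl

lemma commOp_mul {A : Type*} [Ring A] [Algebra ℝ A] (l S T : A) :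
    commOp l (S * T) = commOp l S * T + S * commOp l T := by
  simp only [commOp_apply]
  noncomm_ring

end Multiplication

/-! ### Symbols of the coefficients of `ℳ(ρ)` in one coordinate direction. -/

section Symbols

variable {n : ℕ} (o : Fin n)

lemma smoothFn_eu {f : Eu n → ℝ} : SmoothFn n f ↔ ContDiff ℝ ∞ f := by
  simp only [SmoothFn, par_eu, tgt_eu, id, contDiffOn_univ]
  exact ⟨fun h => h 0, fun h _ => h⟩

lemma contDiff_coord : ContDiff ℝ ∞ fun x : Eu n => x o :=
  (EuclideanSpace.proj o : Eu n →L[ℝ] ℝ).contDiff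

/-- Multiplication by the coordinate `x₀`. -/
def coordOp : Module.End ℝ (compSub n (Eu n)) := mulOp (smoothFn_eu.2 (contDiff_coord o))

/-- Differentiation with respect to `x₀`. -/
def derivOp : Module.End ℝ (compSub n (Eu n)) where
  toFun u := ⟨pderiv (fr n) o u.1,
    smoothFn_eu.2 (contDiff_iff_contDiffAt.2 fun _ =>
      contDiffAt_pderiv (smoothFn_eu.1 u.2.1).contDiffAt o),
    u.2.2.mono' ((subset_tsupport _).trans (tsupport_pderiv_subset o))⟩
  map_add' u v := by
    ext x
    exact pderiv_add ((smoothFn_eu.1 u.2.1).differentiable (by simp) x)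
      ((smoothFn_eu.1 v.2.1).differentiable (by simp) x) o
  map_smul' c u := by
    ext x
    exact pderiv_const_mul c ((smoothFn_eu.1 u.2.1).differentiable (by simp) x) o

lemma derivOp_mulOp {f : Eu n → ℝ} (hf : ContDiff ℝ ∞ f) (hf' : ContDiff ℝ ∞ (pderiv (fr n) o f)) :
    derivOp o * mulOp (smoothFn_eu.2 hf) - mulOp (smoothFn_eu.2 hf) * derivOp o
      = mulOp (smoothFn_eu.2 hf') := by
  ext u x
  have := pderiv_mul (b := fr n) (hf.differentiable (by simp) x)
    ((smoothFn_eu.1 u.2.1).differentiable (by simp) x) o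
  change pderiv (fr n) o (fun x => f x * u.1 x) x - f x * pderiv (fr n) o u.1 x = _
  rw [this, mulOp_apply]
  ring

lemma pderiv_coord (i : Fin n) (x : Eu n) :
    pderiv (fr n) i (fun x : Eu n => x o) x = if i = o then 1 else 0 := by
  have : (fun x : Eu n => x o) = (EuclideanSpace.proj o : Eu n →L[ℝ] ℝ) := rfl
  rw [pderiv, this, ContinuousLinearMap.fderiv]
  simp [eq_comm]

variable (A : Ambient n (Eu n))

/-- The `(0,0)` component of the principal symbol of the coefficients of `ℳ(ρ)`. -/
def symb (i : ℕ) (x : Eu n) : ℝ := (A.bivCoef i).q x x o o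

/-- If the family of metrics is diagonal, the commutator of `ℳ_i` with `x₀` is a vector field along
`∂₀`, up to a function. -/
lemma commOp_coefMc (i : ℕ) (hq : ContDiff ℝ ∞ (symb o A i))
    (hdiag : ∀ x k, k ≠ o → (A.bivCoef i).q x x o k = 0)
    (he : ContDiff ℝ ∞ (A.density.lap (A.bivCoef i) fun x => x o)) :
    commOp (coordOp o) (A.coefMc i)
      = (2 : ℝ) • (mulOp (smoothFn_eu.2 hq) * derivOp o) + mulOp (smoothFn_eu.2 he) := by
  ext u x
  have h := divOp_mul (b := fr n) (μ := A.density.μ x) (q := (A.bivCoef i).q x) (y := x)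
    (f := fun x => x o) (h := u.1)
    ((A.density.smooth x).contDiffAt (by rw [tgt_eu]; exact univ_mem))
    (A.density.pos x x (by rw [tgt_eu]; trivial)).ne'
    (fun k l => ((A.bivCoef i).smooth x k l).contDiffAt (by rw [tgt_eu]; exact univ_mem))
    ((A.bivCoef i).symm x x (by rw [tgt_eu]; trivial))
    (contDiff_coord o).contDiffAt (smoothFn_eu.1 u.2.1).contDiffAt
  have hlap : ∀ v : Eu n → ℝ, A.density.lap (A.bivCoef i) v x
      = divOp (fr n) (A.density.μ x) ((A.bivCoef i).q x) v x := by
    intro v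
    simp only [Density.lap, par_eu, crd_eu, id]
  have hsum : ∑ k, ∑ l, (A.bivCoef i).q x x k l * pderiv (fr n) k (fun x : Eu n => x o) x
      * pderiv (fr n) l u.1 x = symb o A i x * pderiv (fr n) o u.1 x := by
    simp only [pderiv_coord]
    rw [Finset.sum_eq_single o (fun k _ hk => by simp [hk]) (by simp),
      Finset.sum_eq_single o (fun k _ hk => by simp [hdiag x k hk]) (by simp)]
    simp [symb]
  rw [hsum] at h
  change A.density.lap (A.bivCoef i) (fun x => x o * u.1 x) x + tcoef i (A.pot x) * (x o * u.1 x)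
      - x o * (A.density.lap (A.bivCoef i) u.1 x + tcoef i (A.pot x) * u.1 x)
    = 2 * (symb o A i x * pderiv (fr n) o u.1 x)
      + A.density.lap (A.bivCoef i) (fun x => x o) x * u.1 x
  rw [hlap, hlap, hlap, h]
  ring

end Symbols

/-! ### Principal parts of second-order operators and of their commutators. -/

section SecondOrder

variable {A : Type*} [Ring A] [Algebra ℝ A] {δ : A →ₗ[ℝ] A}

lemma hasSymbol_two (hδ : ∀ a b, δ (a * b) = δ a * b + a * δ b) {T q D e : A}
    (hT : δ T = (2 : ℝ) • (q * D) + e) (hD : δ D = 1) (hq : δ q = 0) (he : δ e = 0) :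
    HasSymbol δ 2 T q := by
  refine ⟨?_, hq⟩
  rw [pow_two, Module.End.mul_apply, hT, map_add, map_smul, hδ, hD, hq, he]
  simp

/-- The principal part is the Poisson bracket of `q ξ²` and `r ξ²`, namely `2 (q r' - r q') ξ³`. The
lower-order terms `e` and `f` drop out because they commute with `r` and `q`. -/
lemma hasSymbol_commutator (hδ : ∀ a b, δ (a * b) = δ a * b + a * δ b)
    {S T q r D e f q' r' : A}
    (hS : δ S = (2 : ℝ) • (q * D) + e) (hT : δ T = (2 : ℝ) • (r * D) + f) (hD : δ D = 1)
    (hq : δ q = 0) (hr : δ r = 0) (he : δ e = 0) (hf : δ f = 0) (hq' : δ q' = 0) (hr' : δ r' = 0)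
    (hDq : D * q - q * D = q') (hDr : D * r - r * D = r') (hqr : q * r = r * q)
    (her : e * r = r * e) (hfq : f * q = q * f) :
    HasSymbol δ 3 (S * T - T * S) ((2 : ℝ) • (q * r' - r * q')) := by
  have hS2 : δ ((2 : ℝ) • (q * D) + e) = (2 : ℝ) • q := by
    rw [map_add, map_smul, hδ, hD, hq, he]; simp
  have hT2 : δ ((2 : ℝ) • (r * D) + f) = (2 : ℝ) • r := by
    rw [map_add, map_smul, hδ, hD, hr, hf]; simp
  refine ⟨?_, by simp [hδ, hq, hr, hq', hr']⟩
  set P := (2 : ℝ) • (q * D) + e with hP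
  set Q := (2 : ℝ) • (r * D) + f with hQ
  have h3 : (δ ^ 3) (S * T - T * S) = (6 : ℝ) • (q * Q - Q * q + (P * r - r * P)) := by
    simp only [pow_succ, pow_zero, one_mul, Module.End.mul_apply, map_add, map_sub, map_smul, hδ, hS,
      hT, hS2, hT2, hq, hr, smul_mul_assoc, mul_smul_comm, zero_mul, mul_zero]
    module
  have h4 : q * Q - Q * q + (P * r - r * P) = (2 : ℝ) • (q * r' - r * q') := by
    have e1 : q * Q - Q * q = (2 : ℝ) • (q * r * D - r * (D * q)) := by
      rw [hQ, mul_add, add_mul, hfq, mul_smul_comm, smul_mul_assoc, mul_assoc, mul_assoc]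
      module
    have e2 : P * r - r * P = (2 : ℝ) • (q * (D * r) - r * q * D) := by
      rw [hP, mul_add, add_mul, her, mul_smul_comm, smul_mul_assoc, mul_assoc, mul_assoc]
      module
    rw [e1, e2, hqr, ← hDq, ← hDr, mul_sub, mul_sub, ← mul_assoc q r D, ← mul_assoc r q D, hqr]
    module
  rw [h3, h4]
  norm_num [Nat.factorial]

end SecondOrder

/-! ### Symbols in the example and the determination of `L`. -/

section Example

variable {n : ℕ} (o : Fin n)

lemma bivCoef_exAmbient (i : ℕ) (p y : Eu n) (k l : Fin n) :
    ((exAmbient o).bivCoef i).q p y k l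
      = if k = l then tcoef i fun r => (exCoef o r y k)⁻¹ else 0 := by
  have h : ∀ r ∈ (exAmbient o).J, (exAmbient o).ginv p r y k l
      = if k = l then (exCoef o r y k)⁻¹ else 0 := by
    intro r hr
    have h0 : ∀ k, exCoef o r y k ≠ 0 := fun k => (exCoef_pos o hr y k).ne'
    change (chartGram (diagFamily (exCoef o)) p r y)⁻¹ k l = _
    rw [chartGram_diagFamily, Matrix.inv_eq_right_inv
      (B := Matrix.diagonal fun k => (exCoef o r y k)⁻¹)
      (by simp [Matrix.diagonal_mul_diagonal, h0]), Matrix.diagonal_apply]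
  have h2 : ((exAmbient o).bivCoef i).q p y k l
      = tcoef i fun r => if k = l then (exCoef o r y k)⁻¹ else 0 :=
    tcoef_congr (by
      filter_upwards [(exAmbient o).isOpen_J.mem_nhds (exAmbient o).zero_mem_J] with r hr
      exact h r hr) i
  rw [h2]
  split_ifs
  · rfl
  · rw [tcoef_const]; split_ifs <;> rfl

lemma symb_exAmbient (i : ℕ) (x : Eu n) :
    symb o (exAmbient o) i x = tcoef i fun r => (lam (x o) r ^ 2)⁻¹ := by
  simp [symb, bivCoef_exAmbient, exCoef]

lemma contDiff_symb (i : ℕ) : ContDiff ℝ ∞ (symb o (exAmbient o) i) := by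
  have h := ((exAmbient o).bivCoef i).smooth 0 o o
  rw [tgt_eu, contDiffOn_univ] at h
  have e : symb o (exAmbient o) i = fun y => ((exAmbient o).bivCoef i).q 0 y o o := by
    ext x; simp only [symb, bivCoef_exAmbient]
  rwa [e]

lemma symb_zero (x : Eu n) : symb o (exAmbient o) 0 x = chi (x o) ^ 2 := by
  rw [symb_exAmbient, tcoef_zero, lam_eq]
  simp

lemma symb_one (x : Eu n) : symb o (exAmbient o) 1 x
    = chi (x o) ^ 2 * Real.cos (x o) ^ 2 + 2 * chi (x o) ^ 3 * Real.sin (x o) := by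
  rw [symb_exAmbient, tcoef, iteratedDeriv_one, Nat.factorial_one, Nat.cast_one, div_one]
  have hc := (chi_pos (x o)).ne'
  set a := Real.cos (x o) ^ 2 / 2 + chi (x o) * Real.sin (x o) with ha
  have h1 : HasDerivAt (fun r => lam (x o) r) (-a / chi (x o)) 0 := by
    simp only [lam_eq, ← ha]
    have := (((hasDerivAt_id (0 : ℝ)).mul_const a).const_sub 1).div_const (chi (x o))
    simpa using this
  have h0 : lam (x o) 0 = 1 / chi (x o) := by rw [lam_eq]; simp
  have h2 := (h1.pow 2).inv (by rw [Pi.pow_apply, h0]; positivity)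
  have h3 : deriv (fun r => (lam (x o) r ^ 2)⁻¹) 0 = _ := h2.deriv
  rw [h3, Pi.pow_apply, h0, ha]
  generalize chi (x o) = c at hc
  push_cast
  field_simp

lemma pderiv_comp_coord {f : ℝ → ℝ} {f' : ℝ} {x : Eu n} (hf : HasDerivAt f f' (x o)) :
    pderiv (fr n) o (fun x : Eu n => f (x o)) x = f' := by
  have h : HasFDerivAt (fun x : Eu n => x o) (EuclideanSpace.proj o : Eu n →L[ℝ] ℝ) x :=
    (EuclideanSpace.proj o : Eu n →L[ℝ] ℝ).hasFDerivAt
  have h2 := (hf.comp_hasFDerivAt x h).fderiv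
  rw [pderiv, show (fun x : Eu n => f (x o)) = f ∘ fun x : Eu n => x o from rfl, h2]
  simp

lemma hasDerivAt_chi (s : ℝ) : HasDerivAt chi (Real.cos s) s :=
  (Real.hasDerivAt_sin s).const_add 2

/-- The symbol of the commutator of `ℳ₀` and `ℳ₁`. -/
def exKappa (x : Eu n) : ℝ :=
  2 * (symb o (exAmbient o) 0 x * pderiv (fr n) o (symb o (exAmbient o) 1) x
    - symb o (exAmbient o) 1 x * pderiv (fr n) o (symb o (exAmbient o) 0) x)

/-- Only nonvanishing matters. At the origin `χ = 2` and both symbols equal `4`, but their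
derivatives are `4` and `20`, so the commutator of the first two coefficients has a nonzero
principal part. -/
lemma exKappa_zero : exKappa o 0 = 128 := by
  have h0 : pderiv (fr n) o (symb o (exAmbient o) 0) 0 = 4 := by
    rw [funext (symb_zero o), pderiv_comp_coord o (f := fun s => chi s ^ 2) ((hasDerivAt_chi _).pow 2)]
    norm_num [chi]
  have h1 : pderiv (fr n) o (symb o (exAmbient o) 1) 0 = 20 := by
    rw [funext (symb_one o), pderiv_comp_coord o
      (f := fun s => chi s ^ 2 * Real.cos s ^ 2 + 2 * chi s ^ 3 * Real.sin s)
      ((((hasDerivAt_chi _).pow 2).mul ((Real.hasDerivAt_cos _).pow 2)).add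
        ((((hasDerivAt_chi _).pow 3).const_mul 2).mul (Real.hasDerivAt_sin _)))]
    norm_num [chi]
  rw [exKappa, h0, h1, symb_zero, symb_one]
  norm_num [chi]

lemma contDiff_pderiv_symb (i : ℕ) : ContDiff ℝ ∞ (pderiv (fr n) o (symb o (exAmbient o) i)) :=
  contDiff_iff_contDiffAt.2 fun _ => contDiffAt_pderiv (contDiff_symb o i).contDiffAt o

lemma commOp_mulOp {f : Eu n → ℝ} (hf : SmoothFn n f) : commOp (coordOp o) (mulOp hf) = 0 := by
  rw [commOp_apply, coordOp, mulOp_comm, sub_self]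

lemma commOp_derivOp : commOp (coordOp o) (derivOp o) = 1 := by
  have h : pderiv (fr n) o (fun x : Eu n => x o) = fun _ => 1 := by
    ext x; simp [pderiv_coord]
  rw [commOp_apply, coordOp, derivOp_mulOp o (contDiff_coord o) (by rw [h]; exact contDiff_const)]
  ext u x
  rw [mulOp_apply, h]
  simp

lemma contDiff_exKappa : ContDiff ℝ ∞ (exKappa o) :=
  contDiff_const.mul (((contDiff_symb o 0).mul (contDiff_pderiv_symb o 1)).sub
    ((contDiff_symb o 1).mul (contDiff_pderiv_symb o 0)))

lemma commOp_coefMc_exAmbient (i : ℕ) : ∃ e, ∃ he : SmoothFn n e,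
    commOp (coordOp o) ((exAmbient o).coefMc i)
      = (2 : ℝ) • (mulOp (smoothFn_eu.2 (contDiff_symb o i)) * derivOp o) + mulOp he :=
  ⟨_, _, commOp_coefMc o (exAmbient o) i (contDiff_symb o i)
    (fun x k hk => by rw [bivCoef_exAmbient, if_neg (Ne.symm hk)])
    (smoothFn_eu.1 ((exAmbient o).density.smoothFn_lap ((exAmbient o).bivCoef i)
      (smoothFn_eu.2 (contDiff_coord o))))⟩

lemma hasSymbol_coefMc (i : ℕ) : HasSymbol (commOp (coordOp o)) 2 ((exAmbient o).coefMc i)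
    (mulOp (smoothFn_eu.2 (contDiff_symb o i))) := by
  obtain ⟨e, he, h⟩ := commOp_coefMc_exAmbient o i
  exact hasSymbol_two (commOp_mul _) h (commOp_derivOp o) (commOp_mulOp o _) (commOp_mulOp o _)

lemma hasSymbol_exKappa : HasSymbol (commOp (coordOp o)) 3
    ((exAmbient o).coefMc 0 * (exAmbient o).coefMc 1
      - (exAmbient o).coefMc 1 * (exAmbient o).coefMc 0)
    (mulOp (smoothFn_eu.2 (contDiff_exKappa o))) := by
  obtain ⟨e, he, h⟩ := commOp_coefMc_exAmbient o 0
  obtain ⟨f, hf, h'⟩ := commOp_coefMc_exAmbient o 1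
  have := hasSymbol_commutator (commOp_mul _) h h' (commOp_derivOp o) (commOp_mulOp o _)
    (commOp_mulOp o _) (commOp_mulOp o _) (commOp_mulOp o _) (commOp_mulOp o _) (commOp_mulOp o _)
    (derivOp_mulOp o (contDiff_symb o 0) (contDiff_pderiv_symb o 0))
    (derivOp_mulOp o (contDiff_symb o 1) (contDiff_pderiv_symb o 1))
    (mulOp_comm _ _) (mulOp_comm _ _) (mulOp_comm _ _)
  convert this using 1
  rw [mulOp_mul, mulOp_mul]
  ext u x
  change exKappa o x * u.1 x = 2 * (symb o (exAmbient o) 0 x * _ * u.1 x - _ * _ * u.1 x)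
  rw [exKappa]
  ring

lemma exists_compSub_eq_one : ∃ u : compSub n (Eu n), u.1 0 = 1 := by
  obtain ⟨f⟩ : Nonempty (ContDiffBump (0 : Eu n)) := inferInstance
  exact ⟨⟨f, smoothFn_eu.2 f.contDiff, f.hasCompactSupport⟩,
    f.one_of_mem_closedBall (Metric.mem_closedBall_self f.rIn_pos.le)⟩

end Example

/-- For the conformally flat example, self-adjointness determines `L`. -/
theorem eq_add_of_formallySelfAdjointOn_exAmbient {n M N : ℕ} (o : Fin n) (hK : 3 ≤ M - N) {L : ℝ}
    (hL : ∀ j < N, L ≠ (M : ℝ) + j)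
    (h : (exAmbient o).FormallySelfAdjointOn ((exAmbient o).DP M N L)) : L = (M : ℝ) + N := by
  have hNM : N ≤ M := by omega
  obtain ⟨k, hk⟩ := Nat.exists_eq_add_of_le' hK
  have h1 := (exAmbient o).wordCoeff_eq_reverse_of_formallySelfAdjointOn hNM hL h
  -- The word equals its reverse, so the principal part computed here must vanish; it is tested
  -- below on a function equal to `1` at the origin.
  have h2 := (wordCoeff_sub_reverse (commOp_mul _) (hasSymbol_coefMc o) (L - 2 * N)
    (hasSymbol_exKappa o) (mulOp_comm _ _) k).1
  rw [hk] at h1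
  rw [h1, map_zero, eq_comm, smul_eq_zero] at h2
  have h3 := h2.resolve_left (by exact_mod_cast (Nat.factorial_ne_zero _))
  obtain ⟨u, hu⟩ := exists_compSub_eq_one (n := n)
  have h4 := congrArg (fun T : Module.End ℝ (compSub n (Eu n)) => (T u).1 0) h3
  change _ * ((mulOp _ ^ k) (mulOp _ u)).1 0 = 0 at h4
  rw [mulOp_pow_apply, mulOp_apply, hu, exKappa_zero, symb_zero] at h4
  -- The pair `(k+1, 0)` contributes `(k+1)²`. For words of length two the corresponding sum is
  -- zero, whence the bound `3 ≤ M - N`.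
  have h5 : 0 < ∑ p ∈ Finset.HasAntidiagonal.antidiagonal (k + 1), ((p.1 : ℝ) - p.2) ^ 2 :=
    Finset.sum_pos' (fun _ _ => sq_nonneg _) ⟨(k + 1, 0), by simp, by
      have : (((k + 1 : ℕ) : ℝ) - (0 : ℕ)) = k + 1 := by push_cast; ring
      rw [this]; positivity⟩
  have h6 : (chi ((0 : Eu n) o) ^ 2) ^ k ≠ 0 := pow_ne_zero _ (pow_ne_zero _ (chi_pos _).ne')
  have h7 : L - 2 * N - (k + 3) = 0 := by
    by_contra h8
    exact mul_ne_zero (mul_ne_zero h8 h5.ne') (mul_ne_zero h6 (by norm_num)) h4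
  have h9 : (M : ℝ) = k + 3 + N := by
    have : M = k + 3 + N := by omega
    exact_mod_cast this
  linarith

end AmbientGJMS

end

theorem mainTheorem8 (M N : ℕ) (hNM : N ≤ M) :
    ∃ c : ℝ, c ≠ 0 ∧
      ∀ n : ℕ, 1 ≤ n → (Even n → 2 * (M - N) ≤ n) → ∀ L : ℝ,
        (3 ≤ M - N → (∀ j : ℕ, j < N → L ≠ (M : ℝ) + j) →
          (AmbientGJMS.DPFormallySelfAdjoint n M N L ↔ L = (M : ℝ) + N)) ∧
        (L = (M : ℝ) + N →
          AmbientGJMS.DPFormallySelfAdjoint n M N L ∧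
          ∀ (X : Type) [TopologicalSpace X] [T2Space X] [SecondCountableTopology X]
            [ChartedSpace (EuclideanSpace ℝ (Fin n)) X] [IsManifold (𝓡 n) ∞ X]
            (A : AmbientGJMS.Ambient n X) (u : X → ℝ), ContMDiff (𝓡 n) 𝓘(ℝ, ℝ) ∞ u →
              ∀ x : X, A.DP M N L u x = c * A.gjms (M - N) u x) := by
  have hself : ∀ n, AmbientGJMS.DPFormallySelfAdjoint n M N ((M : ℝ) + N) :=
    fun n X _ _ _ _ _ _ _ A => A.DP_formallySelfAdjointOn hNM
  refine ⟨AmbientGJMS.gjmsConst M N, AmbientGJMS.gjmsConst_ne_zero hNM, fun n hn _ L => ⟨?_, ?_⟩⟩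
  · intro hK hL
    refine ⟨fun h => ?_, fun h => h ▸ hself n⟩
    -- A single ambient space decides necessity, and `1 ≤ n` supplies the distinguished coordinate.
    exact AmbientGJMS.eq_add_of_formallySelfAdjointOn_exAmbient ⟨0, hn⟩ hK hL
      (h (AmbientGJMS.Eu n) (AmbientGJMS.exAmbient _))
  · rintro rfl
    refine ⟨hself n, fun X _ _ _ _ _ A u hu x => ?_⟩
    exact congrFun (A.DP_eq_gjms hNM ⟨u, AmbientGJMS.smoothFn_of_contMDiff hu⟩) x
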